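/- Let $N=n_1+\dots+n_r$ be a partition into positive integers and let $\mathcal V_{lk}\subset \mathrm{Mat}(n_l,n_k;\mathbb R)$ $(1\le k<l\le r)$ be vector spaces such that (V1) $A\in\mathcal V_{lk},\,B\in\mathcal V_{kj}\Rightarrow AB\in\mathcal V_{lj}$ and (V2) $A\in\mathcal V_{lj},\,B\in\mathcal V_{kj}\Rightarrow A\,{}^tB\in\mathcal V_{lk}$ for $j<k<l$, and (V3) $A\in\mathcal V_{lk}\Rightarrow A\,{}^tA\in\mathbb R I_{n_l}$. Put $n_{lk}=\dim\mathcal V_{lk}$ and define the inner product $(\cdot|\cdot)$ on $\mathcal V_{lk}$ by $A\,{}^tA=(A|A)I_{n_l}$. Let $\mathcal Z$ be the space of symmetric $N\times N$ block matrices $y=(Y_{lk})$ with $Y_{kk}=y_{kk}I_{n_k}$, $y_{kk}\in\mathbb R$, and $Y_{lk}\in\mathcal V_{lk}$ for $k<l$, with the inner product $\langle y,y'\rangle=\sum_k y_{kk}y'_{kk}+2\sum_{k<l}(Y_{lk}|Y'_{lk})$. Let $\mathcal P\subset\mathcal Z$ be the cone of positive definite elements, and $\mathcal P^*=\{\eta\in\mathcal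 Z:\langle y,\eta\rangle>0 \text{ for all } y\in\overline{\mathcal P}\setminus\{0\}\}$. Let $H$ be the group of block lower triangular matrices $T=(T_{lk})$ with $T_{kk}=t_{kk}I_{n_k}$, $t_{kk}>0$, and $T_{lk}\in\mathcal V_{lk}$ for $k<l$. It acts on $\mathcal Z$ by $\rho(T)y=Ty\,{}^tT$; let $\rho^*(T)$ be the adjoint of $\rho(T)$. For $\sigma\in\mathbb C^r$ put $\chi_\sigma(T)=\prod_k t_{kk}^{2\sigma_k}$ and $\sigma^*=(\sigma_r,\dots,\sigma_1)$, and let $\Delta^*_\sigma$ be the function on $\mathcal P^*=\rho^*(H)I_N$ with $\Delta^*_\sigma(\rho^*(T)I_N)=\chi_{\sigma^*}(T)$. The Gindikin–Riesz distribution $\mathcal R_\sigma$ is the tempered distribution on $\mathcal Z$ with support in $\overline{\mathcal P}$ and Laplace transform $$\mathcal R_\sigma\bigl(e^{\langle y,\theta\rangle}\bigr)=\Delta^*_{-\sigma^*}(-\theta)\qquad(\theta\in-\mathcal P^*),$$ where $\mathcal R_\sigma(e^{\langle y,\theta\rangle})$ means the value of $\mathcal R_\sigma$ on any Schwartz function that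 coincides with $e^{\langle y,\theta\rangle}$ on a neighbourhood of $\overline{\mathcal P}$. Let $\varepsilon\in\{0,1\}^r$ be non-zero and $I(\varepsilon)=\{i:\varepsilon_i=1\}$. Let $W^i$ be the space of $N\times n_i$ matrices with blocks $X_{li}=0$ for $l<i$, $X_{ii}=x_{ii}I_{n_i}$ with $x_{ii}\in\mathbb R$, and $X_{li}\in\mathcal V_{li}$ for $l>i$. Let $W^\varepsilon=\bigoplus_{i\in I(\varepsilon)}W^i$ with the norm $\|x\|^2=\sum_{i\in I(\varepsilon)}\bigl(x_{ii}^2+\sum_{l>i}(X_{li}|X_{li})\bigr)$ and the corresponding Lebesgue measure $dx$, let $W^{\varepsilon,+}=\{x\in W^\varepsilon: x_{ii}>0 \text{ for } i\in I(\varepsilon)\}$, and let the standard quadratic map $q^\varepsilon:W^\varepsilon\to\mathcal Z$ be $q^\varepsilon(x)=\sum_{i\in I(\varepsilon)}x_i\,{}^tx_i$. Let $u\in R_+(\varepsilon)$, that is, $u\in\mathbb R^r$, $u_i=0$ if $\varepsilon_i=0$ and $u_i>0$ if $\varepsilon_i=1$. Define the measure on $W^{\varepsilon,+}$ $$\mathcal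 M_u^\varepsilon(dx)=\frac{1}{\Gamma_\varepsilon(u)}\prod_{i\in I(\varepsilon)}x_{ii}^{2u_i-1}\,dx,\qquad \Gamma_\varepsilon(u)=\pi^{\dim W^\varepsilon/2}\prod_{i\in I(\varepsilon)}\frac{\Gamma(u_i)}{2\sqrt\pi}.$$ Put $\sigma=u+p(\varepsilon)/2$, where $p_k(\varepsilon)=\sum_{i<k}\varepsilon_i n_{ki}$. Then $\mathcal R_\sigma$ exists, is unique, and is the image of $\mathcal M_u^\varepsilon$ under $q^\varepsilon$: every Schwartz function $f$ on $\mathcal Z$ is integrable for the image measure $q^\varepsilon_*\mathcal M_u^\varepsilon$, and $\mathcal R_\sigma(f)=\int f\,d(q^\varepsilon_*\mathcal M_u^\varepsilon)$. In particular $\mathcal R_\sigma$ is a positive measure on the orbit $\mathcal O_\varepsilon=\rho(H)E_\varepsilon$, where $E_\varepsilon$ is the block diagonal matrix with blocks $\varepsilon_kI_{n_k}$; that is, the complement of $\mathcal O_\varepsilon$ is a null set for the image measure. -/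

import Mathlib

open scoped SchwartzMap Topology

noncomputable section

namespace GindikinRiesz

/-! ### Systems of block spaces -/

/-- A partition `N = n_1 + ⋯ + n_r` into positive parts and a system of vector spaces
`V_{lk} ⊆ Mat(n_l, n_k; ℝ)`, `k < l`, with the properties (V1)-(V3). The components `V l k` with
`l ≤ k` play no role. -/
structure BlockSystem (r : ℕ) (n : Fin r → ℕ) where
  npos : ∀ k, 0 < n k
  V : ∀ l k : Fin r, Submodule ℝ (Matrix (Fin (n l)) (Fin (n k)) ℝ)
  V1 : ∀ {j k l : Fin r}, j < k → k < l →
    ∀ A ∈ V l k, ∀ B ∈ V k j, A * B ∈ V l j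
  V2 : ∀ {j k l : Fin r}, j < k → k < l →
    ∀ A ∈ V l j, ∀ B ∈ V k j, A * B.transpose ∈ V l k
  V3 : ∀ {k l : Fin r}, k < l →
    ∀ A ∈ V l k, ∃ c : ℝ, A * A.transpose = c • (1 : Matrix (Fin (n l)) (Fin (n l)) ℝ)

/-- Row indices of matrices of size `N = n_1 + ⋯ + n_r`: a block number and an index within the
block. -/
abbrev Idx {r : ℕ} (n : Fin r → ℕ) : Type := Σ k : Fin r, Fin (n k)

/-- The `(l,k)`-block of an `N × N` matrix. -/
def blk {r : ℕ} {n : Fin r → ℕ} (M : Matrix (Idx n) (Idx n) ℝ) (l k : Fin r) :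
    Matrix (Fin (n l)) (Fin (n k)) ℝ :=
  M.submatrix (fun a => (⟨l, a⟩ : Idx n)) (fun b => (⟨k, b⟩ : Idx n))

/-- The `l`-th block of an `N × m` matrix. -/
def colBlk {r : ℕ} {n : Fin r → ℕ} {m : ℕ} (x : Matrix (Idx n) (Fin m) ℝ) (l : Fin r) :
    Matrix (Fin (n l)) (Fin m) ℝ :=
  x.submatrix (fun a => (⟨l, a⟩ : Idx n)) id

/-- The number `c` for which `A = c I_m` if `A` is a scalar matrix of positive size. -/
def scal {m : ℕ} (A : Matrix (Fin m) (Fin m) ℝ) : ℝ := A.trace / m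

theorem scal_smul_one {m : ℕ} (hm : 0 < m) (c : ℝ) :
    scal (c • (1 : Matrix (Fin m) (Fin m) ℝ)) = c := by
  have : (m : ℝ) ≠ 0 := by exact_mod_cast hm.ne'
  simp [scal, Matrix.trace_smul, this]

/-- The inner product on `V_{lk}`: `A Aᵀ = (A|A) I`. -/
def ip {m m' : ℕ} (A B : Matrix (Fin m) (Fin m') ℝ) : ℝ := scal (A * B.transpose)

theorem ip_comm {m m' : ℕ} (A B : Matrix (Fin m) (Fin m') ℝ) : ip A B = ip B A := by
  unfold ip scal
  rw [← Matrix.trace_transpose (A * B.transpose)]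
  simp

theorem ip_add_left {m m' : ℕ} (A B C : Matrix (Fin m) (Fin m') ℝ) :
    ip (A + B) C = ip A C + ip B C := by
  simp [ip, scal, Matrix.add_mul, add_div]

theorem ip_smul_left {m m' : ℕ} (c : ℝ) (A B : Matrix (Fin m) (Fin m') ℝ) :
    ip (c • A) B = c * ip A B := by
  simp [ip, scal, mul_div_assoc]

theorem ip_self_nonneg {m m' : ℕ} (A : Matrix (Fin m) (Fin m') ℝ) : 0 ≤ ip A A := by
  unfold ip scal
  apply div_nonneg _ (Nat.cast_nonneg _)
  simp only [Matrix.trace, Matrix.diag, Matrix.mul_apply, Matrix.transpose_apply]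
  exact Finset.sum_nonneg fun i _ => Finset.sum_nonneg fun j _ => mul_self_nonneg _

theorem ip_self_eq_zero {m m' : ℕ} {A : Matrix (Fin m) (Fin m') ℝ} (h : ip A A = 0) : A = 0 := by
  rcases Nat.eq_zero_or_pos m with rfl | hm
  · ext i; exact i.elim0
  · have hm' : (m : ℝ) ≠ 0 := by exact_mod_cast hm.ne'
    have : (A * A.conjTranspose).trace = 0 := by
      rw [Matrix.conjTranspose_eq_transpose_of_trivial]
      simpa [ip, scal, hm'] using h
    exact Matrix.trace_mul_conjTranspose_self_eq_zero_iff.1 this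

theorem scal_add {m : ℕ} (A B : Matrix (Fin m) (Fin m) ℝ) : scal (A + B) = scal A + scal B := by
  simp [scal, add_div]

theorem scal_smul {m : ℕ} (c : ℝ) (A : Matrix (Fin m) (Fin m) ℝ) :
    scal (c • A) = c * scal A := by
  simp [scal, mul_div_assoc]

variable {r : ℕ} {n : Fin r → ℕ}

/-- On `V_{lk}` the form `ip` is the inner product determined by `A Aᵀ = (A|A) I`. -/
theorem BlockSystem.mul_transpose_self (𝒱 : BlockSystem r n) {k l : Fin r} (h : k < l)
    {A : Matrix (Fin (n l)) (Fin (n k)) ℝ} (hA : A ∈ 𝒱.V l k) :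
    A * A.transpose = ip A A • (1 : Matrix (Fin (n l)) (Fin (n l)) ℝ) := by
  obtain ⟨c, hc⟩ := 𝒱.V3 h A hA
  rw [ip, hc, scal_smul_one (𝒱.npos l)]

/-- `n_{lk} = dim V_{lk}`. -/
def BlockSystem.dimV (𝒱 : BlockSystem r n) (l k : Fin r) : ℕ := Module.finrank ℝ (𝒱.V l k)

/-! ### The space `Z_V` with its inner product -/

/-- `Z_V` as a space of symmetric `N × N` matrices. -/
def ZSub (𝒱 : BlockSystem r n) : Submodule ℝ (Matrix (Idx n) (Idx n) ℝ) where
  carrier := {y | y.IsSymm ∧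
    (∀ k, ∃ c : ℝ, blk y k k = c • (1 : Matrix (Fin (n k)) (Fin (n k)) ℝ)) ∧
    ∀ k l, k < l → blk y l k ∈ 𝒱.V l k}
  add_mem' := by
    rintro x y ⟨hx1, hx2, hx3⟩ ⟨hy1, hy2, hy3⟩
    refine ⟨hx1.add hy1, fun k => ?_, fun k l h => (𝒱.V l k).add_mem (hx3 k l h) (hy3 k l h)⟩
    obtain ⟨c, hc⟩ := hx2 k
    obtain ⟨d, hd⟩ := hy2 k
    refine ⟨c + d, ?_⟩
    rw [add_smul, ← hc, ← hd]
    rfl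
  zero_mem' := ⟨Matrix.isSymm_zero, fun k => ⟨0, by rw [zero_smul]; rfl⟩,
    fun k l _ => (𝒱.V l k).zero_mem⟩
  smul_mem' := by
    rintro a x ⟨hx1, hx2, hx3⟩
    refine ⟨hx1.smul a, fun k => ?_, fun k l h => (𝒱.V l k).smul_mem a (hx3 k l h)⟩
    obtain ⟨c, hc⟩ := hx2 k
    refine ⟨a * c, ?_⟩
    rw [mul_smul, ← hc]
    rfl

/-- The vector space `Z_V`, to be equipped with the inner product `⟨y, y'⟩` below and the norm
that comes from it. -/
def ZSp (𝒱 : BlockSystem r n) : Type := ↥(ZSub 𝒱)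

namespace ZSp

variable {𝒱 : BlockSystem r n}

instance instAddCommGroup : AddCommGroup (ZSp 𝒱) := inferInstanceAs (AddCommGroup ↥(ZSub 𝒱))
instance instModule : Module ℝ (ZSp 𝒱) := inferInstanceAs (Module ℝ ↥(ZSub 𝒱))
instance instFiniteDimensional : FiniteDimensional ℝ (ZSp 𝒱) :=
  inferInstanceAs (FiniteDimensional ℝ ↥(ZSub 𝒱))

/-- The underlying matrix. -/
def toMat : ZSp 𝒱 →ₗ[ℝ] Matrix (Idx n) (Idx n) ℝ := (ZSub 𝒱).subtype

theorem toMat_mem (y : ZSp 𝒱) : toMat y ∈ ZSub 𝒱 := y.2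

/-- `⟨y, y'⟩ = ∑_k y_{kk} y'_{kk} + 2 ∑_{k<l} (Y_{lk} | Y'_{lk})`. -/
def cpl (y y' : ZSp 𝒱) : ℝ :=
  ∑ k, scal (blk (toMat y) k k) * scal (blk (toMat y') k k)
    + 2 * ∑ k, ∑ l ∈ Finset.Ioi k, ip (blk (toMat y) l k) (blk (toMat y') l k)

theorem eq_zero_of_cpl {y : ZSp 𝒱} (h : cpl y y = 0) : y = 0 := by
  have h1 : 0 ≤ ∑ k, scal (blk (toMat y) k k) * scal (blk (toMat y) k k) :=
    Finset.sum_nonneg fun _ _ => mul_self_nonneg _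
  have h2' : ∀ k, 0 ≤ ∑ l ∈ Finset.Ioi k, ip (blk (toMat y) l k) (blk (toMat y) l k) :=
    fun k => Finset.sum_nonneg fun _ _ => ip_self_nonneg _
  have h2 : 0 ≤ ∑ k, ∑ l ∈ Finset.Ioi k, ip (blk (toMat y) l k) (blk (toMat y) l k) :=
    Finset.sum_nonneg fun k _ => h2' k
  have h3 : ∑ k, scal (blk (toMat y) k k) * scal (blk (toMat y) k k) = 0 := by
    unfold cpl at h; linarith
  have h4 : ∑ k, ∑ l ∈ Finset.Ioi k, ip (blk (toMat y) l k) (blk (toMat y) l k) = 0 := by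
    unfold cpl at h; linarith
  obtain ⟨hs, hd, -⟩ := y.toMat_mem
  have hdiag : ∀ k, blk (toMat y) k k = 0 := by
    intro k
    have := (Finset.sum_eq_zero_iff_of_nonneg fun _ _ => mul_self_nonneg _).1 h3 k
      (Finset.mem_univ k)
    obtain ⟨c, hc⟩ := hd k
    rw [hc, scal_smul_one (𝒱.npos k)] at this
    rw [hc, mul_self_eq_zero.1 this, zero_smul]
  have hlow : ∀ k l, k < l → blk (toMat y) l k = 0 := by
    intro k l hkl
    have := (Finset.sum_eq_zero_iff_of_nonneg fun k _ => h2' k).1 h4 k (Finset.mem_univ k)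
    exact ip_self_eq_zero ((Finset.sum_eq_zero_iff_of_nonneg fun _ _ => ip_self_nonneg _).1 this l
      (Finset.mem_Ioi.2 hkl))
  apply Subtype.ext
  change toMat y = 0
  ext ⟨l, a⟩ ⟨k, b⟩
  rcases lt_trichotomy k l with h | rfl | h
  · exact congrFun (congrFun (hlow k l h) a) b
  · exact congrFun (congrFun (hdiag k) a) b
  · rw [← hs.apply]
    exact congrFun (congrFun (hlow l k h) b) a

/-- The inner product on `Z_V`. -/
@[reducible]
def core (𝒱 : BlockSystem r n) : InnerProductSpace.Core ℝ (ZSp 𝒱) where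
  inner := cpl
  conj_inner_symm x y := by
    simp only [cpl, conj_trivial]
    congr 1
    · exact Finset.sum_congr rfl fun _ _ => mul_comm _ _
    · simp only [ip_comm]
  re_inner_nonneg x := by
    change 0 ≤ cpl x x
    exact add_nonneg (Finset.sum_nonneg fun _ _ => mul_self_nonneg _)
      (mul_nonneg zero_le_two (Finset.sum_nonneg fun _ _ => Finset.sum_nonneg fun _ _ =>
        ip_self_nonneg _))
  add_left x y z := by
    have h : ∀ l k, blk (toMat (x + y)) l k = blk (toMat x) l k + blk (toMat y) l k := by
      intro l k; rw [map_add]; rfl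
    simp only [cpl, h, scal_add, ip_add_left, add_mul, Finset.sum_add_distrib]
    ring
  smul_left x y c := by
    have h : ∀ l k, blk (toMat (c • x)) l k = c • blk (toMat x) l k := by
      intro l k; rw [map_smul]; rfl
    simp only [cpl, h, scal_smul, ip_smul_left, conj_trivial, mul_assoc, ← Finset.mul_sum]
    ring
  definite x h := eq_zero_of_cpl h

instance instNormedAddCommGroup : NormedAddCommGroup (ZSp 𝒱) :=
  @InnerProductSpace.Core.toNormedAddCommGroup ℝ (ZSp 𝒱) _ _ _ (core 𝒱)
instance instInnerProductSpace : InnerProductSpace ℝ (ZSp 𝒱) :=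
  InnerProductSpace.ofCore (core 𝒱).toCore
instance instMeasurableSpace : MeasurableSpace (ZSp 𝒱) := borel _
instance instBorelSpace : BorelSpace (ZSp 𝒱) := ⟨rfl⟩

end ZSp

/-- Blocks that may stand in position `(l,k)` of a lower triangular matrix. -/
inductive Adm (𝒱 : BlockSystem r n) :
    ∀ l k : Fin r, Matrix (Fin (n l)) (Fin (n k)) ℝ → Prop
  | lower {l k : Fin r} (h : k < l) (A : Matrix (Fin (n l)) (Fin (n k)) ℝ) (hA : A ∈ 𝒱.V l k) :
      Adm 𝒱 l k A
  | diag (k : Fin r) (c : ℝ) : Adm 𝒱 k k (c • 1)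
  | upper {l k : Fin r} (h : l < k) : Adm 𝒱 l k 0

namespace Adm

variable {𝒱 : BlockSystem r n} {j k l : Fin r}

theorem zero' (l k : Fin r) : Adm 𝒱 l k 0 := by
  rcases lt_trichotomy k l with h | rfl | h
  · exact lower h 0 (Submodule.zero_mem _)
  · have := diag (𝒱 := 𝒱) k 0
    rwa [zero_smul] at this
  · exact upper h

theorem add {A B : Matrix (Fin (n l)) (Fin (n k)) ℝ} (hA : Adm 𝒱 l k A) (hB : Adm 𝒱 l k B) :
    Adm 𝒱 l k (A + B) := by
  cases hA with
  | lower h _ hA' =>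
    cases hB with
    | lower _ _ hB' => exact lower h _ (Submodule.add_mem _ hA' hB')
    | diag => exact absurd h (lt_irrefl _)
    | upper h' => exact absurd h (lt_asymm h')
  | diag c =>
    cases hB with
    | lower h _ _ => exact absurd h (lt_irrefl _)
    | diag d => rw [← add_smul]; exact diag _ _
    | upper h' => exact absurd h' (lt_irrefl _)
  | upper h => simpa using hB

theorem smul_one_mul {m m' : ℕ} (c : ℝ) (A : Matrix (Fin m) (Fin m') ℝ) :
    (c • (1 : Matrix (Fin m) (Fin m) ℝ)) * A = c • A := by simp

theorem mul {A : Matrix (Fin (n l)) (Fin (n k)) ℝ} {B : Matrix (Fin (n k)) (Fin (n j)) ℝ}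
    (hA : Adm 𝒱 l k A) (hB : Adm 𝒱 k j B) : Adm 𝒱 l j (A * B) := by
  cases hA with
  | lower h _ hA' =>
    cases hB with
    | lower h' _ hB' => exact lower (h'.trans h) _ (𝒱.V1 h' h _ hA' _ hB')
    | diag c =>
      rw [Matrix.mul_smul, Matrix.mul_one]; exact lower h _ (Submodule.smul_mem _ _ hA')
    | upper h' => rw [Matrix.mul_zero]; exact zero' _ _
  | diag c =>
    rw [smul_one_mul]
    cases hB with
    | lower h' _ hB' => exact lower h' _ (Submodule.smul_mem _ _ hB')
    | diag d => rw [smul_smul]; exact diag _ _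
    | upper h' => rw [smul_zero]; exact zero' _ _
  | upper h => rw [Matrix.zero_mul]; exact zero' _ _

theorem mul_transpose_mem {A : Matrix (Fin (n l)) (Fin (n j)) ℝ}
    {B : Matrix (Fin (n k)) (Fin (n j)) ℝ}
    (hA : Adm 𝒱 l j A) (hB : Adm 𝒱 k j B) (hkl : k < l) : A * B.transpose ∈ 𝒱.V l k := by
  cases hA with
  | lower h _ hA' =>
    cases hB with
    | lower h' _ hB' => exact 𝒱.V2 h' hkl _ hA' _ hB'
    | diag c =>
      rw [Matrix.transpose_smul, Matrix.transpose_one, Matrix.mul_smul, Matrix.mul_one]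
      exact Submodule.smul_mem _ _ hA'
    | upper h' => rw [Matrix.transpose_zero, Matrix.mul_zero]; exact Submodule.zero_mem _
  | diag c =>
    cases hB with
    | lower h' _ hB' => exact absurd h' (lt_asymm hkl)
    | diag d => exact absurd hkl (lt_irrefl _)
    | upper h' => rw [Matrix.transpose_zero, Matrix.mul_zero]; exact Submodule.zero_mem _
  | upper h => rw [Matrix.zero_mul]; exact Submodule.zero_mem _

theorem mul_transpose_add {A B : Matrix (Fin (n l)) (Fin (n j)) ℝ}
    (hA : Adm 𝒱 l j A) (hB : Adm 𝒱 l j B) :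
    ∃ c : ℝ, A * B.transpose + B * A.transpose = c • 1 := by
  rcases lt_trichotomy j l with hjl | hjl | hjl
  · have key : ∀ C, Adm 𝒱 l j C → C ∈ 𝒱.V l j := by
      intro C hC
      cases hC with
      | lower _ _ h => exact h
      | diag => exact absurd hjl (lt_irrefl _)
      | upper h => exact absurd hjl (lt_asymm h)
    obtain ⟨a, ha⟩ := 𝒱.V3 hjl A (key A hA)
    obtain ⟨b, hb⟩ := 𝒱.V3 hjl B (key B hB)
    obtain ⟨c, hc⟩ := 𝒱.V3 hjl (A + B) (Submodule.add_mem _ (key A hA) (key B hB))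
    refine ⟨c - a - b, ?_⟩
    rw [sub_smul, sub_smul, ← ha, ← hb, ← hc, Matrix.transpose_add, Matrix.add_mul,
      Matrix.mul_add, Matrix.mul_add]
    abel
  · subst hjl
    have key : ∀ C, Adm 𝒱 j j C → ∃ c : ℝ, C = c • 1 := by
      intro C hC
      cases hC with
      | lower h _ _ => exact absurd h (lt_irrefl _)
      | diag c => exact ⟨c, rfl⟩
      | upper h => exact absurd h (lt_irrefl _)
    obtain ⟨a, rfl⟩ := key A hA
    obtain ⟨b, rfl⟩ := key B hB
    refine ⟨a * b + b * a, ?_⟩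
    simp [add_smul, smul_smul, add_comm]
  · have key : ∀ C, Adm 𝒱 l j C → C = 0 := by
      intro C hC
      cases hC with
      | lower h _ _ => exact absurd h (lt_asymm hjl)
      | diag => exact absurd hjl (lt_irrefl _)
      | upper h => rfl
    rw [key A hA, key B hB]
    exact ⟨0, by simp⟩

theorem sum {ι : Type} (s : Finset ι) (f : ι → Matrix (Fin (n l)) (Fin (n k)) ℝ)
    (h : ∀ i ∈ s, Adm 𝒱 l k (f i)) : Adm 𝒱 l k (∑ i ∈ s, f i) :=
  Finset.sum_induction f (Adm 𝒱 l k) (fun _ _ => add) (zero' _ _) h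

end Adm

/-- If all blocks of the block columns `X`, `Y` are admissible, then `X Yᵀ + Y Xᵀ ∈ Z_V`. -/
theorem col_mem {𝒱 : BlockSystem r n} {i : Fin r} {X Y : Matrix (Idx n) (Fin (n i)) ℝ}
    (hX : ∀ l, Adm 𝒱 l i (colBlk X l)) (hY : ∀ l, Adm 𝒱 l i (colBlk Y l)) :
    X * Y.transpose + Y * X.transpose ∈ ZSub 𝒱 := by
  have hb : ∀ l k, blk (X * Y.transpose + Y * X.transpose) l k =
      colBlk X l * (colBlk Y k).transpose + colBlk Y l * (colBlk X k).transpose := by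
    intro l k
    ext a b
    simp [blk, colBlk, Matrix.mul_apply]
  refine ⟨?_, fun k => ?_, fun k l h => ?_⟩
  · rw [Matrix.IsSymm, Matrix.transpose_add, Matrix.transpose_mul, Matrix.transpose_mul,
      Matrix.transpose_transpose, Matrix.transpose_transpose, add_comm]
  · rw [hb]
    exact Adm.mul_transpose_add (hX k) (hY k)
  · rw [hb]
    exact Submodule.add_mem _ (Adm.mul_transpose_mem (hX l) (hY k) h)
      (Adm.mul_transpose_mem (hY l) (hX k) h)

theorem mat_mem {𝒱 : BlockSystem r n} {A B : Matrix (Idx n) (Idx n) ℝ}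
    (hA : ∀ l k, Adm 𝒱 l k (blk A l k)) (hB : ∀ l k, Adm 𝒱 l k (blk B l k)) :
    A * B.transpose + B * A.transpose ∈ ZSub 𝒱 := by
  have h : A * B.transpose + B * A.transpose =
      ∑ i : Fin r, (A.submatrix id (fun b : Fin (n i) => (⟨i, b⟩ : Idx n)) *
          (B.submatrix id (fun b : Fin (n i) => (⟨i, b⟩ : Idx n))).transpose +
        B.submatrix id (fun b : Fin (n i) => (⟨i, b⟩ : Idx n)) *
          (A.submatrix id (fun b : Fin (n i) => (⟨i, b⟩ : Idx n))).transpose) := by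
    ext a b
    simp [Matrix.mul_apply, Fintype.sum_sigma, Matrix.sum_apply, Finset.sum_add_distrib]
  rw [h]
  exact Submodule.sum_mem _ fun i _ => col_mem (fun l => hA l i) (fun l => hB l i)

/-! ### The group `H_V`, its actions, the cone `P_V` and its dual cone -/

/-- The group `H_V` of lower triangular matrices with `T_{kk} = t_{kk} I`, `t_{kk} > 0`, and
`T_{lk} ∈ V_{lk}` for `k < l`. -/
def HSet (𝒱 : BlockSystem r n) : Set (Matrix (Idx n) (Idx n) ℝ) :=
  {T | (∀ k l, l < k → blk T l k = 0) ∧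
    (∀ k, ∃ t : ℝ, 0 < t ∧ blk T k k = t • (1 : Matrix (Fin (n k)) (Fin (n k)) ℝ)) ∧
    ∀ k l, k < l → blk T l k ∈ 𝒱.V l k}

theorem HSet.adm {𝒱 : BlockSystem r n} {T : Matrix (Idx n) (Idx n) ℝ} (hT : T ∈ HSet 𝒱)
    (l k : Fin r) : Adm 𝒱 l k (blk T l k) := by
  obtain ⟨h1, h2, h3⟩ := hT
  rcases lt_trichotomy k l with h | rfl | h
  · exact .lower h _ (h3 k l h)
  · obtain ⟨t, -, ht⟩ := h2 k
    rw [ht]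
    exact .diag _ _
  · rw [h1 k l h]
    exact .upper h

theorem conj_mem {𝒱 : BlockSystem r n} {T y : Matrix (Idx n) (Idx n) ℝ} (hT : T ∈ HSet 𝒱)
    (hy : y ∈ ZSub 𝒱) : T * y * T.transpose ∈ ZSub 𝒱 := by
  obtain ⟨h1, h2, h3⟩ := hy
  let S : Matrix (Idx n) (Idx n) ℝ := Matrix.of fun a b =>
    if b.1 < a.1 then y a b else if a.1 = b.1 then y a b / 2 else 0
  have hyS : y = S + S.transpose := by
    ext a b
    simp only [Matrix.add_apply, Matrix.transpose_apply, S, Matrix.of_apply]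
    rcases lt_trichotomy b.1 a.1 with h | h | h
    · simp [h, h.not_gt, h.ne]
    · simp [h, h1.apply a b]
    · simp [h, h.not_gt, h.ne, h1.apply a b]
  have hS : ∀ l k, Adm 𝒱 l k (blk S l k) := by
    intro l k
    rcases lt_trichotomy k l with h | rfl | h
    · have : blk S l k = blk y l k := by
        ext a b; simp [blk, S, h]
      rw [this]
      exact .lower h _ (h3 k l h)
    · obtain ⟨c, hc⟩ := h2 k
      have : blk S k k = (c / 2) • 1 := by
        rw [div_eq_inv_mul, mul_smul, ← hc]
        ext a b; simp [blk, S, div_eq_inv_mul]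
      rw [this]
      exact .diag _ _
    · have : blk S l k = 0 := by
        ext a b; simp [blk, S, h.not_gt, h.ne]
      rw [this]
      exact .upper h
  have hTS : ∀ l k, Adm 𝒱 l k (blk (T * S) l k) := by
    intro l k
    have : blk (T * S) l k = ∑ a, blk T l a * blk S a k := by
      ext a b
      simp [blk, Matrix.mul_apply, Fintype.sum_sigma, Matrix.sum_apply]
    rw [this]
    exact Adm.sum _ _ fun a _ => (HSet.adm hT l a).mul (hS a k)
  have := mat_mem hTS (HSet.adm hT)
  convert this using 1
  conv_lhs => rw [hyS]
  rw [Matrix.transpose_mul, Matrix.mul_add, Matrix.add_mul, Matrix.mul_assoc T S.transpose]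

/-- The action `ρ(T) y = T y Tᵀ` of `T ∈ H_V` on `Z_V`. -/
def rho {𝒱 : BlockSystem r n} (T : HSet 𝒱) : ZSp 𝒱 →ₗ[ℝ] ZSp 𝒱 where
  toFun y := ⟨T.1 * ZSp.toMat y * T.1.transpose, conj_mem T.2 y.toMat_mem⟩
  map_add' x y := Subtype.ext (by
    change T.1 * ZSp.toMat (x + y) * T.1.transpose =
      T.1 * ZSp.toMat x * T.1.transpose + T.1 * ZSp.toMat y * T.1.transpose
    rw [map_add, Matrix.mul_add, Matrix.add_mul])
  map_smul' c y := Subtype.ext (by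
    change T.1 * ZSp.toMat (c • y) * T.1.transpose = c • (T.1 * ZSp.toMat y * T.1.transpose)
    rw [map_smul, Matrix.mul_smul, Matrix.smul_mul])

/-- `ρ^*(T)`, given by `⟨y, ρ^*(T) η⟩ = ⟨ρ(T) y, η⟩`. -/
def rhoStar {𝒱 : BlockSystem r n} (T : HSet 𝒱) : ZSp 𝒱 →ₗ[ℝ] ZSp 𝒱 :=
  LinearMap.adjoint (rho T)

/-- `χ_σ(T) = t_{11}^{2σ_1} ⋯ t_{rr}^{2σ_r}`. -/
def chi {𝒱 : BlockSystem r n} (σ : Fin r → ℂ) (T : HSet 𝒱) : ℂ :=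
  ∏ k, ((scal (blk T.1 k k) : ℝ) : ℂ) ^ (2 * σ k)

/-- The block diagonal matrix with blocks `c_k I_{n_k}`. -/
def diagZ (𝒱 : BlockSystem r n) (c : Fin r → ℝ) : ZSp 𝒱 :=
  ⟨Matrix.diagonal fun a => c a.1, by
    refine ⟨Matrix.isSymm_diagonal _, fun k => ⟨c k, ?_⟩, fun k l h => ?_⟩
    · ext a b
      simp [blk, Matrix.diagonal_apply, Matrix.one_apply]
    · have : blk (Matrix.diagonal fun a : Idx n => c a.1) l k = 0 := by
        ext a b
        simp [blk, h.ne']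
      rw [this]
      exact Submodule.zero_mem _⟩

/-- The identity matrix `I_N`. -/
def unitZ (𝒱 : BlockSystem r n) : ZSp 𝒱 := diagZ 𝒱 fun _ => 1

/-- The cone `P_V` of positive definite matrices in `Z_V`. -/
def cone (𝒱 : BlockSystem r n) : Set (ZSp 𝒱) := {y | (ZSp.toMat y).PosDef}

/-- The dual cone `P_V^*`, as a subset of `Z_V`. -/
def dualCone (𝒱 : BlockSystem r n) : Set (ZSp 𝒱) :=
  {η | ∀ y ∈ closure (cone 𝒱), y ≠ 0 → 0 < inner ℝ y η}

/-- `σ^* = (σ_r, …, σ_1)`. -/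
def revPar (σ : Fin r → ℂ) : Fin r → ℂ := fun k => σ k.rev

open Classical in
/-- The function `Δ^*_σ` on `P_V^*`: `Δ^*_σ(ρ^*(T) I_N) = χ_{σ^*}(T)`. Every `η ∈ P_V^*` is
`ρ^*(T) I_N` for exactly one `T ∈ H_V`; the value `0` elsewhere is not used. -/
def DeltaStar (𝒱 : BlockSystem r n) (σ : Fin r → ℂ) (η : ZSp 𝒱) : ℂ :=
  if h : ∃ T : HSet 𝒱, rhoStar T (unitZ 𝒱) = η then chi (revPar σ) h.choose else 0

/-! ### Gindikin-Riesz distributions -/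

/-- For a tempered distribution `R` with support in the closure of `P_V`, this says that the
Laplace transform `R(e^{⟨y,θ⟩})` at `θ` is `c`: the value of `R` on the Schwartz functions that
coincide with `y ↦ e^{⟨y,θ⟩}` near the closure of `P_V` (such functions exist for
`θ ∈ -P_V^*`) is `c`. -/
def HasLaplaceAt (𝒱 : BlockSystem r n) (R : 𝓢'(ZSp 𝒱, ℂ)) (θ : ZSp 𝒱) (c : ℂ) : Prop :=
  (∃ f : 𝓢(ZSp 𝒱, ℂ),
    ∀ᶠ y in 𝓝ˢ (closure (cone 𝒱)), f y = Complex.exp ((inner ℝ y θ : ℝ) : ℂ)) ∧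
  ∀ f : 𝓢(ZSp 𝒱, ℂ),
    (∀ᶠ y in 𝓝ˢ (closure (cone 𝒱)), f y = Complex.exp ((inner ℝ y θ : ℝ) : ℂ)) → R f = c

/-- `R` is the Gindikin-Riesz distribution with parameter `σ ∈ ℂ^r`: the tempered distribution on
`Z_V` with support in the closure of `P_V` and Laplace transform `Δ^*_{-σ^*}(-θ)`,
`θ ∈ -P_V^*`. -/
def IsGindikinRiesz (𝒱 : BlockSystem r n) (σ : Fin r → ℂ) (R : 𝓢'(ZSp 𝒱, ℂ)) : Prop :=
  Distribution.dsupport R ⊆ closure (cone 𝒱) ∧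
  ∀ θ : ZSp 𝒱, -θ ∈ dualCone 𝒱 → HasLaplaceAt 𝒱 R θ (DeltaStar 𝒱 (-revPar σ) (-θ))

/-! ### Standard quadratic maps -/

/-- The space `W_V^i` of block columns. -/
def WSub (𝒱 : BlockSystem r n) (i : Fin r) : Submodule ℝ (Matrix (Idx n) (Fin (n i)) ℝ) where
  carrier := {x | (∀ l, l < i → colBlk x l = 0) ∧
    (∃ c : ℝ, colBlk x i = c • (1 : Matrix (Fin (n i)) (Fin (n i)) ℝ)) ∧
    ∀ l, i < l → colBlk x l ∈ 𝒱.V l i}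
  add_mem' := by
    rintro x y ⟨hx1, ⟨c, hc⟩, hx3⟩ ⟨hy1, ⟨d, hd⟩, hy3⟩
    have h : ∀ l, colBlk (x + y) l = colBlk x l + colBlk y l := fun _ => rfl
    refine ⟨fun l hl => ?_, ⟨c + d, ?_⟩, fun l hl => ?_⟩
    · rw [h, hx1 l hl, hy1 l hl, add_zero]
    · rw [h, hc, hd, add_smul]
    · exact (𝒱.V l i).add_mem (hx3 l hl) (hy3 l hl)
  zero_mem' := ⟨fun _ _ => rfl, ⟨0, by rw [zero_smul]; rfl⟩, fun l _ => (𝒱.V l i).zero_mem⟩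
  smul_mem' := by
    rintro a x ⟨hx1, ⟨c, hc⟩, hx3⟩
    have h : ∀ l, colBlk (a • x) l = a • colBlk x l := fun _ => rfl
    refine ⟨fun l hl => ?_, ⟨a * c, ?_⟩, fun l hl => ?_⟩
    · rw [h, hx1 l hl, smul_zero]
    · rw [h, hc, mul_smul]
    · exact (𝒱.V l i).smul_mem a (hx3 l hl)

theorem WSub.adm {𝒱 : BlockSystem r n} {i : Fin r} {x : Matrix (Idx n) (Fin (n i)) ℝ}
    (hx : x ∈ WSub 𝒱 i) (l : Fin r) : Adm 𝒱 l i (colBlk x l) := by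
  obtain ⟨h1, ⟨c, hc⟩, h3⟩ := hx
  rcases lt_trichotomy i l with h | rfl | h
  · exact .lower h _ (h3 l h)
  · rw [hc]
    exact .diag _ _
  · rw [h1 l h]
    exact .upper h

/-- `W_V^ε`, the direct sum of the spaces `W_V^i` over `I(ε) = {i | ε_i = 1}`, to be equipped with
the inner product below. -/
def WSp (𝒱 : BlockSystem r n) (ε : Fin r → Fin 2) : Type :=
  ∀ i : {i : Fin r // ε i = 1}, ↥(WSub 𝒱 i.1)

namespace WSp

variable {𝒱 : BlockSystem r n} {ε : Fin r → Fin 2}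

instance instAddCommGroup : AddCommGroup (WSp 𝒱 ε) :=
  inferInstanceAs (AddCommGroup (∀ i : {i : Fin r // ε i = 1}, ↥(WSub 𝒱 i.1)))
instance instModule : Module ℝ (WSp 𝒱 ε) :=
  inferInstanceAs (Module ℝ (∀ i : {i : Fin r // ε i = 1}, ↥(WSub 𝒱 i.1)))
instance instFiniteDimensional : FiniteDimensional ℝ (WSp 𝒱 ε) :=
  inferInstanceAs (FiniteDimensional ℝ (∀ i : {i : Fin r // ε i = 1}, ↥(WSub 𝒱 i.1)))

/-- The block `X_{li}` of `x`. -/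
def X (x : WSp 𝒱 ε) (l : Fin r) (i : {i : Fin r // ε i = 1}) :
    Matrix (Fin (n l)) (Fin (n i.1)) ℝ :=
  colBlk (x i).1 l

/-- The number `x_{ii}`. -/
def d (x : WSp 𝒱 ε) (i : {i : Fin r // ε i = 1}) : ℝ := scal (x.X i.1 i)

/-- The inner product `∑_{i ∈ I(ε)} (x_{ii} x'_{ii} + ∑_{l>i} (X_{li} | X'_{li}))`. -/
def ipW (x x' : WSp 𝒱 ε) : ℝ :=
  ∑ i, (x.d i * x'.d i + ∑ l ∈ Finset.Ioi i.1, ip (x.X l i) (x'.X l i))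

theorem eq_zero_of_ipW {x : WSp 𝒱 ε} (h : ipW x x = 0) : x = 0 := by
  have hn : ∀ i, 0 ≤ ∑ l ∈ Finset.Ioi i.1, ip (x.X l i) (x.X l i) :=
    fun i => Finset.sum_nonneg fun _ _ => ip_self_nonneg _
  have h0 := (Finset.sum_eq_zero_iff_of_nonneg
    fun i _ => add_nonneg (mul_self_nonneg (x.d i)) (hn i)).1 h
  funext i
  have hi := h0 i (Finset.mem_univ i)
  have hd : x.d i * x.d i = 0 := by linarith [hn i, mul_self_nonneg (x.d i)]
  have hs : ∑ l ∈ Finset.Ioi i.1, ip (x.X l i) (x.X l i) = 0 := by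
    linarith [hn i, mul_self_nonneg (x.d i)]
  obtain ⟨h1, ⟨c, hc⟩, -⟩ := (x i).2
  apply Subtype.ext
  ext ⟨l, a⟩ b
  have hl : x.X l i = 0 := by
    rcases lt_trichotomy i.1 l with h | rfl | h
    · exact ip_self_eq_zero ((Finset.sum_eq_zero_iff_of_nonneg fun _ _ => ip_self_nonneg _).1 hs l
        (Finset.mem_Ioi.2 h))
    · have hc' : x.X i.1 i = c • 1 := hc
      rw [d, hc', scal_smul_one (𝒱.npos i.1)] at hd
      rw [hc', mul_self_eq_zero.1 hd, zero_smul]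
    · exact h1 l h
  have := congrFun (congrFun hl a) b
  exact this

/-- The inner product on `W_V^ε`. -/
@[reducible]
def core (𝒱 : BlockSystem r n) (ε : Fin r → Fin 2) : InnerProductSpace.Core ℝ (WSp 𝒱 ε) where
  inner := ipW
  conj_inner_symm x y := by
    simp only [ipW, conj_trivial, ip_comm, mul_comm]
  re_inner_nonneg x := by
    change 0 ≤ ipW x x
    exact Finset.sum_nonneg fun _ _ => add_nonneg (mul_self_nonneg _)
      (Finset.sum_nonneg fun _ _ => ip_self_nonneg _)
  add_left x y z := by
    have h : ∀ l i, (x + y).X l i = x.X l i + y.X l i := fun _ _ => rfl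
    simp only [ipW, d, h, scal_add, ip_add_left, add_mul, Finset.sum_add_distrib]
    ring
  smul_left x y c := by
    have h : ∀ l i, (c • x).X l i = c • x.X l i := fun _ _ => rfl
    simp only [ipW, d, h, scal_smul, ip_smul_left, conj_trivial, mul_assoc, ← Finset.mul_sum,
      ← mul_add]
  definite x h := eq_zero_of_ipW h

instance instNormedAddCommGroup : NormedAddCommGroup (WSp 𝒱 ε) :=
  @InnerProductSpace.Core.toNormedAddCommGroup ℝ (WSp 𝒱 ε) _ _ _ (core 𝒱 ε)
instance instInnerProductSpace : InnerProductSpace ℝ (WSp 𝒱 ε) :=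
  InnerProductSpace.ofCore (core 𝒱 ε).toCore
instance instMeasurableSpace : MeasurableSpace (WSp 𝒱 ε) := borel _
instance instBorelSpace : BorelSpace (WSp 𝒱 ε) := ⟨rfl⟩

end WSp

/-- The standard quadratic map `q_V^ε(x) = ∑_{i ∈ I(ε)} x_i x_iᵀ`. -/
def quad (𝒱 : BlockSystem r n) (ε : Fin r → Fin 2) (x : WSp 𝒱 ε) : ZSp 𝒱 :=
  ⟨∑ i, (x i).1 * (x i).1.transpose, Submodule.sum_mem _ fun i _ => by
    have h := Submodule.smul_mem _ (1 / 2 : ℝ)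
      (col_mem (WSub.adm (x i).2) (WSub.adm (x i).2))
    rw [← two_smul ℝ, smul_smul] at h
    simpa using h⟩

/-- The open subset `W_V^{ε,+}`. -/
def WPlus (𝒱 : BlockSystem r n) (ε : Fin r → Fin 2) : Set (WSp 𝒱 ε) := {x | ∀ i, 0 < x.d i}

/-- `R_+(ε)`. -/
def RPlus (ε : Fin r → Fin 2) : Set (Fin r → ℝ) :=
  {u | ∀ i, (ε i = 0 → u i = 0) ∧ (ε i = 1 → 0 < u i)}

/-- `Γ_ε(u) = π^{dim W_V^ε / 2} ∏_{i ∈ I(ε)} Γ(u_i) / (2 √π)`. -/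
def GammaEps (𝒱 : BlockSystem r n) (ε : Fin r → Fin 2) (u : Fin r → ℝ) : ℝ :=
  Real.pi ^ ((Module.finrank ℝ (WSp 𝒱 ε) : ℝ) / 2) *
    ∏ i : {i : Fin r // ε i = 1}, Real.Gamma (u i.1) / (2 * Real.sqrt Real.pi)

/-- The measure `M_u^ε(dx) = Γ_ε(u)⁻¹ ∏_{i ∈ I(ε)} x_{ii}^{2 u_i - 1} dx` on `W_V^{ε,+}`, regarded
as a measure on `W_V^ε`; here `dx` is the Lebesgue measure of the Euclidean space `W_V^ε`. -/
def measM (𝒱 : BlockSystem r n) (ε : Fin r → Fin 2) (u : Fin r → ℝ) :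
    MeasureTheory.Measure (WSp 𝒱 ε) :=
  (MeasureTheory.volume.restrict (WPlus 𝒱 ε)).withDensity fun x =>
    ENNReal.ofReal ((∏ i, x.d i ^ (2 * u i.1 - 1)) / GammaEps 𝒱 ε u)

/-- `p_k(ε) = ∑_{i<k} ε_i n_{ki}`. -/
def pPar (𝒱 : BlockSystem r n) (ε : Fin r → Fin 2) (k : Fin r) : ℕ :=
  ∑ i ∈ Finset.Iio k, (ε i : ℕ) * 𝒱.dimV k i

/-- The `H_V`-orbit `O_ε = ρ(H_V) E_ε`, where `E_ε` has the diagonal blocks `ε_k I`. -/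
def orbit (𝒱 : BlockSystem r n) (ε : Fin r → Fin 2) : Set (ZSp 𝒱) :=
  {y | ∃ T : HSet 𝒱, y = rho T (diagZ 𝒱 fun k => ((ε k : ℕ) : ℝ))}

end GindikinRiesz

end

open GindikinRiesz MeasureTheory
open scoped SchwartzMap

open GindikinRiesz MeasureTheory
open scoped SchwartzMap

section WeakIntegral

variable {E : Type*} [NormedAddCommGroup E] [InnerProductSpace ℝ E] [FiniteDimensional ℝ E]

/-- The bounded continuous function `y ↦ ‖y‖ ^ k • D^l f(y)` attached to a Schwartz function. -/
noncomputable def SchwartzMap.weightedDeriv (k l : ℕ) :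
    𝓢(E, ℂ) →ₗ[ℂ] BoundedContinuousFunction E (E [×l]→L[ℝ] ℂ) where
  toFun f := BoundedContinuousFunction.ofNormedAddCommGroup
    (fun y => (‖y‖ ^ k) • iteratedFDeriv ℝ l f y)
    ((continuous_norm.pow k).smul ((f.smooth ⊤).continuous_iteratedFDeriv (by exact_mod_cast le_top)))
    (SchwartzMap.seminorm ℂ k l f) (fun y => by
      rw [norm_smul, norm_pow, norm_norm]
      exact f.le_seminorm ℂ k l y)
  map_add' f g := by
    ext1 y
    have : iteratedFDeriv ℝ l (⇑(f + g)) y = iteratedFDeriv ℝ l f y + iteratedFDeriv ℝ l g y := by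
      have := iteratedFDeriv_add_apply (x := y) (i := l) ((f.smooth l).contDiffAt)
        ((g.smooth l).contDiffAt)
      rwa [← FunLike.coe_add] at this
    change ‖y‖ ^ k • iteratedFDeriv ℝ l (⇑(f + g)) y = _
    rw [this, smul_add]
    rfl
  map_smul' c f := by
    ext1 y
    have : iteratedFDeriv ℝ l (⇑(c • f)) y = c • iteratedFDeriv ℝ l f y := by
      have := iteratedFDeriv_const_smul_apply (a := c) (x := y) (i := l) ((f.smooth l).contDiffAt)
      rwa [← FunLike.coe_smul] at this
    change ‖y‖ ^ k • iteratedFDeriv ℝ l (⇑(c • f)) y = _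
    rw [this, smul_comm]
    rfl

@[simp]
theorem SchwartzMap.weightedDeriv_apply (k l : ℕ) (f : 𝓢(E, ℂ)) (y : E) :
    f.weightedDeriv k l y = (‖y‖ ^ k) • iteratedFDeriv ℝ l f y := rfl

theorem SchwartzMap.seminorm_le_norm_weightedDeriv (k l : ℕ) (f : 𝓢(E, ℂ)) :
    SchwartzMap.seminorm ℂ k l f ≤ ‖f.weightedDeriv k l‖ := by
  refine f.seminorm_le_bound ℂ k l (norm_nonneg (f.weightedDeriv k l)) fun y => ?_
  have := (f.weightedDeriv k l).norm_coe_le_norm y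
  rwa [weightedDeriv_apply, norm_smul, norm_pow, norm_norm] at this

/-- The Banach space of finite families of bounded continuous functions in which the weighted
derivatives of Schwartz functions take their values. -/
def WeightedDerivSpace (E : Type*) [NormedAddCommGroup E] [InnerProductSpace ℝ E]
    (s : Finset (ℕ × ℕ)) : Type _ :=
  (p : s) → BoundedContinuousFunction E (E [×p.1.2]→L[ℝ] ℂ)

noncomputable instance (s : Finset (ℕ × ℕ)) : NormedAddCommGroup (WeightedDerivSpace E s) :=
  inferInstanceAs (NormedAddCommGroup ((p : s) → BoundedContinuousFunction E (E [×p.1.2]→L[ℝ] ℂ)))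

noncomputable instance (s : Finset (ℕ × ℕ)) : NormedSpace ℂ (WeightedDerivSpace E s) :=
  inferInstanceAs (NormedSpace ℂ ((p : s) → BoundedContinuousFunction E (E [×p.1.2]→L[ℝ] ℂ)))

instance (s : Finset (ℕ × ℕ)) : CompleteSpace (WeightedDerivSpace E s) :=
  inferInstanceAs (CompleteSpace ((p : s) → BoundedContinuousFunction E (E [×p.1.2]→L[ℝ] ℂ)))

/-- Evaluation of a component at a point. -/
noncomputable def WeightedDerivSpace.eval {s : Finset (ℕ × ℕ)} (p : s) (y : E) :
    WeightedDerivSpace E s →L[ℂ] (E [×p.1.2]→L[ℝ] ℂ) :=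
  (BoundedContinuousFunction.evalCLM ℂ y).comp
    (ContinuousLinearMap.proj (R := ℂ)
      (φ := fun p : s => BoundedContinuousFunction E (E [×p.1.2]→L[ℝ] ℂ)) p)

theorem WeightedDerivSpace.ext_eval {s : Finset (ℕ × ℕ)} {v w : WeightedDerivSpace E s}
    (h : ∀ p y, WeightedDerivSpace.eval p y v = WeightedDerivSpace.eval p y w) : v = w :=
  funext fun p => BoundedContinuousFunction.ext fun y => h p y

theorem WeightedDerivSpace.norm_le {s : Finset (ℕ × ℕ)} {v : WeightedDerivSpace E s} {C : ℝ}
    (hC : 0 ≤ C) (h : ∀ p : s, ‖v p‖ ≤ C) : ‖v‖ ≤ C :=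
  (pi_norm_le_iff_of_nonneg hC).2 h

theorem WeightedDerivSpace.norm_apply_le {s : Finset (ℕ × ℕ)} (v : WeightedDerivSpace E s)
    (p : s) : ‖v p‖ ≤ ‖v‖ :=
  norm_le_pi_norm (ι := s)
    (G := fun p : s => BoundedContinuousFunction E (E [×p.1.2]→L[ℝ] ℂ)) v p

/-- The family of weighted derivatives with indices in a finite set. -/
noncomputable def SchwartzMap.weightedDerivs (s : Finset (ℕ × ℕ)) :
    𝓢(E, ℂ) →ₗ[ℂ] WeightedDerivSpace E s where
  toFun f p := SchwartzMap.weightedDeriv p.1.1 p.1.2 f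
  map_add' f g := funext fun p => map_add (SchwartzMap.weightedDeriv p.1.1 p.1.2) f g
  map_smul' c f := funext fun p => map_smul (SchwartzMap.weightedDeriv p.1.1 p.1.2) c f

@[simp]
theorem SchwartzMap.eval_weightedDerivs {s : Finset (ℕ × ℕ)} (p : s) (y : E) (f : 𝓢(E, ℂ)) :
    WeightedDerivSpace.eval p y (SchwartzMap.weightedDerivs s f) =
      (‖y‖ ^ p.1.1) • iteratedFDeriv ℝ p.1.2 f y := rfl

/-- Every continuous functional on the Schwartz space factors through finitely many weighted
derivatives. -/
theorem SchwartzMap.exists_functional_weightedDerivs (U : 𝓢(E, ℂ) →L[ℂ] ℂ) :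
    ∃ (s : Finset (ℕ × ℕ))
      (Λ : StrongDual ℂ (WeightedDerivSpace E s)),
      ∀ f, U f = Λ (SchwartzMap.weightedDerivs s f) := by
  have hU : Continuous (((normSeminorm ℂ ℂ).comp U.toLinearMap) : Seminorm ℂ 𝓢(E, ℂ)) :=
    continuous_norm.comp U.continuous
  obtain ⟨s, C, -, hC⟩ := Seminorm.bound_of_continuous (schwartz_withSeminorms ℂ E ℂ) _ hU
  refine ⟨s, ?_⟩
  have hC' : ∀ f, ‖U f‖ ≤ C * ‖SchwartzMap.weightedDerivs s f‖ := by
    intro f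
    refine (hC f).trans ?_
    change (C : ℝ) * (s.sup (schwartzSeminormFamily ℂ E ℂ)) f ≤ _
    refine mul_le_mul_of_nonneg_left ?_ C.2
    refine Seminorm.finset_sup_apply_le (norm_nonneg _) fun p hp => ?_
    refine (f.seminorm_le_norm_weightedDeriv p.1 p.2).trans ?_
    exact (SchwartzMap.weightedDerivs s f).norm_apply_le ⟨p, hp⟩
  have hker : ∀ f g, SchwartzMap.weightedDerivs s f = SchwartzMap.weightedDerivs s g →
      U f = U g := by
    intro f g h
    rw [← sub_eq_zero, ← map_sub, ← norm_le_zero_iff]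
    refine (hC' _).trans ?_
    rw [map_sub, h, sub_self, norm_zero, mul_zero]
  choose τ hτ using fun v : LinearMap.range (SchwartzMap.weightedDerivs (E := E) s) => v.2
  let L₀ : LinearMap.range (SchwartzMap.weightedDerivs (E := E) s) →ₗ[ℂ] ℂ :=
    { toFun := fun v => U (τ v)
      map_add' := fun v w => by
        rw [← map_add]
        refine hker _ _ ?_
        rw [map_add, hτ, hτ, hτ]
        rfl
      map_smul' := fun c v => by
        rw [← map_smul]
        refine hker _ _ ?_
        rw [map_smul, hτ, hτ]
        rfl }
  let L : StrongDual ℂ (LinearMap.range (SchwartzMap.weightedDerivs (E := E) s)) :=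
    L₀.mkContinuous C fun v => by
      refine (hC' (τ v)).trans ?_
      rw [hτ]
      rfl
  obtain ⟨Λ, hΛ, -⟩ := exists_extension_norm_eq _ L
  refine ⟨Λ, fun f => ?_⟩
  rw [hΛ ⟨_, LinearMap.mem_range_self _ f⟩]
  exact hker _ _ (hτ ⟨_, LinearMap.mem_range_self _ f⟩).symm

variable [MeasurableSpace E] [BorelSpace E]

theorem SchwartzMap.iteratedFDeriv_bound (φ : 𝓢(E, ℂ)) (l : ℕ) (y : E) :
    ‖iteratedFDeriv ℝ l φ y‖ ≤ SchwartzMap.seminorm ℂ 0 l φ := by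
  simpa using φ.le_seminorm ℂ 0 l y

theorem SchwartzMap.continuous_iteratedFDeriv' (φ : 𝓢(E, ℂ)) (l : ℕ) :
    Continuous (iteratedFDeriv ℝ l φ) :=
  (φ.smooth ⊤).continuous_iteratedFDeriv (by exact_mod_cast le_top)

theorem SchwartzMap.integrable_smul_iteratedFDeriv_sub (g φ : 𝓢(E, ℂ)) (l : ℕ) (y : E) :
    Integrable fun a => g a • iteratedFDeriv ℝ l φ (y - a) := by
  refine (g.integrable.norm.mul_const (SchwartzMap.seminorm ℂ 0 l φ)).mono'
    (g.continuous.smul ((φ.continuous_iteratedFDeriv' l).comp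
      (continuous_const.sub continuous_id))).aestronglyMeasurable (.of_forall fun a => ?_)
  rw [norm_smul]
  exact mul_le_mul_of_nonneg_left (φ.iteratedFDeriv_bound l _) (norm_nonneg _)

theorem fderiv_integral_smul_sub_apply {X : Type*} [NormedAddCommGroup X] [NormedSpace ℂ X]
    [CompleteSpace X] (g : 𝓢(E, ℂ)) {G : E → X} (hG : ContDiff ℝ 1 G) {C C' : ℝ}
    (hC : ∀ z, ‖G z‖ ≤ C) (hC' : ∀ z, ‖fderiv ℝ G z‖ ≤ C') (y v : E) :
    fderiv ℝ (fun y => ∫ a, g a • G (y - a)) y v = ∫ a, g a • fderiv ℝ G (y - a) v := by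
  have hc := hG.continuous_fderiv one_ne_zero
  have hm : AEStronglyMeasurable (fun a => g a • fderiv ℝ G (y - a)) volume :=
    (g.continuous.smul (hc.comp (continuous_const.sub continuous_id))).aestronglyMeasurable
  have hmG : ∀ z, AEStronglyMeasurable (fun a => g a • G (z - a)) volume := fun z =>
    (g.continuous.smul (hG.continuous.comp
      (continuous_const.sub continuous_id))).aestronglyMeasurable
  have hint : Integrable fun a => g a • fderiv ℝ G (y - a) := by
    refine (g.integrable.norm.mul_const C').mono' hm (.of_forall fun a => ?_)
    rw [norm_smul]
    exact mul_le_mul_of_nonneg_left (hC' _) (norm_nonneg _)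
  have hintG : Integrable fun a => g a • G (y - a) := by
    refine (g.integrable.norm.mul_const C).mono' (hmG y) (.of_forall fun a => ?_)
    rw [norm_smul]
    exact mul_le_mul_of_nonneg_left (hC _) (norm_nonneg _)
  have hF : HasFDerivAt (fun y => ∫ a, g a • G (y - a)) (∫ a, g a • fderiv ℝ G (y - a)) y := by
    refine hasFDerivAt_integral_of_dominated_of_fderiv_le (𝕜 := ℝ) (s := Set.univ)
      (bound := fun a => ‖g a‖ * C') (F' := fun y a => g a • fderiv ℝ G (y - a))
      Filter.univ_mem (.of_forall hmG) hintG hm ?_ (g.integrable.norm.mul_const _) ?_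
    · refine .of_forall fun a z _ => ?_
      rw [norm_smul]
      exact mul_le_mul_of_nonneg_left (hC' _) (norm_nonneg _)
    · refine .of_forall fun a z _ => ?_
      have hd := (hG.differentiable one_ne_zero (z - a)).hasFDerivAt
      have := hd.comp z ((hasFDerivAt_id z).sub_const a)
      rw [ContinuousLinearMap.comp_id] at this
      exact this.const_smul (g a)
  rw [hF.fderiv, ContinuousLinearMap.integral_apply hint]
  rfl

theorem SchwartzMap.iteratedFDeriv_integral_mul_sub (g φ : 𝓢(E, ℂ)) (l : ℕ) (y : E) :
    iteratedFDeriv ℝ l (fun y => ∫ a, g a • φ (y - a)) y =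
      ∫ a, g a • iteratedFDeriv ℝ l φ (y - a) := by
  induction l generalizing y with
  | zero =>
    ext m
    rw [iteratedFDeriv_zero_apply,
      ContinuousMultilinearMap.integral_apply (g.integrable_smul_iteratedFDeriv_sub φ 0 y)]
    simp
  | succ l ih =>
    have hn : ∀ z, ‖fderiv ℝ (iteratedFDeriv ℝ l φ) z‖ ≤ SchwartzMap.seminorm ℂ 0 (l + 1) φ := by
      intro z
      rw [norm_fderiv_iteratedFDeriv]
      exact φ.iteratedFDeriv_bound _ _
    have hG : ContDiff ℝ 1 (iteratedFDeriv ℝ l φ) :=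
      (φ.smooth ⊤).iteratedFDeriv_right (m := 1) (i := l) (by exact_mod_cast le_top)
    ext m
    have hint : Integrable fun a => g a • (fderiv ℝ (iteratedFDeriv ℝ l φ) (y - a)) (m 0) := by
      refine (g.integrable.norm.mul_const
        (SchwartzMap.seminorm ℂ 0 (l + 1) φ * ‖m 0‖)).mono'
        (g.continuous.smul (((hG.continuous_fderiv one_ne_zero).comp
          (continuous_const.sub continuous_id)).clm_apply continuous_const)).aestronglyMeasurable
        (.of_forall fun a => ?_)
      rw [norm_smul]
      exact mul_le_mul_of_nonneg_left ((ContinuousLinearMap.le_opNorm _ _).trans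
        (mul_le_mul_of_nonneg_right (hn _) (norm_nonneg _))) (norm_nonneg _)
    rw [iteratedFDeriv_succ_apply_left, funext ih,
      fderiv_integral_smul_sub_apply g hG (φ.iteratedFDeriv_bound l) hn y (m 0),
      ContinuousMultilinearMap.integral_apply hint,
      ContinuousMultilinearMap.integral_apply (g.integrable_smul_iteratedFDeriv_sub φ (l + 1) y)]
    rfl

theorem SchwartzMap.iteratedFDeriv_compSubConstCLM (φ : 𝓢(E, ℂ)) (l : ℕ) (a y : E) :
    iteratedFDeriv ℝ l (φ.compSubConstCLM ℂ a) y = iteratedFDeriv ℝ l φ (y - a) :=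
  congrFun (iteratedFDeriv_comp_sub' (𝕜 := ℝ) (f := φ) l a) y

/-- Translates of a Schwartz function have seminorms of polynomial growth. -/
theorem SchwartzMap.pow_mul_norm_iteratedFDeriv_sub_le (φ : 𝓢(E, ℂ)) (k l : ℕ) (a y : E) :
    ‖y‖ ^ k * ‖iteratedFDeriv ℝ l φ (y - a)‖ ≤
      2 ^ k * (SchwartzMap.seminorm ℂ k l φ + SchwartzMap.seminorm ℂ 0 l φ) * (1 + ‖a‖) ^ k := by
  have h1 : ‖y‖ ^ k ≤ 2 ^ k * (‖y - a‖ ^ k + ‖a‖ ^ k) := by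
    have h : ‖y‖ ≤ ‖y - a‖ + ‖a‖ := by
      simpa using norm_add_le (y - a) a
    refine (pow_le_pow_left₀ (norm_nonneg _) h k).trans ?_
    refine (add_pow_le (norm_nonneg _) (norm_nonneg _) k).trans ?_
    gcongr
    · norm_num
    · exact Nat.sub_le _ _
  have h2 := φ.le_seminorm ℂ k l (y - a)
  have h3 := φ.iteratedFDeriv_bound l (y - a)
  have h4 : 1 ≤ (1 + ‖a‖) ^ k := one_le_pow₀ (by simp)
  have h5 : ‖a‖ ^ k ≤ (1 + ‖a‖) ^ k := pow_le_pow_left₀ (norm_nonneg _) (by simp) k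
  have h6 : 0 ≤ SchwartzMap.seminorm ℂ k l φ := apply_nonneg _ _
  calc ‖y‖ ^ k * ‖iteratedFDeriv ℝ l φ (y - a)‖
      ≤ 2 ^ k * (‖y - a‖ ^ k + ‖a‖ ^ k) * ‖iteratedFDeriv ℝ l φ (y - a)‖ := by gcongr
    _ = 2 ^ k * (‖y - a‖ ^ k * ‖iteratedFDeriv ℝ l φ (y - a)‖ +
        ‖a‖ ^ k * ‖iteratedFDeriv ℝ l φ (y - a)‖) := by ring
    _ ≤ 2 ^ k * (SchwartzMap.seminorm ℂ k l φ * (1 + ‖a‖) ^ k +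
        (1 + ‖a‖) ^ k * SchwartzMap.seminorm ℂ 0 l φ) := by
      have := h2.trans (le_mul_of_one_le_right h6 h4)
      gcongr
    _ = _ := by ring

theorem SchwartzMap.norm_weightedDeriv_compSubConstCLM_le (φ : 𝓢(E, ℂ)) (k l : ℕ) (a : E) :
    ‖(φ.compSubConstCLM ℂ a).weightedDeriv k l‖ ≤
      2 ^ k * (SchwartzMap.seminorm ℂ k l φ + SchwartzMap.seminorm ℂ 0 l φ) * (1 + ‖a‖) ^ k := by
  refine (BoundedContinuousFunction.norm_le (by positivity)).2 fun y => ?_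
  rw [weightedDeriv_apply, iteratedFDeriv_compSubConstCLM, norm_smul, norm_pow, norm_norm]
  exact φ.pow_mul_norm_iteratedFDeriv_sub_le k l a y

theorem SchwartzMap.continuous_weightedDeriv_compSubConstCLM (φ : 𝓢(E, ℂ)) (k l : ℕ) :
    Continuous fun a => (φ.compSubConstCLM ℂ a).weightedDeriv k l := by
  set C := 2 ^ k * (SchwartzMap.seminorm ℂ k (l + 1) φ + SchwartzMap.seminorm ℂ 0 (l + 1) φ)
    with hC
  have hC0 : 0 ≤ C := by positivity
  have key : ∀ R : ℝ, 0 ≤ R → ∀ a b : E, ‖a‖ ≤ R → ‖b‖ ≤ R →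
      dist ((φ.compSubConstCLM ℂ a).weightedDeriv k l) ((φ.compSubConstCLM ℂ b).weightedDeriv k l) ≤
        C * (1 + R) ^ k * ‖a - b‖ := by
    intro R hR a b ha hb
    refine (BoundedContinuousFunction.dist_le (by positivity)).2 fun y => ?_
    rw [dist_eq_norm, weightedDeriv_apply, weightedDeriv_apply,
      iteratedFDeriv_compSubConstCLM, iteratedFDeriv_compSubConstCLM]
    have hdiff : ∀ c ∈ Metric.closedBall (0 : E) R, HasFDerivWithinAt
        (fun c => (‖y‖ ^ k) • iteratedFDeriv ℝ l φ (y - c))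
        ((‖y‖ ^ k) • (fderiv ℝ (iteratedFDeriv ℝ l φ) (y - c)).comp
          (-ContinuousLinearMap.id ℝ E)) (Metric.closedBall (0 : E) R) c := by
      intro c _
      have hd : HasFDerivAt (iteratedFDeriv ℝ l φ) (fderiv ℝ (iteratedFDeriv ℝ l φ) (y - c))
          (y - c) :=
        ((φ.smooth ⊤).differentiable_iteratedFDeriv (m := l)
          (by exact_mod_cast ENat.natCast_lt_top l) _).hasFDerivAt
      exact ((hd.comp c ((hasFDerivAt_id c).const_sub y)).const_smul (‖y‖ ^ k)).hasFDerivWithinAt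
    refine (convex_closedBall (0 : E) R).norm_image_sub_le_of_norm_hasFDerivWithin_le hdiff
      (fun c hc => ?_) (by simpa using hb) (by simpa using ha)
    rw [norm_smul, norm_pow, norm_norm, ContinuousLinearMap.comp_neg, norm_neg,
      ContinuousLinearMap.comp_id, norm_fderiv_iteratedFDeriv]
    refine (φ.pow_mul_norm_iteratedFDeriv_sub_le k (l + 1) c y).trans ?_
    have : ‖c‖ ≤ R := by simpa using hc
    gcongr
  rw [continuous_iff_continuousAt]
  intro a
  rw [ContinuousAt, tendsto_iff_dist_tendsto_zero]
  have hlim : Filter.Tendsto (fun b => C * (1 + (‖a‖ + 1)) ^ k * ‖b - a‖) (𝓝 a) (𝓝 0) := by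
    have : Continuous fun b => C * (1 + (‖a‖ + 1)) ^ k * ‖b - a‖ := by fun_prop
    simpa using this.tendsto a
  refine squeeze_zero' (.of_forall fun _ => dist_nonneg) ?_ hlim
  filter_upwards [Metric.ball_mem_nhds a one_pos] with b hb
  have hb' : ‖b‖ ≤ ‖a‖ + 1 := by
    have h1 : ‖b - a‖ < 1 := by simpa [dist_eq_norm] using hb
    have h2 : ‖b‖ ≤ ‖b - a‖ + ‖a‖ := by simpa using norm_add_le (b - a) a
    linarith
  exact key (‖a‖ + 1) (by positivity) b a hb' (by simp)

theorem SchwartzMap.integrable_norm_mul_one_add_pow (g : 𝓢(E, ℂ)) (k : ℕ) :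
    Integrable fun a => ‖g a‖ * (1 + ‖a‖) ^ k := by
  have h : ∀ a, ‖g a‖ * (1 + ‖a‖) ^ k ≤ 2 ^ k * (‖g a‖ + ‖a‖ ^ k * ‖g a‖) := by
    intro a
    have h1 : (1 + ‖a‖) ^ k ≤ 2 ^ k * (1 + ‖a‖ ^ k) := by
      refine (add_pow_le zero_le_one (norm_nonneg _) k).trans ?_
      rw [one_pow]
      gcongr
      · norm_num
      · exact Nat.sub_le _ _
    calc ‖g a‖ * (1 + ‖a‖) ^ k ≤ ‖g a‖ * (2 ^ k * (1 + ‖a‖ ^ k)) := by gcongr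
      _ = _ := by ring
  refine ((g.integrable.norm.add (g.integrable_pow_mul volume k)).const_mul (2 ^ k)).mono'
    (by fun_prop) (.of_forall fun a => ?_)
  rw [Real.norm_of_nonneg (by positivity)]
  exact h a

theorem SchwartzMap.continuous_weightedDerivs_compSubConstCLM (s : Finset (ℕ × ℕ))
    (φ : 𝓢(E, ℂ)) : Continuous fun a => SchwartzMap.weightedDerivs s (φ.compSubConstCLM ℂ a) :=
  continuous_pi fun p => φ.continuous_weightedDeriv_compSubConstCLM p.1.1 p.1.2

theorem SchwartzMap.integrable_smul_weightedDerivs (s : Finset (ℕ × ℕ)) (g φ : 𝓢(E, ℂ)) :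
    Integrable fun a => g a • SchwartzMap.weightedDerivs s (φ.compSubConstCLM ℂ a) := by
  set K : ℝ := ∑ p ∈ s, 2 ^ p.1 *
    (SchwartzMap.seminorm ℂ p.1 p.2 φ + SchwartzMap.seminorm ℂ 0 p.2 φ) with hK
  set m : ℕ := s.sup Prod.fst with hm
  refine ((g.integrable_norm_mul_one_add_pow m).const_mul K).mono'
    (g.continuous.smul (SchwartzMap.continuous_weightedDerivs_compSubConstCLM s
      φ)).aestronglyMeasurable (.of_forall fun a => ?_)
  have hK0 : 0 ≤ K := Finset.sum_nonneg fun p _ => by positivity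
  have : ‖SchwartzMap.weightedDerivs s (φ.compSubConstCLM ℂ a)‖ ≤ K * (1 + ‖a‖) ^ m := by
    refine WeightedDerivSpace.norm_le (by positivity) fun p => ?_
    refine (φ.norm_weightedDeriv_compSubConstCLM_le p.1.1 p.1.2 a).trans ?_
    gcongr
    · exact Finset.single_le_sum (f := fun p : ℕ × ℕ => 2 ^ p.1 *
        (SchwartzMap.seminorm ℂ p.1 p.2 φ + SchwartzMap.seminorm ℂ 0 p.2 φ))
        (fun p _ => by positivity) p.2
    · simp
    · exact Finset.le_sup (f := Prod.fst) p.2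
  rw [norm_smul]
  calc ‖g a‖ * ‖SchwartzMap.weightedDerivs s (φ.compSubConstCLM ℂ a)‖
      ≤ ‖g a‖ * (K * (1 + ‖a‖) ^ m) := by gcongr
    _ = _ := by ring

/-- A continuous functional commutes with the integral that defines a convolution. -/
theorem SchwartzMap.functional_convolution (U : 𝓢(E, ℂ) →L[ℂ] ℂ) (g φ Φ : 𝓢(E, ℂ))
    (hΦ : ∀ y, Φ y = ∫ a, g a * φ (y - a)) :
    Integrable (fun a => g a * U (φ.compSubConstCLM ℂ a)) ∧
      U Φ = ∫ a, g a * U (φ.compSubConstCLM ℂ a) := by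
  obtain ⟨s, Λ, hΛ⟩ := SchwartzMap.exists_functional_weightedDerivs U
  have hint := SchwartzMap.integrable_smul_weightedDerivs s g φ
  have h1 : SchwartzMap.weightedDerivs s Φ =
      ∫ a, g a • SchwartzMap.weightedDerivs s (φ.compSubConstCLM ℂ a) := by
    refine WeightedDerivSpace.ext_eval fun p y => ?_
    rw [← ContinuousLinearMap.integral_comp_comm _ hint, eval_weightedDerivs]
    simp only [map_smul, eval_weightedDerivs, iteratedFDeriv_compSubConstCLM]
    have hΦ' : (Φ : E → ℂ) = fun y => ∫ a, g a • φ (y - a) := funext hΦ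
    rw [hΦ', SchwartzMap.iteratedFDeriv_integral_mul_sub, ← integral_smul]
    exact integral_congr_ae (.of_forall fun a => smul_comm _ _ _)
  have h2 : ∀ a, g a * U (φ.compSubConstCLM ℂ a) =
      Λ (g a • SchwartzMap.weightedDerivs s (φ.compSubConstCLM ℂ a)) := by
    intro a
    rw [map_smul, ← hΛ, smul_eq_mul]
  simp only [h2]
  exact ⟨Λ.integrable_comp hint, by rw [hΛ, h1, ContinuousLinearMap.integral_comp_comm _ hint]⟩

theorem SchwartzMap.continuous_functional_compSubConstCLM (U : 𝓢(E, ℂ) →L[ℂ] ℂ) (φ : 𝓢(E, ℂ)) :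
    Continuous fun a => U (φ.compSubConstCLM ℂ a) := by
  obtain ⟨s, Λ, hΛ⟩ := SchwartzMap.exists_functional_weightedDerivs U
  simp only [hΛ]
  exact Λ.continuous.comp (SchwartzMap.continuous_weightedDerivs_compSubConstCLM s φ)

end WeakIntegral

section Cutoff

/-- There is a Schwartz function on the line that is `e^{-t}` for `t ≥ 0`. -/
theorem exists_schwartzMap_eq_exp_neg : ∃ S : 𝓢(ℝ, ℝ), ∀ t, 0 ≤ t → S t = Real.exp (-t) := by
  set f : ℝ → ℝ := fun t => Real.smoothTransition (t + 1) * Real.exp (-t) with hf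
  have hf1 : ∀ t, 0 ≤ t → f t = Real.exp (-t) := fun t ht => by
    simp [hf, Real.smoothTransition.one_of_one_le (by linarith : 1 ≤ t + 1)]
  have hf0 : ∀ t, t ≤ -1 → f t = 0 := fun t ht => by
    simp [hf, Real.smoothTransition.zero_of_nonpos (by linarith : t + 1 ≤ 0)]
  have hsm : ContDiff ℝ (⊤ : ℕ∞) f :=
    (Real.smoothTransition.contDiff.comp (contDiff_id.add contDiff_const)).mul
      (Real.contDiff_exp.comp contDiff_neg)
  refine ⟨⟨f, hsm, fun k n => ?_⟩, hf1⟩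
  have hc : Continuous fun t : ℝ => ‖t‖ ^ k * ‖iteratedFDeriv ℝ n f t‖ :=
    (continuous_norm.pow k).mul
      (hsm.continuous_iteratedFDeriv (by exact_mod_cast le_top)).norm
  obtain ⟨C, hC⟩ := (isCompact_Icc (a := (-1 : ℝ)) (b := 0)).bddAbove_image hc.continuousOn
  refine ⟨max C k.factorial, fun t => ?_⟩
  by_cases h1 : t < -1
  · have : f =ᶠ[𝓝 t] fun _ => 0 := by
      filter_upwards [Iio_mem_nhds h1] with s hs
      exact hf0 s (le_of_lt hs)
    rw [(this.iteratedFDeriv (𝕜 := ℝ) n).eq_of_nhds]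
    have h0 : iteratedFDeriv ℝ n (fun _ : ℝ => (0 : ℝ)) = 0 := iteratedFDeriv_fun_zero
    rw [h0]
    simp
  · by_cases h2 : t ≤ 0
    · exact (hC ⟨t, ⟨not_lt.1 h1, h2⟩, rfl⟩).trans (le_max_left _ _)
    · push Not at h2
      have : f =ᶠ[𝓝 t] fun s => Real.exp ((-1) * s) := by
        filter_upwards [Ioi_mem_nhds h2] with s hs
        rw [hf1 s (le_of_lt hs), neg_one_mul]
      refine le_trans ?_ (le_max_right _ _)
      rw [(this.iteratedFDeriv (𝕜 := ℝ) n).eq_of_nhds, norm_iteratedFDeriv_eq_norm_iteratedDeriv,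
        iteratedDeriv_exp_const_mul, norm_mul, norm_pow, norm_neg, norm_one, one_pow, one_mul,
        Real.norm_of_nonneg h2.le, Real.norm_of_nonneg (Real.exp_pos _).le, neg_one_mul,
        Real.exp_neg]
      have := Real.pow_div_factorial_le_exp t h2.le k
      rw [div_le_iff₀ (by positivity)] at this
      rw [← div_eq_mul_inv, div_le_iff₀ (Real.exp_pos _)]
      linarith

variable {E : Type*} [NormedAddCommGroup E] [InnerProductSpace ℝ E]

/-- If `⟪y, θ⟫ ≤ -c ‖y‖` on a set, then `e^{⟪y, θ⟫}` coincides with a Schwartz function on every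
neighbourhood of this set of bounded width. -/
theorem exists_schwartzMap_eq_exp_inner {C : Set E} {θ : E} {c : ℝ} (hc : 0 < c)
    (hC : ∀ y ∈ C, inner ℝ y θ ≤ -c * ‖y‖) (R : ℝ) :
    ∃ f : 𝓢(E, ℂ), ∀ y, (∃ x ∈ C, ‖y - x‖ ≤ R) →
      f y = Complex.exp ((inner ℝ y θ : ℝ) : ℂ) := by
  obtain ⟨S, hS⟩ := exists_schwartzMap_eq_exp_neg
  set M : ℝ := c * R + R * ‖θ‖ + c / 2 with hM
  set w : E → ℝ := fun y => (c / 2) * (1 + ‖y‖ ^ 2) ^ (1 / 2 : ℝ) with hw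
  have hwg : w.HasTemperateGrowth :=
    (Function.HasTemperateGrowth.const (c / 2)).mul
      (Function.hasTemperateGrowth_one_add_norm_sq_rpow E (1 / 2))
  set h : E → ℝ := fun y => (M - inner ℝ y θ) - w y with hh
  have hhg : h.HasTemperateGrowth :=
    ((Function.HasTemperateGrowth.const M).sub (Function.hasTemperateGrowth_inner_left θ)).sub hwg
  have hsq : ∀ y : E, (1 + ‖y‖ ^ 2) ^ (1 / 2 : ℝ) = Real.sqrt (1 + ‖y‖ ^ 2) := fun y =>
    (Real.sqrt_eq_rpow _).symm
  have hw0 : ∀ y, 0 ≤ w y := fun y => by positivity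
  have hw1 : ∀ y, (c / 2) * ‖y‖ ≤ w y := fun y => by
    rw [hw]
    simp only [hsq]
    gcongr
    exact Real.le_sqrt_of_sq_le (by linarith [sq_nonneg ‖y‖])
  have hw2 : ∀ y, w y ≤ (c / 2) * (1 + ‖y‖) := fun y => by
    rw [hw]
    simp only [hsq]
    gcongr
    exact Real.sqrt_le_iff.2 ⟨by positivity, by nlinarith [norm_nonneg y]⟩
  have hup : ∃ (k : ℕ) (K : ℝ), ∀ y, ‖y‖ ≤ K * (1 + ‖w y‖) ^ k := by
    refine ⟨1, 2 / c, fun y => ?_⟩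
    rw [pow_one, Real.norm_of_nonneg (hw0 y), div_mul_eq_mul_div, le_div_iff₀ hc]
    linarith [hw1 y]
  have hSh : (fun y => (((Real.exp M * S (h y) : ℝ)) : ℂ)).HasTemperateGrowth :=
    Function.Complex.hasTemperateGrowth_ofReal.comp
      ((Function.HasTemperateGrowth.const (Real.exp M)).mul (S.hasTemperateGrowth.comp hhg))
  refine ⟨SchwartzMap.smulLeftCLM ℂ (fun y => (((Real.exp M * S (h y) : ℝ)) : ℂ))
    (SchwartzMap.postcompCLM (𝕜 := ℝ) Complex.ofRealCLM (SchwartzMap.compCLM ℝ hwg hup S)), ?_⟩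
  rintro y ⟨x, hx, hxy⟩
  have hh0 : 0 ≤ h y := by
    have h1 : inner ℝ y θ = inner ℝ x θ + inner ℝ (y - x) θ := by
      rw [← inner_add_left, add_sub_cancel]
    have h2 : inner ℝ (y - x) θ ≤ R * ‖θ‖ :=
      (real_inner_le_norm _ _).trans (mul_le_mul_of_nonneg_right hxy (norm_nonneg _))
    have h3 : ‖y‖ ≤ ‖x‖ + R := by
      have := norm_add_le x (y - x)
      rw [add_sub_cancel] at this
      linarith
    have h4 := hC x hx
    have h5 := hw2 y
    have h6 : c * ‖y‖ ≤ c * (‖x‖ + R) := by gcongr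
    have h7 : 0 ≤ c * ‖y‖ := by positivity
    simp only [hh, hM]
    nlinarith
  rw [SchwartzMap.smulLeftCLM_apply_apply hSh, SchwartzMap.postcompCLM_apply]
  simp only [SchwartzMap.compCLM_apply, Function.comp_apply]
  rw [hS _ hh0, hS _ (hw0 y), smul_eq_mul, Complex.ofRealCLM_apply, ← Complex.ofReal_mul,
    ← Complex.ofReal_exp, ← Real.exp_add, ← Real.exp_add]
  congr 2
  simp only [hh]
  ring

end Cutoff

section Density

variable {E : Type*} [NormedAddCommGroup E] [InnerProductSpace ℝ E] [FiniteDimensional ℝ E]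

/-- Compactly supported functions are dense in the Schwartz space. -/
theorem SchwartzMap.exists_tendsto_hasCompactSupport (φ : 𝓢(E, ℂ)) :
    ∃ u : ℕ → 𝓢(E, ℂ), (∀ N, HasCompactSupport (u N)) ∧
      Filter.Tendsto u Filter.atTop (𝓝 φ) := by
  let b : ContDiffBump (0 : E) := ⟨1, 2, one_pos, one_lt_two⟩
  set m : E → ℂ := fun y => ((b y : ℝ) : ℂ) - 1 with hm
  have hbs : ContDiff ℝ (⊤ : ℕ∞) (fun y => ((b y : ℝ) : ℂ)) :=
    Complex.ofRealCLM.contDiff.comp b.contDiff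
  have hbc : HasCompactSupport (fun y => ((b y : ℝ) : ℂ)) :=
    b.hasCompactSupport.comp_left (g := fun t : ℝ => (t : ℂ)) Complex.ofReal_zero
  have hms : ContDiff ℝ (⊤ : ℕ∞) m := hbs.sub contDiff_const
  have hmb : ∀ i, ∃ B, 0 ≤ B ∧ ∀ y, ‖iteratedFDeriv ℝ i m y‖ ≤ B := by
    intro i
    set β : 𝓢(E, ℂ) := hbc.toSchwartzMap hbs
    refine ⟨SchwartzMap.seminorm ℂ 0 i β + 1, by positivity, fun y => ?_⟩
    have h1 : iteratedFDeriv ℝ i m y =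
        iteratedFDeriv ℝ i β y - iteratedFDeriv ℝ i (fun _ : E => (1 : ℂ)) y :=
      iteratedFDeriv_sub_apply ((hbs.of_le (by exact_mod_cast le_top)).contDiffAt)
        contDiffAt_const
    rw [h1]
    refine (norm_sub_le _ _).trans (add_le_add (by simpa using β.le_seminorm ℂ 0 i y) ?_)
    rcases Nat.eq_zero_or_pos i with rfl | hi
    · simp
    · rw [iteratedFDeriv_const_of_ne hi.ne']
      simp
  choose B hB0 hB using hmb
  have hR : ∀ N : ℕ, (0 : ℝ) < N + 1 := fun N => by positivity
  have hscal : ∀ N : ℕ, ContDiff ℝ (⊤ : ℕ∞) (fun y : E => ((N : ℝ) + 1)⁻¹ • y) := fun N =>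
    contDiff_id.const_smul _
  have hcs : ∀ N : ℕ, HasCompactSupport
      (fun y : E => ((b (((N : ℝ) + 1)⁻¹ • y) : ℝ) : ℂ) * φ y) := fun N =>
    HasCompactSupport.mul_right (hbc.comp_homeomorph (Homeomorph.smulOfNeZero _
      (inv_ne_zero (hR N).ne')))
  set u : ℕ → 𝓢(E, ℂ) := fun N => (hcs N).toSchwartzMap
    ((hbs.comp (hscal N)).mul (φ.smooth ⊤)) with hu
  refine ⟨u, hcs, ?_⟩
  rw [(schwartz_withSeminorms ℂ E ℂ).tendsto_nhds]
  rintro ⟨k, l⟩ ε hε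
  set K : ℝ := ∑ i ∈ Finset.range (l + 1), (l.choose i : ℝ) * B i *
    SchwartzMap.seminorm ℂ (k + 1) (l - i) φ with hK
  have hK0 : 0 ≤ K := Finset.sum_nonneg fun i _ => by
    have := hB0 i
    positivity
  have hbound : ∀ N : ℕ, SchwartzMap.seminorm ℂ k l (u N - φ) ≤ K / ((N : ℝ) + 1) := by
    intro N
    refine SchwartzMap.seminorm_le_bound ℂ k l _ (by have := hR N; positivity) fun y => ?_
    have hfun : (⇑(u N - φ) : E → ℂ) = fun y => m (((N : ℝ) + 1)⁻¹ • y) * φ y := by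
      funext z
      simp [hu, hm, sub_mul]
    rw [hfun]
    by_cases hy : ‖y‖ < (N : ℝ) + 1
    · have h0 : (fun y => m (((N : ℝ) + 1)⁻¹ • y) * φ y) =ᶠ[𝓝 y] fun _ => 0 := by
        filter_upwards [(isOpen_lt continuous_norm continuous_const).mem_nhds hy] with z hz
        have : b (((N : ℝ) + 1)⁻¹ • z) = 1 := by
          refine b.one_of_mem_closedBall ?_
          rw [mem_closedBall_zero_iff, norm_smul, norm_inv, Real.norm_of_nonneg (hR N).le,
            inv_mul_le_iff₀ (hR N)]
          exact (le_of_lt hz).trans_eq (mul_one _).symm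
        simp [hm, this]
      rw [(h0.iteratedFDeriv (𝕜 := ℝ) l).eq_of_nhds]
      have h00 : iteratedFDeriv ℝ l (fun _ : E => (0 : ℂ)) = 0 := iteratedFDeriv_fun_zero
      rw [h00]
      have := hR N
      simp only [Pi.zero_apply, norm_zero, mul_zero]
      positivity
    · push Not at hy
      have hle := norm_iteratedFDeriv_mul_le (𝕜 := ℝ) (N := ((⊤ : ℕ∞) : WithTop ℕ∞))
        (hms.comp (hscal N)) (φ.smooth ⊤) y (n := l) (by exact_mod_cast le_top)
      have hd : ∀ i, ‖iteratedFDeriv ℝ i (m ∘ fun y : E => ((N : ℝ) + 1)⁻¹ • y) y‖ ≤ B i := by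
        intro i
        have := congrFun (iteratedFDeriv_comp_const_smul (𝕜 := ℝ) (i := i) (f := m)
          (((N : ℝ) + 1)⁻¹) (hms.of_le (by exact_mod_cast le_top))) y
        change ‖iteratedFDeriv ℝ i (fun z => m (((N : ℝ) + 1)⁻¹ • z)) y‖ ≤ _
        rw [this, norm_smul, norm_pow, norm_inv, Real.norm_of_nonneg (hR N).le]
        refine (mul_le_of_le_one_left (norm_nonneg _) ?_).trans (hB i _)
        refine pow_le_one₀ (by have := hR N; positivity) (inv_le_one_of_one_le₀ ?_)
        have : (0 : ℝ) ≤ N := N.cast_nonneg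
        linarith
      rw [le_div_iff₀ (hR N)]
      calc ‖y‖ ^ k * ‖iteratedFDeriv ℝ l (fun y => m (((N : ℝ) + 1)⁻¹ • y) * φ y) y‖ *
            ((N : ℝ) + 1)
          ≤ ‖y‖ ^ k * (∑ i ∈ Finset.range (l + 1), (l.choose i : ℝ) * B i *
              ‖iteratedFDeriv ℝ (l - i) φ y‖) * ‖y‖ := by
            have hsum : ‖iteratedFDeriv ℝ l (fun y => m (((N : ℝ) + 1)⁻¹ • y) * φ y) y‖ ≤
                ∑ i ∈ Finset.range (l + 1), (l.choose i : ℝ) * B i *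
                  ‖iteratedFDeriv ℝ (l - i) φ y‖ := by
              refine hle.trans (Finset.sum_le_sum fun i _ => ?_)
              have := hd i
              gcongr
            have hsum0 := (norm_nonneg _).trans hsum
            gcongr
        _ = ∑ i ∈ Finset.range (l + 1), (l.choose i : ℝ) * B i *
              (‖y‖ ^ (k + 1) * ‖iteratedFDeriv ℝ (l - i) φ y‖) := by
            rw [Finset.mul_sum, Finset.sum_mul]
            exact Finset.sum_congr rfl fun i _ => by ring
        _ ≤ K := by
            refine Finset.sum_le_sum fun i _ => ?_
            have := hB0 i
            have := φ.le_seminorm ℂ (k + 1) (l - i) y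
            gcongr
  have hlim : Filter.Tendsto (fun N : ℕ => K / ((N : ℝ) + 1)) Filter.atTop (𝓝 0) :=
    Filter.Tendsto.div_atTop tendsto_const_nhds
      (Filter.tendsto_atTop_add_const_right _ _ tendsto_natCast_atTop_atTop)
  filter_upwards [hlim.eventually (gt_mem_nhds hε)] with N hN
  exact (hbound N).trans_lt hN

end Density

section LaplaceUniqueness

variable {E : Type*} [NormedAddCommGroup E] [InnerProductSpace ℝ E] [FiniteDimensional ℝ E]
  [MeasurableSpace E] [BorelSpace E]

theorem abs_mul_exp_le {r r' s t : ℝ} (hr : r < r') (ht : |t| ≤ r) :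
    |s| * Real.exp (t * s) ≤ (r' - r)⁻¹ * (Real.exp (r' * s) + Real.exp (-(r' * s))) := by
  have hd : 0 < r' - r := sub_pos.2 hr
  have h1 : (r' - r) * |s| ≤ Real.exp ((r' - r) * |s|) :=
    (le_add_of_nonneg_right zero_le_one).trans (Real.add_one_le_exp _)
  have h2 : t * s ≤ r * |s| := (le_abs_self _).trans (by rw [abs_mul]; gcongr)
  have h3 : Real.exp (r' * |s|) ≤ Real.exp (r' * s) + Real.exp (-(r' * s)) := by
    rcases abs_cases s with ⟨h, -⟩ | ⟨h, -⟩ <;> rw [h]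
    · exact le_add_of_nonneg_right (Real.exp_pos _).le
    · rw [mul_neg]
      exact le_add_of_nonneg_left (Real.exp_pos _).le
  rw [← div_eq_inv_mul, le_div_iff₀ hd]
  calc |s| * Real.exp (t * s) * (r' - r)
      = ((r' - r) * |s|) * Real.exp (t * s) := by ring
    _ ≤ Real.exp ((r' - r) * |s|) * Real.exp (r * |s|) := by gcongr
    _ = Real.exp (r' * |s|) := by rw [← Real.exp_add]; congr 1; ring
    _ ≤ _ := h3

/-- The Laplace transform in a fixed direction is holomorphic in a strip. -/
theorem differentiableOn_integral_mul_cexp {G : E → ℂ} {η : E} {δ : ℝ} (hG : Continuous G)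
    (hint : ∀ t : ℝ, |t| < δ →
      Integrable fun a => G a * Complex.exp ((t * inner ℝ a η : ℝ) : ℂ)) :
    DifferentiableOn ℂ (fun z : ℂ => ∫ a, G a * Complex.exp (z * ((inner ℝ a η : ℝ) : ℂ)))
      {z | |z.re| < δ} := by
  intro z₀ hz₀
  have hz₀' : |z₀.re| < δ := hz₀
  obtain ⟨r', hr1, hr2⟩ := exists_between hz₀'
  obtain ⟨r, hr3, hr4⟩ := exists_between hr1
  have hr'0 : |r'| < δ := by rwa [abs_of_nonneg ((abs_nonneg _).trans hr1.le)]
  have hre : ∀ (z : ℂ) (s : ℝ), ‖Complex.exp (z * (s : ℂ))‖ = Real.exp (z.re * s) := by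
    intro z s
    rw [Complex.norm_exp]
    simp
  have hnorm : ∀ t : ℝ, |t| < δ → Integrable fun a => ‖G a‖ * Real.exp (t * inner ℝ a η) := by
    intro t ht
    refine (hint t ht).norm.congr (.of_forall fun a => ?_)
    simp only [norm_mul]
    rw [Complex.norm_exp, Complex.ofReal_re]
  have hcont : ∀ z : ℂ, Continuous fun a => G a * Complex.exp (z * ((inner ℝ a η : ℝ) : ℂ)) := by
    intro z
    fun_prop
  have hint0 : Integrable fun a => G a * Complex.exp (z₀ * ((inner ℝ a η : ℝ) : ℂ)) := by
    refine (hnorm _ hz₀').mono' (hcont _).aestronglyMeasurable (.of_forall fun a => ?_)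
    rw [norm_mul, hre]
  have hs : {z : ℂ | |z.re| < r} ∈ 𝓝 z₀ :=
    (isOpen_lt (Complex.continuous_re.abs) continuous_const).mem_nhds hr3
  refine (hasDerivAt_integral_of_dominated_loc_of_deriv_le (𝕜 := ℂ) hs
    (F := fun z a => G a * Complex.exp (z * ((inner ℝ a η : ℝ) : ℂ)))
    (F' := fun z a => G a * (Complex.exp (z * ((inner ℝ a η : ℝ) : ℂ)) * ((inner ℝ a η : ℝ) : ℂ)))
    (bound := fun a => (r' - r)⁻¹ * (‖G a‖ * Real.exp (r' * inner ℝ a η) +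
      ‖G a‖ * Real.exp ((-r') * inner ℝ a η)))
    (.of_forall fun z => (hcont z).aestronglyMeasurable) hint0 ?_ ?_ ?_
    ?_).2.differentiableAt.differentiableWithinAt
  · exact Continuous.aestronglyMeasurable (by fun_prop)
  · refine .of_forall fun a z hz => ?_
    have hz' : |z.re| ≤ r := le_of_lt hz
    rw [norm_mul, norm_mul, hre, Complex.norm_real, Real.norm_eq_abs, ← mul_add,
      mul_left_comm (r' - r)⁻¹, mul_comm (Real.exp _), neg_mul]
    exact mul_le_mul_of_nonneg_left (abs_mul_exp_le hr4 hz') (norm_nonneg (G a))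
  · exact ((hnorm r' hr'0).add (hnorm (-r') (by rwa [abs_neg]))).const_mul _
  · refine .of_forall fun a z _ => ?_
    have h1 : HasDerivAt (fun z : ℂ => z * ((inner ℝ a η : ℝ) : ℂ)) ((inner ℝ a η : ℝ) : ℂ) z :=
      hasDerivAt_mul_const _
    exact (h1.cexp).const_mul _

/-- A continuous function whose Laplace transform vanishes near the origin is zero. -/
theorem eq_zero_of_integral_mul_exp_eq_zero {G : E → ℂ} {c : ℝ} (hc : 0 < c) (hG : Continuous G)
    (hint : ∀ η : E, ‖η‖ < c → Integrable fun a => G a * Complex.exp ((inner ℝ a η : ℝ) : ℂ))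
    (hzero : ∀ η : E, ‖η‖ < c → ∫ a, G a * Complex.exp ((inner ℝ a η : ℝ) : ℂ) = 0) :
    G = 0 := by
  have hF : FourierTransform.fourier G = 0 := by
    funext η
    rw [Pi.zero_apply, Real.fourier_eq']
    set δ : ℝ := c / (‖η‖ + 1) with hδ
    have hη : 0 < ‖η‖ + 1 := by positivity
    have hδ0 : 0 < δ := by positivity
    have hlt : ∀ t : ℝ, |t| < δ → ‖t • η‖ < c := by
      intro t ht
      rw [norm_smul, Real.norm_eq_abs]
      calc |t| * ‖η‖ ≤ |t| * (‖η‖ + 1) := by gcongr; linarith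
        _ < δ * (‖η‖ + 1) := by gcongr
        _ = c := div_mul_cancel₀ _ hη.ne'
    set f : ℂ → ℂ := fun z => ∫ a, G a * Complex.exp (z * ((inner ℝ a η : ℝ) : ℂ)) with hf
    have hopen : IsOpen {z : ℂ | |z.re| < δ} := isOpen_lt Complex.continuous_re.abs continuous_const
    have hconv : Convex ℝ {z : ℂ | |z.re| < δ} := by
      have : {z : ℂ | |z.re| < δ} = Complex.reLm ⁻¹' Metric.ball 0 δ := by
        ext z
        simp
      rw [this]
      exact (convex_ball 0 δ).linear_preimage _
    have hana : AnalyticOnNhd ℂ f {z : ℂ | |z.re| < δ} :=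
      (differentiableOn_integral_mul_cexp hG fun t ht => by
        have := hint _ (hlt t ht)
        simpa only [inner_smul_right] using this).analyticOnNhd hopen
    have hreal : ∀ t : ℝ, |t| < δ → f t = 0 := by
      intro t ht
      have := hzero _ (hlt t ht)
      simpa only [hf, inner_smul_right, Complex.ofReal_mul] using this
    have hfreq : ∃ᶠ z in 𝓝[≠] (0 : ℂ), f z = 0 := by
      have htend : Filter.Tendsto (fun t : ℝ => (t : ℂ)) (𝓝[≠] 0) (𝓝[≠] 0) := by
        refine tendsto_nhdsWithin_of_tendsto_nhds_of_eventually_within _ ?_ ?_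
        · exact (Complex.continuous_ofReal.tendsto' 0 0 Complex.ofReal_zero).mono_left
            nhdsWithin_le_nhds
        · filter_upwards [self_mem_nhdsWithin] with t ht
          simpa using ht
      refine htend.frequently (Filter.Eventually.frequently ?_)
      have : ∀ᶠ t : ℝ in 𝓝 0, |t| < δ :=
        (isOpen_lt continuous_abs continuous_const).mem_nhds (by simpa using hδ0)
      filter_upwards [nhdsWithin_le_nhds this] with t ht
      exact hreal t ht
    have hall := hana.eqOn_zero_of_preconnected_of_frequently_eq_zero hconv.isPreconnected
      (z₀ := 0) (by simpa using hδ0) hfreq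
    have h2 := hall (x := ((-2 * Real.pi : ℝ) : ℂ) * Complex.I) (by simpa using hδ0)
    simp only [hf, Pi.zero_apply] at h2
    rw [← h2]
    refine integral_congr_ae (.of_forall fun a => ?_)
    simp only [smul_eq_mul]
    rw [mul_comm]
    congr 2
    push_cast
    ring
  have hGint : Integrable G := by
    have := hint 0 (by simpa using hc)
    simpa using this
  have := hG.fourierInv_fourier_eq hGint (by rw [hF]; exact integrable_zero _ _ _)
  rw [← this, hF]
  funext v
  simp [Real.fourierInv_eq]

/-- A functional on the Schwartz space that vanishes on all functions which coincide with
`e^{⟪y, θ⟫}` near `C`, for all `θ` in a ball, is zero. -/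
theorem SchwartzMap.eq_zero_of_laplace_eq_zero (D : 𝓢(E, ℂ) →L[ℂ] ℂ) {C : Set E} {θ₀ : E} {c : ℝ}
    (hc : 0 < c) (hC : ∀ y ∈ C, inner ℝ y θ₀ ≤ -c * ‖y‖)
    (hD : ∀ θ, ‖θ - θ₀‖ < c → ∀ f : 𝓢(E, ℂ),
      (∀ᶠ y in 𝓝ˢ C, f y = Complex.exp ((inner ℝ y θ : ℝ) : ℂ)) → D f = 0) : D = 0 := by
  have hCθ : ∀ θ, ‖θ - θ₀‖ < c → ∀ y ∈ C, inner ℝ y θ ≤ -(c - ‖θ - θ₀‖) * ‖y‖ := by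
    intro θ _ y hy
    have h1 : inner ℝ y θ = inner ℝ y θ₀ + inner ℝ y (θ - θ₀) := by
      rw [← inner_add_right, add_sub_cancel]
    have h2 := real_inner_le_norm y (θ - θ₀)
    have h3 := hC y hy
    rw [h1]
    linarith
  have hnhds : ∀ R : ℝ, 0 < R → {y : E | ∃ x ∈ C, ‖y - x‖ < R} ∈ 𝓝ˢ C := by
    intro R hR
    rw [mem_nhdsSet_iff_forall]
    intro x hx
    filter_upwards [Metric.ball_mem_nhds x hR] with y hy
    exact ⟨x, hx, by simpa [dist_eq_norm] using hy⟩
  have hzero : ∀ f : 𝓢(E, ℂ), (∀ᶠ y in 𝓝ˢ C, f y = 0) → D f = 0 := by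
    intro f hf
    obtain ⟨g, hg⟩ := exists_schwartzMap_eq_exp_inner hc hC 1
    have hg' : ∀ᶠ y in 𝓝ˢ C, g y = Complex.exp ((inner ℝ y θ₀ : ℝ) : ℂ) := by
      filter_upwards [hnhds 1 one_pos] with y ⟨x, hx, hxy⟩
      exact hg y ⟨x, hx, hxy.le⟩
    have h1 := hD θ₀ (by simpa using hc) g hg'
    have h2 := hD θ₀ (by simpa using hc) (f + g) (by
      filter_upwards [hf, hg'] with y h1 h2
      simp [h1, h2])
    rwa [map_add, h1, add_zero] at h2
  have hcomp : ∀ φ : 𝓢(E, ℂ), HasCompactSupport φ → D φ = 0 := by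
    intro φ hφ
    obtain ⟨ρ, hρ0, hρ⟩ : ∃ ρ : ℝ, 0 < ρ ∧ ∀ y, φ y ≠ 0 → ‖y‖ ≤ ρ := by
      obtain ⟨ρ, hρ⟩ := hφ.isCompact.isBounded.exists_norm_le
      exact ⟨max ρ 1, by positivity, fun y hy =>
        (hρ y (subset_tsupport _ hy)).trans (le_max_left _ _)⟩
    set F : E → ℂ := fun a => D (φ.compSubConstCLM ℂ a) with hF
    have hFc : Continuous F := SchwartzMap.continuous_functional_compSubConstCLM D φ
    have hF0 : ∀ a, (¬ ∃ x ∈ C, ‖a - x‖ ≤ ρ + 1) → F a = 0 := by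
      intro a ha
      refine hzero _ ?_
      filter_upwards [hnhds 1 one_pos] with y ⟨x, hx, hxy⟩
      rw [SchwartzMap.compSubConstCLM_apply]
      by_contra hne
      refine ha ⟨x, hx, ?_⟩
      have h1 := hρ _ hne
      have h2 : ‖a - x‖ ≤ ‖a - y‖ + ‖y - x‖ := norm_sub_le_norm_sub_add_norm_sub _ _ _
      rw [norm_sub_rev a y] at h2
      linarith
    have hlap : ∀ θ, ‖θ - θ₀‖ < c →
        Integrable (fun a => F a * Complex.exp ((inner ℝ a θ : ℝ) : ℂ)) ∧
          ∫ a, F a * Complex.exp ((inner ℝ a θ : ℝ) : ℂ) = 0 := by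
      intro θ hθ
      obtain ⟨g, hg⟩ := exists_schwartzMap_eq_exp_inner (sub_pos.2 hθ) (hCθ θ hθ) (ρ + 1)
      have hg' : ∀ᶠ y in 𝓝ˢ C, g y = Complex.exp ((inner ℝ y θ : ℝ) : ℂ) := by
        filter_upwards [hnhds 1 one_pos] with y ⟨x, hx, hxy⟩
        exact hg y ⟨x, hx, by linarith⟩
      have hgF : ∀ a, F a * Complex.exp ((inner ℝ a θ : ℝ) : ℂ) = g a * F a := by
        intro a
        by_cases ha : ∃ x ∈ C, ‖a - x‖ ≤ ρ + 1
        · rw [hg a ha, mul_comm]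
        · rw [hF0 a ha, zero_mul, mul_zero]
      set Φ := SchwartzMap.convolution (ContinuousLinearMap.mul ℂ ℂ) g φ with hΦ
      have hΦi : ∀ y, Φ y = ∫ a, g a * φ (y - a) := fun y => by
        rw [hΦ, SchwartzMap.convolution_apply]
        rfl
      obtain ⟨h1, h2⟩ := SchwartzMap.functional_convolution D g φ Φ hΦi
      simp only [hgF]
      refine ⟨h1, h2.symm.trans ?_⟩
      set κ : ℂ := ∫ b, Complex.exp ((-inner ℝ b θ : ℝ) : ℂ) * φ b with hκ
      have hΦκ : ∀ᶠ y in 𝓝ˢ C, (Φ - κ • g) y = 0 := by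
        filter_upwards [hnhds 1 one_pos, hg'] with y ⟨x, hx, hxy⟩ hgy
        have h3 : ∀ a, g a * φ (y - a) = Complex.exp ((inner ℝ a θ : ℝ) : ℂ) * φ (y - a) := by
          intro a
          by_cases hne : φ (y - a) = 0
          · rw [hne, mul_zero, mul_zero]
          · have h4 := hρ _ hne
            have h5 : ‖a - x‖ ≤ ‖a - y‖ + ‖y - x‖ := norm_sub_le_norm_sub_add_norm_sub _ _ _
            rw [norm_sub_rev a y] at h5
            rw [hg a ⟨x, hx, by linarith⟩]
        have h6 : Φ y = κ * Complex.exp ((inner ℝ y θ : ℝ) : ℂ) := by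
          rw [hΦi]
          simp only [h3]
          rw [← integral_sub_left_eq_self _ volume y, hκ, ← integral_mul_const]
          refine integral_congr_ae (.of_forall fun b => ?_)
          simp only [sub_sub_cancel, inner_sub_left]
          rw [mul_right_comm, ← Complex.exp_add]
          congr 2
          push_cast
          ring
        simp [h6, hgy]
      have h7 := hzero _ hΦκ
      rwa [map_sub, map_smul, hD θ hθ g hg', smul_zero, sub_zero] at h7
    have hG : (fun a => F a * Complex.exp ((inner ℝ a θ₀ : ℝ) : ℂ)) = 0 := by
      have hexp : ∀ η a, F a * Complex.exp ((inner ℝ a θ₀ : ℝ) : ℂ) *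
          Complex.exp ((inner ℝ a η : ℝ) : ℂ) =
          F a * Complex.exp ((inner ℝ a (θ₀ + η) : ℝ) : ℂ) := by
        intro η a
        rw [mul_assoc, ← Complex.exp_add, inner_add_right, Complex.ofReal_add]
      refine eq_zero_of_integral_mul_exp_eq_zero hc (by fun_prop) (fun η hη => ?_) fun η hη => ?_
      · simp only [hexp]
        exact (hlap (θ₀ + η) (by simpa using hη)).1
      · simp only [hexp]
        exact (hlap (θ₀ + η) (by simpa using hη)).2
    have h0 := congrFun hG 0
    simpa [hF] using h0
  ext φ
  obtain ⟨u, hu, hlim⟩ := φ.exists_tendsto_hasCompactSupport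
  have h1 := (D.continuous.tendsto φ).comp hlim
  have h2 : (D ∘ u) = fun _ => 0 := funext fun N => hcomp _ (hu N)
  rw [h2] at h1
  exact tendsto_nhds_unique h1 tendsto_const_nhds

end LaplaceUniqueness

namespace GindikinRiesz

variable {r : ℕ} {n : Fin r → ℕ} {𝒱 : BlockSystem r n}

/-! ### Calculus of blocks -/

section Blocks

theorem blk_add (A B : Matrix (Idx n) (Idx n) ℝ) (l k : Fin r) :
    blk (A + B) l k = blk A l k + blk B l k := rfl

theorem blk_smul (c : ℝ) (A : Matrix (Idx n) (Idx n) ℝ) (l k : Fin r) :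
    blk (c • A) l k = c • blk A l k := rfl

theorem blk_transpose (A : Matrix (Idx n) (Idx n) ℝ) (l k : Fin r) :
    blk A.transpose l k = (blk A k l).transpose := rfl

theorem blk_mul (A B : Matrix (Idx n) (Idx n) ℝ) (l k : Fin r) :
    blk (A * B) l k = ∑ a, blk A l a * blk B a k := by
  ext a b
  simp [blk, Matrix.mul_apply, Fintype.sum_sigma, Matrix.sum_apply]

theorem colBlk_mul {m : ℕ} (A : Matrix (Idx n) (Idx n) ℝ) (x : Matrix (Idx n) (Fin m) ℝ)
    (l : Fin r) : colBlk (A * x) l = ∑ a, blk A l a * colBlk x a := by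
  ext a b
  simp [blk, colBlk, Matrix.mul_apply, Fintype.sum_sigma, Matrix.sum_apply]

theorem blk_one_self (k : Fin r) : blk (1 : Matrix (Idx n) (Idx n) ℝ) k k = 1 := by
  ext a b
  simp [blk, Matrix.one_apply]

theorem blk_one_of_ne {l k : Fin r} (h : l ≠ k) : blk (1 : Matrix (Idx n) (Idx n) ℝ) l k = 0 := by
  ext a b
  simp [blk, h]

theorem blk_diagonal_self (c : Fin r → ℝ) (k : Fin r) :
    blk (Matrix.diagonal fun a : Idx n => c a.1) k k = c k • 1 := by
  ext a b
  simp [blk, Matrix.diagonal_apply, Matrix.one_apply]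

theorem blk_diagonal_of_ne (c : Fin r → ℝ) {l k : Fin r} (h : l ≠ k) :
    blk (Matrix.diagonal fun a : Idx n => c a.1) l k = 0 := by
  ext a b
  simp [blk, h]

theorem ext_blk {A B : Matrix (Idx n) (Idx n) ℝ} (h : ∀ l k, blk A l k = blk B l k) : A = B := by
  ext ⟨l, a⟩ ⟨k, b⟩
  exact congrFun (congrFun (h l k) a) b

theorem scal_zero {m : ℕ} : scal (0 : Matrix (Fin m) (Fin m) ℝ) = 0 := by simp [scal]

theorem scal_transpose {m : ℕ} (A : Matrix (Fin m) (Fin m) ℝ) : scal A.transpose = scal A := by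
  simp [scal]

theorem scal_sum {m : ℕ} {ι : Type*} (s : Finset ι) (f : ι → Matrix (Fin m) (Fin m) ℝ) :
    scal (∑ i ∈ s, f i) = ∑ i ∈ s, scal (f i) := by
  simp [scal, Matrix.trace_sum, Finset.sum_div]

theorem ip_zero_left {m m' : ℕ} (A : Matrix (Fin m) (Fin m') ℝ) : ip 0 A = 0 := by
  simp [ip, scal]

theorem ip_zero_right {m m' : ℕ} (A : Matrix (Fin m) (Fin m') ℝ) : ip A 0 = 0 := by
  simp [ip, scal]

end Blocks

/-! ### The group `H` -/

theorem Adm.mem_of_lt {l k : Fin r} {A : Matrix (Fin (n l)) (Fin (n k)) ℝ} (hA : Adm 𝒱 l k A)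
    (h : k < l) : A ∈ 𝒱.V l k := by
  cases hA with
  | lower _ _ hA => exact hA
  | diag => exact absurd h (lt_irrefl _)
  | upper h' => exact absurd h (lt_asymm h')

theorem Adm.eq_zero_of_lt {l k : Fin r} {A : Matrix (Fin (n l)) (Fin (n k)) ℝ}
    (hA : Adm 𝒱 l k A) (h : l < k) : A = 0 := by
  cases hA with
  | lower h' _ _ => exact absurd h (lt_asymm h')
  | diag => exact absurd h (lt_irrefl _)
  | upper h' => rfl

theorem Adm.eq_smul_one {k : Fin r} {A : Matrix (Fin (n k)) (Fin (n k)) ℝ}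
    (hA : Adm 𝒱 k k A) : ∃ c : ℝ, A = c • 1 := by
  cases hA with
  | lower h' _ _ => exact absurd h' (lt_irrefl _)
  | diag c => exact ⟨c, rfl⟩
  | upper h' => exact absurd h' (lt_irrefl _)

namespace HSet

theorem diag_pos (𝒱 : BlockSystem r n) {T : Matrix (Idx n) (Idx n) ℝ} (hT : T ∈ HSet 𝒱)
    (k : Fin r) : 0 < scal (blk T k k) := by
  obtain ⟨t, ht, h⟩ := hT.2.1 k
  rwa [h, scal_smul_one (𝒱.npos k)]

theorem blk_self {T : Matrix (Idx n) (Idx n) ℝ} (hT : T ∈ HSet 𝒱) (k : Fin r) :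
    blk T k k = scal (blk T k k) • 1 := by
  obtain ⟨t, -, h⟩ := hT.2.1 k
  rw [h, scal_smul_one (𝒱.npos k)]

theorem mul {S T : Matrix (Idx n) (Idx n) ℝ} (hS : S ∈ HSet 𝒱) (hT : T ∈ HSet 𝒱) :
    S * T ∈ HSet 𝒱 := by
  have hadm : ∀ l k, Adm 𝒱 l k (blk (S * T) l k) := fun l k => by
    rw [blk_mul]
    exact Adm.sum _ _ fun a _ => (HSet.adm hS l a).mul (HSet.adm hT a k)
  refine ⟨fun k l h => ?_, fun k => ?_, fun k l h => ?_⟩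
  · rw [blk_mul]
    refine Finset.sum_eq_zero fun a _ => ?_
    rcases lt_or_ge l a with ha | ha
    · rw [hS.1 a l ha, Matrix.zero_mul]
    · rw [hT.1 k a (ha.trans_lt h), Matrix.mul_zero]
  · refine ⟨scal (blk S k k) * scal (blk T k k),
      mul_pos (diag_pos 𝒱 hS k) (diag_pos 𝒱 hT k), ?_⟩
    rw [blk_mul, Finset.sum_eq_single k]
    · rw [blk_self hS k, blk_self hT k]
      simp [scal_smul_one (𝒱.npos k), smul_smul, mul_comm]
    · intro a _ ha
      rcases lt_or_gt_of_ne ha with h | h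
      · rw [hT.1 k a h, Matrix.mul_zero]
      · rw [hS.1 a k h, Matrix.zero_mul]
    · simp
  · exact (hadm l k).mem_of_lt h

theorem diagonal {c : Fin r → ℝ} (hc : ∀ k, 0 < c k) :
    (Matrix.diagonal fun a : Idx n => c a.1) ∈ HSet 𝒱 := by
  refine ⟨fun k l h => blk_diagonal_of_ne c h.ne, fun k => ⟨c k, hc k, blk_diagonal_self c k⟩,
    fun k l h => ?_⟩
  rw [blk_diagonal_of_ne c h.ne']
  exact Submodule.zero_mem _

end HSet

theorem toMat_rho (T : HSet 𝒱) (y : ZSp 𝒱) :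
    ZSp.toMat (rho T y) = T.1 * ZSp.toMat y * T.1.transpose := rfl

theorem ZSp.ext_toMat {y z : ZSp 𝒱} (h : ZSp.toMat y = ZSp.toMat z) : y = z := Subtype.ext h

theorem inner_eq_cpl (y z : ZSp 𝒱) : inner ℝ y z = ZSp.cpl y z := rfl

theorem rho_mul (S T U : HSet 𝒱) (h : U.1 = S.1 * T.1) (y : ZSp 𝒱) :
    rho U y = rho S (rho T y) := by
  apply ZSp.ext_toMat
  rw [toMat_rho, toMat_rho, toMat_rho, h, Matrix.transpose_mul]
  simp only [Matrix.mul_assoc]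

theorem inner_rhoStar (T : HSet 𝒱) (y η : ZSp 𝒱) :
    inner ℝ y (rhoStar T η) = inner ℝ (rho T y) η :=
  LinearMap.adjoint_inner_right _ _ _

theorem rhoStar_mul (S T U : HSet 𝒱) (h : U.1 = S.1 * T.1) (η : ZSp 𝒱) :
    rhoStar U η = rhoStar T (rhoStar S η) := by
  refine ext_inner_left ℝ fun y => ?_
  rw [inner_rhoStar, inner_rhoStar, inner_rhoStar, rho_mul S T U h]

/-! ### The closed cone -/

theorem continuous_toMat : Continuous (fun y : ZSp 𝒱 => ZSp.toMat y) :=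
  LinearMap.continuous_of_finiteDimensional (ZSp.toMat (𝒱 := 𝒱))

theorem toMat_isHermitian (y : ZSp 𝒱) : (ZSp.toMat y).IsHermitian := by
  have := y.toMat_mem.1
  rwa [Matrix.IsHermitian, Matrix.conjTranspose_eq_transpose_of_trivial]

theorem toMat_unitZ : ZSp.toMat (unitZ 𝒱) = 1 := Matrix.diagonal_one

theorem posSemidef_of_mem_closure_cone {y : ZSp 𝒱} (hy : y ∈ closure (cone 𝒱)) :
    (ZSp.toMat y).PosSemidef := by
  refine Matrix.PosSemidef.of_dotProduct_mulVec_nonneg (toMat_isHermitian y) fun x => ?_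
  have hc : Continuous fun y : ZSp 𝒱 => star x ⬝ᵥ (ZSp.toMat y).mulVec x :=
    continuous_const.dotProduct (continuous_toMat.matrix_mulVec continuous_const)
  have hcl : IsClosed {y : ZSp 𝒱 | 0 ≤ star x ⬝ᵥ (ZSp.toMat y).mulVec x} :=
    isClosed_le continuous_const hc
  exact closure_minimal (fun z hz => (show (ZSp.toMat z).PosDef from
    hz).posSemidef.dotProduct_mulVec_nonneg x) hcl hy

theorem mem_closure_cone {y : ZSp 𝒱} (hy : (ZSp.toMat y).PosSemidef) :
    y ∈ closure (cone 𝒱) := by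
  have hlim : Filter.Tendsto (fun N : ℕ => y + (1 / ((N : ℝ) + 1)) • unitZ 𝒱) Filter.atTop
      (𝓝 y) := by
    have := (tendsto_one_div_add_atTop_nhds_zero_nat (𝕜 := ℝ)).smul_const (unitZ 𝒱)
    simpa using this.const_add y
  refine mem_closure_of_tendsto hlim (.of_forall fun N => ?_)
  change (ZSp.toMat _).PosDef
  rw [map_add, map_smul, toMat_unitZ]
  exact Matrix.PosDef.posSemidef_add hy (Matrix.PosDef.one.smul (by positivity))

theorem mem_closure_cone_iff {y : ZSp 𝒱} :
    y ∈ closure (cone 𝒱) ↔ (ZSp.toMat y).PosSemidef :=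
  ⟨posSemidef_of_mem_closure_cone, mem_closure_cone⟩

theorem rho_mem_closure_cone (T : HSet 𝒱) {y : ZSp 𝒱} (hy : y ∈ closure (cone 𝒱)) :
    rho T y ∈ closure (cone 𝒱) := by
  rw [mem_closure_cone_iff] at hy ⊢
  rw [toMat_rho, ← Matrix.conjTranspose_eq_transpose_of_trivial]
  exact hy.mul_mul_conjTranspose_same _

theorem inner_diagZ (y : ZSp 𝒱) (c : Fin r → ℝ) :
    inner ℝ y (diagZ 𝒱 c) = ∑ k, scal (blk (ZSp.toMat y) k k) * c k := by
  rw [inner_eq_cpl, ZSp.cpl]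
  have h1 : ∀ k, scal (blk (ZSp.toMat (diagZ 𝒱 c)) k k) = c k := fun k => by
    change scal (blk (Matrix.diagonal fun a : Idx n => c a.1) k k) = c k
    rw [blk_diagonal_self, scal_smul_one (𝒱.npos k)]
  have h2 : ∀ k, ∀ l ∈ Finset.Ioi k, ip (blk (ZSp.toMat y) l k)
      (blk (ZSp.toMat (diagZ 𝒱 c)) l k) = 0 := fun k l hl => by
    change ip _ (blk (Matrix.diagonal fun a : Idx n => c a.1) l k) = 0
    rw [blk_diagonal_of_ne c (Finset.mem_Ioi.1 hl).ne', ip_zero_right]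
  simp only [h1]
  rw [Finset.sum_eq_zero fun k _ => Finset.sum_eq_zero (h2 k), mul_zero, add_zero]

theorem inner_unitZ (y : ZSp 𝒱) :
    inner ℝ y (unitZ 𝒱) = ∑ k, scal (blk (ZSp.toMat y) k k) := by
  simp [unitZ, inner_diagZ]

theorem unitZ_mem_dualCone : unitZ 𝒱 ∈ dualCone 𝒱 := by
  intro y hy hy0
  rw [mem_closure_cone_iff] at hy
  have hd : ∀ k, 0 ≤ scal (blk (ZSp.toMat y) k k) := fun k =>
    div_nonneg (Finset.sum_nonneg fun a _ => hy.diag_nonneg) (Nat.cast_nonneg _)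
  rw [inner_unitZ]
  refine lt_of_le_of_ne (Finset.sum_nonneg fun k _ => hd k) fun h0 => hy0 ?_
  have hz := (Finset.sum_eq_zero_iff_of_nonneg fun k _ => hd k).1 h0.symm
  have htr : (ZSp.toMat y).trace = 0 := by
    rw [Matrix.trace, Fintype.sum_sigma]
    refine Finset.sum_eq_zero fun k _ => ?_
    have h1 : (blk (ZSp.toMat y) k k).trace = 0 := by
      have h2 := hz k (Finset.mem_univ k)
      have h3 : ((n k : ℕ) : ℝ) ≠ 0 := by exact_mod_cast (𝒱.npos k).ne'
      rw [scal, div_eq_zero_iff] at h2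
      exact h2.resolve_right h3
    exact h1
  exact ZSp.ext_toMat (hy.trace_eq_zero_iff.1 htr)

/-- An element of the dual cone dominates the norm on the closed cone. -/
theorem exists_mul_norm_le_inner {η : ZSp 𝒱} (hη : η ∈ dualCone 𝒱) :
    ∃ c : ℝ, 0 < c ∧ ∀ y ∈ closure (cone 𝒱), c * ‖y‖ ≤ inner ℝ y η := by
  set K : Set (ZSp 𝒱) := closure (cone 𝒱) ∩ Metric.sphere 0 1 with hK
  have hKc : IsCompact K := (isCompact_sphere 0 1).inter_left isClosed_closure
  have hcont : Continuous fun y : ZSp 𝒱 => inner ℝ y η := by fun_prop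
  have hsmul : ∀ y ∈ closure (cone 𝒱), y ≠ 0 → ‖y‖⁻¹ • y ∈ K := by
    intro y hy hy0
    refine ⟨?_, by simp [norm_smul, hy0]⟩
    rw [mem_closure_cone_iff] at hy ⊢
    rw [map_smul]
    exact hy.smul (by positivity)
  rcases K.eq_empty_or_nonempty with hE | hne
  · refine ⟨1, one_pos, fun y hy => ?_⟩
    by_cases hy0 : y = 0
    · simp [hy0]
    · exact absurd (hsmul y hy hy0) (by simp [hE])
  · obtain ⟨z, hz, hmin⟩ := hKc.exists_isMinOn hne hcont.continuousOn
    have hz0 : z ≠ 0 := by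
      rintro rfl
      simpa using hz.2
    refine ⟨inner ℝ z η, hη z hz.1 hz0, fun y hy => ?_⟩
    by_cases hy0 : y = 0
    · simp [hy0]
    · have h := hmin (hsmul y hy hy0)
      simp only [Set.mem_ofPred_eq, inner_smul_left] at h
      have hpos : 0 < ‖y‖ := norm_pos_iff.2 hy0
      simp only [conj_trivial] at h
      rw [← div_eq_inv_mul, le_div_iff₀ hpos] at h
      exact h

/-! ### Homogeneity of the dual cone -/

/-- The matrix with the single non-zero block row `m`, taken from the part of `Y` to the left of
the diagonal. -/
def rowPart (Y : Matrix (Idx n) (Idx n) ℝ) (m : Fin r) : Matrix (Idx n) (Idx n) ℝ :=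
  Matrix.of fun p q => if p.1 = m ∧ q.1 < m then Y p q else 0

theorem blk_rowPart_of_lt (Y : Matrix (Idx n) (Idx n) ℝ) {m k : Fin r} (h : k < m) :
    blk (rowPart Y m) m k = blk Y m k := by
  ext a b
  simp [blk, rowPart, h]

theorem blk_rowPart_of_ne (Y : Matrix (Idx n) (Idx n) ℝ) {m l : Fin r} (k : Fin r) (h : l ≠ m) :
    blk (rowPart Y m) l k = 0 := by
  ext a b
  simp [blk, rowPart, h]

theorem blk_rowPart_of_le (Y : Matrix (Idx n) (Idx n) ℝ) {m k : Fin r} (l : Fin r) (h : m ≤ k) :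
    blk (rowPart Y m) l k = 0 := by
  ext a b
  simp [blk, rowPart, h.not_gt]

theorem rowPart_mul_rowPart (Y : Matrix (Idx n) (Idx n) ℝ) (m : Fin r) :
    rowPart Y m * rowPart Y m = 0 := by
  refine ext_blk fun l k => ?_
  rw [blk_mul]
  refine Finset.sum_eq_zero fun a _ => ?_
  rcases lt_or_ge a m with h | h
  · rw [blk_rowPart_of_ne Y k h.ne, Matrix.mul_zero]
  · rw [blk_rowPart_of_le Y l h, Matrix.zero_mul]

theorem one_add_rowPart_mem {η : ZSp 𝒱} (m : Fin r) (s : ℝ) :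
    1 + s • rowPart (ZSp.toMat η) m ∈ HSet 𝒱 := by
  refine ⟨fun k l h => ?_, fun k => ⟨1, one_pos, ?_⟩, fun k l h => ?_⟩
  · have h0 : blk (rowPart (ZSp.toMat η) m) l k = 0 := by
      by_cases hl : l = m
      · exact blk_rowPart_of_le _ _ (hl ▸ h.le)
      · exact blk_rowPart_of_ne _ _ hl
    rw [blk_add, blk_smul, blk_one_of_ne h.ne, h0]
    simp
  · have h0 : blk (rowPart (ZSp.toMat η) m) k k = 0 := by
      by_cases hl : k = m
      · exact blk_rowPart_of_le _ _ hl.ge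
      · exact blk_rowPart_of_ne _ _ hl
    rw [blk_add, blk_smul, blk_one_self, h0]
    simp
  · rw [blk_add, blk_smul, blk_one_of_ne h.ne', zero_add]
    refine Submodule.smul_mem _ _ ?_
    by_cases hl : l = m
    · subst hl
      rw [blk_rowPart_of_lt _ h]
      exact η.toMat_mem.2.2 k l h
    · rw [blk_rowPart_of_ne _ _ hl]
      exact Submodule.zero_mem _

/-- The elementary element of `H` that is used to clear a row. -/
def elim (η : ZSp 𝒱) (m : Fin r) (s : ℝ) : HSet 𝒱 :=
  ⟨1 + s • rowPart (ZSp.toMat η) m, one_add_rowPart_mem m s⟩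

theorem elim_mul_elim_neg (η : ZSp 𝒱) (m : Fin r) (s : ℝ) :
    (elim η m s).1 * (elim η m (-s)).1 = 1 := by
  simp only [elim, Matrix.add_mul, Matrix.mul_add, Matrix.smul_mul, Matrix.mul_smul,
    rowPart_mul_rowPart, Matrix.one_mul, Matrix.mul_one]
  simp

theorem one_mem_HSet : (1 : Matrix (Idx n) (Idx n) ℝ) ∈ HSet 𝒱 := by
  have := HSet.diagonal (𝒱 := 𝒱) (c := fun _ => 1) fun _ => one_pos
  rwa [Matrix.diagonal_one] at this

theorem rho_one (y : ZSp 𝒱) : rho ⟨1, one_mem_HSet⟩ y = y := by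
  apply ZSp.ext_toMat
  rw [toMat_rho]
  simp

theorem rho_elim_rho_elim_neg (η y : ZSp 𝒱) (m : Fin r) (s : ℝ) :
    rho (elim η m s) (rho (elim η m (-s)) y) = y := by
  rw [← rho_mul _ _ ⟨1, one_mem_HSet⟩ (elim_mul_elim_neg η m s).symm, rho_one]

theorem rhoStar_elim_rhoStar_elim_neg (η ζ : ZSp 𝒱) (m : Fin r) (s : ℝ) :
    rhoStar (elim η m s) (rhoStar (elim η m (-s)) ζ) = ζ := by
  refine ext_inner_left ℝ fun y => ?_
  rw [inner_rhoStar, inner_rhoStar]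
  have := rho_elim_rho_elim_neg η y m (-s)
  rw [neg_neg] at this
  rw [this]

theorem rhoStar_elim_mem_dualCone {η ζ : ZSp 𝒱} (hζ : ζ ∈ dualCone 𝒱) (m : Fin r) (s : ℝ) :
    rhoStar (elim η m s) ζ ∈ dualCone 𝒱 := by
  intro y hy hy0
  rw [inner_rhoStar]
  refine hζ _ (rho_mem_closure_cone _ hy) fun h0 => hy0 ?_
  have := rho_elim_rho_elim_neg η y m (-s)
  rw [neg_neg, h0, map_zero] at this
  exact this.symm

theorem diag_pos_of_mem_dualCone {η : ZSp 𝒱} (hη : η ∈ dualCone 𝒱) (k : Fin r) :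
    0 < scal (blk (ZSp.toMat η) k k) := by
  have h1 : diagZ 𝒱 (Pi.single k 1) ∈ closure (cone 𝒱) := by
    refine mem_closure_cone (Matrix.PosSemidef.diagonal fun a => ?_)
    by_cases h : a.1 = k
    · rw [h]
      simp
    · simp [h]
  have h2 : diagZ 𝒱 (Pi.single k 1) ≠ 0 := by
    intro h0
    have h3 := congrArg (fun y => scal (blk (ZSp.toMat y) k k)) h0
    change scal (blk (Matrix.diagonal fun a : Idx n => (Pi.single k 1 : Fin r → ℝ) a.1) k k) =
      scal 0 at h3
    rw [blk_diagonal_self, scal_smul_one (𝒱.npos k), scal_zero, Pi.single_eq_same] at h3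
    exact one_ne_zero h3
  have h3 := hη _ h1 h2
  rw [real_inner_comm, inner_diagZ, Finset.sum_eq_single k] at h3
  · simpa using h3
  · intro l _ hl
    simp [hl]
  · simp

end GindikinRiesz

namespace GindikinRiesz

variable {r : ℕ} {n : Fin r → ℕ} {𝒱 : BlockSystem r n}

/-- The element of `Z_V` that consists of the off-diagonal blocks `(l,k)` of `ζ` with
`m ≤ max l k`. -/
def outerPart (ζ : ZSp 𝒱) (m : Fin r) : ZSp 𝒱 :=
  ⟨Matrix.of fun p q => if p.1 ≠ q.1 ∧ (m ≤ p.1 ∨ m ≤ q.1) then ZSp.toMat ζ p q else 0, by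
    obtain ⟨h1, -, h3⟩ := ζ.toMat_mem
    refine ⟨?_, fun k => ⟨0, ?_⟩, fun k l h => ?_⟩
    · ext p q
      simp only [Matrix.transpose_apply, Matrix.of_apply, h1.apply p q, ne_comm (a := q.1),
        or_comm (a := m ≤ q.1)]
    · ext a b
      simp [blk]
    · by_cases hl : m ≤ l
      · convert h3 k l h using 1
        ext a b
        simp [blk, h.ne', hl]
      · have hk : ¬ m ≤ k := fun hk => hl (hk.trans h.le)
        convert (𝒱.V l k).zero_mem using 1
        ext a b
        simp [blk, hl, hk]⟩

theorem toMat_outerPart_apply (ζ : ZSp 𝒱) (m : Fin r) (p q : Idx n) :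
    ZSp.toMat (outerPart ζ m) p q =
      if p.1 ≠ q.1 ∧ (m ≤ p.1 ∨ m ≤ q.1) then ZSp.toMat ζ p q else 0 := rfl

theorem blk_outerPart_self (ζ : ZSp 𝒱) (m k : Fin r) :
    blk (ZSp.toMat (outerPart ζ m)) k k = 0 := by
  ext a b
  simp [blk, toMat_outerPart_apply]

theorem blk_outerPart_of_lt (ζ : ZSp 𝒱) {m k l : Fin r} (hk : k < m) (hl : l < m) :
    blk (ZSp.toMat (outerPart ζ m)) l k = 0 := by
  ext a b
  simp [blk, toMat_outerPart_apply, hk.not_ge, hl.not_ge]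

theorem blk_outerPart_of_le (ζ : ZSp 𝒱) {m k l : Fin r} (h : k < l) (hl : m ≤ l) :
    blk (ZSp.toMat (outerPart ζ m)) l k = blk (ZSp.toMat ζ) l k := by
  ext a b
  simp [blk, toMat_outerPart_apply, hl, h.ne']

theorem inner_outerPart (ζ : ZSp 𝒱) (m : Fin r) :
    inner ℝ (outerPart ζ m) ζ = 2 * ∑ k, ∑ l ∈ Finset.Ioi k,
      if m ≤ l then ip (blk (ZSp.toMat ζ) l k) (blk (ZSp.toMat ζ) l k) else 0 := by
  rw [inner_eq_cpl, ZSp.cpl, Finset.sum_eq_zero, zero_add]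
  · congr 1
    refine Finset.sum_congr rfl fun k _ => Finset.sum_congr rfl fun l hl => ?_
    rw [Finset.mem_Ioi] at hl
    split_ifs with h
    · rw [blk_outerPart_of_le ζ hl h]
    · rw [not_le] at h
      rw [blk_outerPart_of_lt ζ (hl.trans h) h, ip_zero_left]
  · intro k _
    rw [blk_outerPart_self, scal_zero, zero_mul]

theorem blk_eq_zero_of_inner_outerPart {ζ : ZSp 𝒱} {m : Fin r}
    (h : inner ℝ (outerPart ζ m) ζ = 0) {k l : Fin r} (hkl : k < l) (hl : m ≤ l) :
    blk (ZSp.toMat ζ) l k = 0 := by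
  rw [inner_outerPart] at h
  have hn : ∀ k l : Fin r, 0 ≤ if m ≤ l then
      ip (blk (ZSp.toMat ζ) l k) (blk (ZSp.toMat ζ) l k) else 0 := fun k l => by
    split_ifs
    · exact ip_self_nonneg _
    · exact le_rfl
  have h0 := (mul_eq_zero.1 h).resolve_left two_ne_zero
  have h1 := (Finset.sum_eq_zero_iff_of_nonneg
    fun k _ => Finset.sum_nonneg fun l _ => hn k l).1 h0 k (Finset.mem_univ k)
  have h2 := (Finset.sum_eq_zero_iff_of_nonneg fun l _ => hn k l).1 h1 l (Finset.mem_Ioi.2 hkl)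
  rw [if_pos hl] at h2
  exact ip_self_eq_zero h2

theorem inner_rho_elim {η y : ZSp 𝒱} {m : Fin r} (hη0 : scal (blk (ZSp.toMat η) m m) ≠ 0)
    (hη : ∀ l k, m < l → k < l → blk (ZSp.toMat η) l k = 0)
    (hy : ∀ k, blk (ZSp.toMat y) k k = 0)
    (hy' : ∀ l k, l < m → k < m → blk (ZSp.toMat y) l k = 0) :
    inner ℝ (rho (elim η m (-(scal (blk (ZSp.toMat η) m m))⁻¹)) y) η = 0 := by
  set d := scal (blk (ZSp.toMat η) m m) with hd
  set N := rowPart (ZSp.toMat η) m with hN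
  set Y := ZSp.toMat y with hY
  have hsym : Y.transpose = Y := y.toMat_mem.1
  have hNY : ∀ l k, (l ≠ m ∨ k < m) → blk (N * Y) l k = 0 := by
    intro l k h
    rw [blk_mul]
    refine Finset.sum_eq_zero fun a _ => ?_
    rcases lt_or_ge a m with ha | ha
    · rcases h with h | h
      · rw [hN, blk_rowPart_of_ne _ _ h, Matrix.zero_mul]
      · rw [hy' a k ha h, Matrix.mul_zero]
    · rw [hN, blk_rowPart_of_le _ _ ha, Matrix.zero_mul]
  have hNYN : N * Y * N.transpose = 0 := by
    refine ext_blk fun l k => ?_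
    rw [blk_mul]
    refine Finset.sum_eq_zero fun a _ => ?_
    rcases lt_or_ge a m with ha | ha
    · rw [hNY l a (Or.inr ha), Matrix.zero_mul]
    · rw [blk_transpose, hN, blk_rowPart_of_le _ _ ha, Matrix.transpose_zero, Matrix.mul_zero]
  have hg : ∀ s : ℝ, ZSp.toMat (rho (elim η m s) y) =
      Y + s • (N * Y) + s • (N * Y).transpose := by
    intro s
    rw [toMat_rho, Matrix.transpose_mul, hsym]
    change (1 + s • N) * Y * (1 + s • N).transpose = _
    rw [Matrix.transpose_add, Matrix.transpose_smul, Matrix.transpose_one, Matrix.add_mul,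
      Matrix.mul_add, Matrix.add_mul, Matrix.add_mul, Matrix.mul_smul, Matrix.smul_mul,
      Matrix.mul_smul, Matrix.smul_mul, Matrix.smul_mul, hNYN]
    simp only [Matrix.one_mul, Matrix.mul_one, smul_zero, add_zero]
  have hNYm : scal (blk (N * Y) m m) =
      ∑ k ∈ Finset.Iio m, ip (blk Y m k) (blk (ZSp.toMat η) m k) := by
    rw [blk_mul, scal_sum, ← Finset.sum_subset (Finset.subset_univ (Finset.Iio m))]
    · refine Finset.sum_congr rfl fun k hk => ?_
      rw [hN, blk_rowPart_of_lt _ (Finset.mem_Iio.1 hk), ip_comm, ip, ← blk_transpose, hsym]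
    · intro a _ ha
      rw [Finset.mem_Iio, not_lt] at ha
      rw [hN, blk_rowPart_of_le _ _ ha, Matrix.zero_mul, scal_zero]
  rw [inner_eq_cpl, ZSp.cpl]
  simp only [hg, blk_add, blk_smul, blk_transpose]
  have h1 : ∑ k, scal (blk Y k k + -d⁻¹ • blk (N * Y) k k + -d⁻¹ • (blk (N * Y) k k).transpose) *
      scal (blk (ZSp.toMat η) k k) =
      -2 * ∑ k ∈ Finset.Iio m, ip (blk Y m k) (blk (ZSp.toMat η) m k) := by
    rw [Finset.sum_eq_single m]
    · rw [hy, zero_add, scal_add, scal_smul, scal_smul, scal_transpose, hNYm, ← hd]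
      field_simp
      ring
    · intro k _ hk
      rw [hy, hNY k k (Or.inl hk)]
      simp [scal_zero]
    · simp
  have h2 : ∑ k, ∑ l ∈ Finset.Ioi k, ip (blk Y l k + -d⁻¹ • blk (N * Y) l k +
      -d⁻¹ • (blk (N * Y) k l).transpose) (blk (ZSp.toMat η) l k) =
      ∑ k ∈ Finset.Iio m, ip (blk Y m k) (blk (ZSp.toMat η) m k) := by
    rw [← Finset.sum_subset (Finset.subset_univ (Finset.Iio m))]
    · refine Finset.sum_congr rfl fun k hk => ?_
      rw [Finset.mem_Iio] at hk
      rw [Finset.sum_eq_single m]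
      · rw [hNY m k (Or.inr hk), hNY k m (Or.inl hk.ne)]
        simp
      · intro l hl hlm
        rw [Finset.mem_Ioi] at hl
        rcases lt_or_gt_of_ne hlm with h | h
        · rw [hNY l k (Or.inr hk), hNY k l (Or.inr h), hy' l k h hk]
          simp [ip_zero_left]
        · rw [hη l k h hl, ip_zero_right]
      · intro h
        exact absurd (Finset.mem_Ioi.2 hk) h
    · intro k _ hk
      rw [Finset.mem_Iio, not_lt] at hk
      refine Finset.sum_eq_zero fun l hl => ?_
      rw [Finset.mem_Ioi] at hl
      rw [hη l k (hk.trans_lt hl) hl, ip_zero_right]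
  rw [h1, h2]
  ring

theorem blk_rhoStar_elim {η : ZSp 𝒱} {m : Fin r} (hη0 : scal (blk (ZSp.toMat η) m m) ≠ 0)
    (hη : ∀ l k, m < l → k < l → blk (ZSp.toMat η) l k = 0) {k l : Fin r} (hkl : k < l)
    (hl : m ≤ l) :
    blk (ZSp.toMat (rhoStar (elim η m (-(scal (blk (ZSp.toMat η) m m))⁻¹)) η)) l k = 0 := by
  refine blk_eq_zero_of_inner_outerPart ?_ hkl hl
  rw [inner_rhoStar]
  exact inner_rho_elim hη0 hη (fun k => blk_outerPart_self _ m k)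
    fun l k hl hk => blk_outerPart_of_lt _ hk hl

theorem rhoStar_diagonal_unitZ {c : Fin r → ℝ} (hc : ∀ k, 0 < c k) :
    rhoStar ⟨_, HSet.diagonal (𝒱 := 𝒱) hc⟩ (unitZ 𝒱) = diagZ 𝒱 fun k => c k ^ 2 := by
  refine ext_inner_left ℝ fun y => ?_
  rw [inner_rhoStar, inner_unitZ, inner_diagZ]
  refine Finset.sum_congr rfl fun k _ => ?_
  rw [toMat_rho, scal, scal, div_mul_eq_mul_div]
  congr 1
  rw [Matrix.trace, Matrix.trace, Finset.sum_mul]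
  refine Finset.sum_congr rfl fun a _ => ?_
  simp only [blk, Matrix.diag_apply, Matrix.submatrix_apply, Matrix.diagonal_transpose,
    Matrix.mul_diagonal, Matrix.diagonal_mul]
  ring

theorem eq_diagZ {η : ZSp 𝒱} (h : ∀ l k, k < l → blk (ZSp.toMat η) l k = 0) :
    η = diagZ 𝒱 fun k => scal (blk (ZSp.toMat η) k k) := by
  obtain ⟨h1, h2, -⟩ := η.toMat_mem
  apply ZSp.ext_toMat
  refine ext_blk fun l k => ?_
  change _ = blk (Matrix.diagonal fun a : Idx n => scal (blk (ZSp.toMat η) a.1 a.1)) l k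
  rcases lt_trichotomy k l with hkl | rfl | hkl
  · rw [h l k hkl, blk_diagonal_of_ne (fun k => scal (blk (ZSp.toMat η) k k)) hkl.ne']
  · obtain ⟨c, hc⟩ := h2 k
    rw [blk_diagonal_self (fun k => scal (blk (ZSp.toMat η) k k)), hc,
      scal_smul_one (𝒱.npos k)]
  · rw [blk_diagonal_of_ne (fun k => scal (blk (ZSp.toMat η) k k)) hkl.ne,
      ← h1, blk_transpose, h k l hkl, Matrix.transpose_zero]

/-- `H` acts transitively on the dual cone. -/
theorem exists_rhoStar_unitZ_eq {η : ZSp 𝒱} (hη : η ∈ dualCone 𝒱) :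
    ∃ T : HSet 𝒱, rhoStar T (unitZ 𝒱) = η := by
  have main : ∀ m : ℕ, ∀ η : ZSp 𝒱, η ∈ dualCone 𝒱 →
      (∀ l k : Fin r, m ≤ l.1 → k < l → blk (ZSp.toMat η) l k = 0) →
      ∃ T : HSet 𝒱, rhoStar T (unitZ 𝒱) = η := by
    intro m
    induction m with
    | zero =>
      intro η hη h
      have hpos : ∀ k, 0 < √(scal (blk (ZSp.toMat η) k k)) := fun k =>
        Real.sqrt_pos.2 (diag_pos_of_mem_dualCone hη k)
      refine ⟨⟨_, HSet.diagonal hpos⟩, ?_⟩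
      rw [rhoStar_diagonal_unitZ hpos]
      conv_rhs => rw [eq_diagZ fun l k hk => h l k (Nat.zero_le _) hk]
      congr 1
      funext k
      exact Real.sq_sqrt (diag_pos_of_mem_dualCone hη k).le
    | succ m ih =>
      intro η hη h
      by_cases hm : m < r
      · set s := -(scal (blk (ZSp.toMat η) ⟨m, hm⟩ ⟨m, hm⟩))⁻¹ with hs
        obtain ⟨T, hT⟩ := ih (rhoStar (elim η ⟨m, hm⟩ s) η) (rhoStar_elim_mem_dualCone hη _ _)
          fun l k hl hk => blk_rhoStar_elim (diag_pos_of_mem_dualCone hη _).ne'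
            (fun l k hl hk => h l k hl hk) hk hl
        refine ⟨⟨_, HSet.mul T.2 (elim η ⟨m, hm⟩ (-s)).2⟩, ?_⟩
        rw [rhoStar_mul T (elim η ⟨m, hm⟩ (-s)) _ rfl, hT]
        simpa only [neg_neg] using rhoStar_elim_rhoStar_elim_neg η η ⟨m, hm⟩ (-s)
      · exact ih η hη fun l k hl hk => absurd l.2 (by omega)
  exact main r η hη fun l k hl _ => absurd l.2 (by omega)

end GindikinRiesz

namespace GindikinRiesz

variable {r : ℕ} {n : Fin r → ℕ} {𝒱 : BlockSystem r n} {ε : Fin r → Fin 2}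

/-! ### The quadratic map -/

theorem mem_WSub_of_adm {i : Fin r} {x : Matrix (Idx n) (Fin (n i)) ℝ}
    (h : ∀ l, Adm 𝒱 l i (colBlk x l)) : x ∈ WSub 𝒱 i :=
  ⟨fun l hl => (h l).eq_zero_of_lt hl, (h i).eq_smul_one, fun l hl => (h l).mem_of_lt hl⟩

theorem WSp.X_self (x : WSp 𝒱 ε) (i : {i : Fin r // ε i = 1}) : x.X i.1 i = x.d i • 1 := by
  obtain ⟨-, ⟨c, hc⟩, -⟩ := (x i).2
  have h : x.X i.1 i = c • 1 := hc
  rw [WSp.d, h, scal_smul_one (𝒱.npos i.1)]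

theorem WSp.X_of_lt (x : WSp 𝒱 ε) {l : Fin r} {i : {i : Fin r // ε i = 1}} (h : l < i.1) :
    x.X l i = 0 :=
  (x i).2.1 l h

/-- The component `x_i` as a linear function of `x`. -/
noncomputable def WSp.colMat (i : {i : Fin r // ε i = 1}) :
    WSp 𝒱 ε →ₗ[ℝ] Matrix (Idx n) (Fin (n i.1)) ℝ where
  toFun x := (x i).1
  map_add' _ _ := rfl
  map_smul' _ _ := rfl

/-- `x_{ii}` as a linear function of `x`. -/
noncomputable def WSp.dLin (i : {i : Fin r // ε i = 1}) : WSp 𝒱 ε →ₗ[ℝ] ℝ where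
  toFun x := x.d i
  map_add' x y := scal_add (x.X i.1 i) (y.X i.1 i)
  map_smul' c x := scal_smul c (x.X i.1 i)

theorem WSp.continuous_d (i : {i : Fin r // ε i = 1}) :
    Continuous fun x : WSp 𝒱 ε => x.d i :=
  LinearMap.continuous_of_finiteDimensional (WSp.dLin (𝒱 := 𝒱) i)

theorem toMat_quad (x : WSp 𝒱 ε) :
    ZSp.toMat (quad 𝒱 ε x) = ∑ i, (x i).1 * (x i).1.transpose := rfl

theorem continuous_quad : Continuous (quad 𝒱 ε) := by
  have hinj : LinearMap.ker (ZSp.toMat (𝒱 := 𝒱)) = ⊥ :=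
    LinearMap.ker_eq_bot.2 fun x y h => ZSp.ext_toMat h
  rw [((ZSp.toMat (𝒱 := 𝒱)).isClosedEmbedding_of_injective hinj).isEmbedding.continuous_iff]
  have hc : ∀ i : {i : Fin r // ε i = 1}, Continuous fun x : WSp 𝒱 ε => (x i).1 := fun i =>
    LinearMap.continuous_of_finiteDimensional (WSp.colMat (𝒱 := 𝒱) i)
  change Continuous fun x : WSp 𝒱 ε => ∑ i, (x i).1 * (x i).1.transpose
  exact continuous_finsetSum _ fun i _ => (hc i).matrix_mul (hc i).matrix_transpose

theorem measurable_quad : Measurable (quad 𝒱 ε) := continuous_quad.measurable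

theorem quad_mem_closure_cone (x : WSp 𝒱 ε) : quad 𝒱 ε x ∈ closure (cone 𝒱) := by
  refine mem_closure_cone ?_
  rw [toMat_quad]
  refine Matrix.posSemidef_sum _ fun i _ => ?_
  rw [← Matrix.conjTranspose_eq_transpose_of_trivial]
  exact Matrix.posSemidef_self_mul_conjTranspose _

theorem blk_quad (x : WSp 𝒱 ε) (l k : Fin r) :
    blk (ZSp.toMat (quad 𝒱 ε x)) l k = ∑ i, x.X l i * (x.X k i).transpose := by
  ext a b
  simp [toMat_quad, blk, WSp.X, colBlk, Matrix.mul_apply, Matrix.sum_apply]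

theorem inner_quad_unitZ (x : WSp 𝒱 ε) : inner ℝ (quad 𝒱 ε x) (unitZ 𝒱) = ‖x‖ ^ 2 := by
  rw [inner_unitZ, ← real_inner_self_eq_norm_sq]
  change _ = WSp.ipW x x
  simp only [blk_quad, scal_sum]
  rw [Finset.sum_comm, WSp.ipW]
  refine Finset.sum_congr rfl fun i _ => ?_
  rw [← Finset.sum_subset (Finset.subset_univ (Finset.Ici i.1)), ← Finset.Ioi_insert,
    Finset.sum_insert (by simp)]
  · congr 1
    rw [x.X_self i]
    simp [scal_smul_one (𝒱.npos i.1), smul_smul]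
  · intro k _ hk
    rw [Finset.mem_Ici, not_le] at hk
    rw [x.X_of_lt hk, Matrix.zero_mul, scal_zero]

/-! ### The action of `H` on the space of columns -/

theorem colBlk_mul_adm {T : Matrix (Idx n) (Idx n) ℝ} (hT : T ∈ HSet 𝒱) {i : Fin r}
    {x : Matrix (Idx n) (Fin (n i)) ℝ} (hx : x ∈ WSub 𝒱 i) : T * x ∈ WSub 𝒱 i :=
  mem_WSub_of_adm fun l => by
    rw [colBlk_mul]
    exact Adm.sum _ _ fun a _ => (HSet.adm hT l a).mul (WSub.adm hx a)

/-- The action of `H` on `W^i` by multiplication from the left. -/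
noncomputable def actCol (T : HSet 𝒱) (i : Fin r) : WSub 𝒱 i →ₗ[ℝ] WSub 𝒱 i where
  toFun x := ⟨T.1 * x.1, colBlk_mul_adm T.2 x.2⟩
  map_add' _ _ := Subtype.ext (Matrix.mul_add _ _ _)
  map_smul' _ _ := Subtype.ext (Matrix.mul_smul _ _ _)

/-- The action of `H` on `W^ε` by multiplication from the left. -/
noncomputable def actW (ε : Fin r → Fin 2) (T : HSet 𝒱) : WSp 𝒱 ε →ₗ[ℝ] WSp 𝒱 ε where
  toFun x := fun i => actCol T i.1 (x i)
  map_add' x y := funext fun i => map_add (actCol T i.1) (x i) (y i)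
  map_smul' c x := funext fun i => map_smul (actCol T i.1) c (x i)

theorem rho_quad (T : HSet 𝒱) (x : WSp 𝒱 ε) :
    rho T (quad 𝒱 ε x) = quad 𝒱 ε (actW ε T x) := by
  apply ZSp.ext_toMat
  rw [toMat_rho, toMat_quad, toMat_quad, Matrix.mul_sum, Matrix.sum_mul]
  refine Finset.sum_congr rfl fun i _ => ?_
  change _ = (T.1 * (x i).1) * (T.1 * (x i).1).transpose
  rw [Matrix.transpose_mul]
  simp only [Matrix.mul_assoc]

theorem inner_quad_rhoStar_unitZ (T : HSet 𝒱) (x : WSp 𝒱 ε) :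
    inner ℝ (quad 𝒱 ε x) (rhoStar T (unitZ 𝒱)) = ‖actW ε T x‖ ^ 2 := by
  rw [inner_rhoStar, rho_quad, inner_quad_unitZ]

theorem actW_d (T : HSet 𝒱) (x : WSp 𝒱 ε) (i : {i : Fin r // ε i = 1}) :
    (actW ε T x).d i = scal (blk T.1 i.1 i.1) * x.d i := by
  have h : (actW ε T x).X i.1 i = ∑ a, blk T.1 i.1 a * x.X a i := colBlk_mul _ _ _
  rw [WSp.d, h, Finset.sum_eq_single i.1]
  · rw [x.X_self, Matrix.mul_smul, Matrix.mul_one, scal_smul, mul_comm]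
  · intro a _ ha
    rcases lt_or_gt_of_ne ha with h | h
    · rw [x.X_of_lt h, Matrix.mul_zero]
    · rw [T.2.1 a i.1 h, Matrix.zero_mul]
  · simp

/-! ### The orbit -/

open Classical in
/-- The matrix with the block columns `x_i`, `i ∈ I(ε)`, completed by columns of the identity
matrix. -/
noncomputable def fillMat (x : WSp 𝒱 ε) : Matrix (Idx n) (Idx n) ℝ :=
  Matrix.of fun p q => if h : ε q.1 = 1 then (x ⟨q.1, h⟩).1 p q.2 else
    (1 : Matrix (Idx n) (Idx n) ℝ) p q

theorem blk_fillMat_of_eq (x : WSp 𝒱 ε) (l : Fin r) {k : Fin r} (h : ε k = 1) :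
    blk (fillMat x) l k = x.X l ⟨k, h⟩ := by
  ext a b
  simp [blk, fillMat, h, WSp.X, colBlk]

theorem blk_fillMat_of_ne (x : WSp 𝒱 ε) (l : Fin r) {k : Fin r} (h : ε k ≠ 1) :
    blk (fillMat x) l k = blk 1 l k := by
  ext a b
  simp [blk, fillMat, h]

theorem fillMat_mem_HSet {x : WSp 𝒱 ε} (hx : x ∈ WPlus 𝒱 ε) : fillMat x ∈ HSet 𝒱 := by
  refine ⟨fun k l h => ?_, fun k => ?_, fun k l h => ?_⟩ <;> by_cases hk : ε k = 1
  · rw [blk_fillMat_of_eq x l hk, x.X_of_lt h]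
  · rw [blk_fillMat_of_ne x l hk, blk_one_of_ne h.ne]
  · exact ⟨_, hx ⟨k, hk⟩, by rw [blk_fillMat_of_eq x k hk]; exact x.X_self ⟨k, hk⟩⟩
  · exact ⟨1, one_pos, by rw [blk_fillMat_of_ne x k hk, blk_one_self, one_smul]⟩
  · rw [blk_fillMat_of_eq x l hk]
    exact (x ⟨k, hk⟩).2.2.2 l h
  · rw [blk_fillMat_of_ne x l hk, blk_one_of_ne h.ne']
    exact Submodule.zero_mem _

theorem Fin.two_eq_zero_of_ne_one {a : Fin 2} (h : a ≠ 1) : a = 0 := by omega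

@[to_additive]
theorem prod_subtype_eps (ε : Fin r → Fin 2) {M : Type*} [CommMonoid M] (f : Fin r → M)
    (hf : ∀ k, ε k ≠ 1 → f k = 1) : ∏ i : {i : Fin r // ε i = 1}, f i.1 = ∏ k, f k := by
  rw [← Finset.prod_subtype (Finset.univ.filter fun k => ε k = 1) (by simp) f,
    Finset.prod_filter_of_ne]
  exact fun k _ h => by_contra fun hk => h (hf k hk)

theorem quad_mem_orbit {x : WSp 𝒱 ε} (hx : x ∈ WPlus 𝒱 ε) : quad 𝒱 ε x ∈ orbit 𝒱 ε := by
  refine ⟨⟨fillMat x, fillMat_mem_HSet hx⟩, ZSp.ext_toMat ?_⟩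
  rw [toMat_rho]
  change _ = fillMat x * Matrix.diagonal (fun a : Idx n => ((ε a.1 : ℕ) : ℝ)) *
    (fillMat x).transpose
  refine ext_blk fun l k => ?_
  have hD : ∀ a, blk (fillMat x * Matrix.diagonal (fun a : Idx n => ((ε a.1 : ℕ) : ℝ))) l a =
      ((ε a : ℕ) : ℝ) • blk (fillMat x) l a := fun a => by
    ext p q
    simp [blk, Matrix.mul_diagonal, mul_comm]
  rw [blk_quad, blk_mul]
  simp only [hD, blk_transpose]
  rw [← sum_subtype_eps ε]
  · refine Finset.sum_congr rfl fun i _ => ?_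
    rw [blk_fillMat_of_eq x l i.2, blk_fillMat_of_eq x k i.2, i.2]
    simp
  · intro a ha
    rw [Fin.two_eq_zero_of_ne_one ha]
    simp

theorem isOpen_WPlus : IsOpen (WPlus 𝒱 ε) := by
  have : WPlus 𝒱 ε = ⋂ i, {x | 0 < x.d i} := by
    ext x
    simp [WPlus]
  rw [this]
  exact isOpen_iInter_of_finite fun i => isOpen_lt continuous_const (WSp.continuous_d i)

theorem measurableSet_image_of_isOpen {E F : Type*} [MetricSpace E] [ProperSpace E]
    [TopologicalSpace F] [T2Space F] [MeasurableSpace F] [BorelSpace F] {f : E → F}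
    (hf : Continuous f) {U : Set E} (hU : IsOpen U) : MeasurableSet (f '' U) := by
  obtain ⟨C, hC, -, hCU, -⟩ := hU.exists_iUnion_isClosed
  rw [← hCU, Set.image_iUnion]
  refine MeasurableSet.iUnion fun k => ?_
  have h := IsSigmaCompact.of_isClosed_subset isSigmaCompact_univ (hC k) (Set.subset_univ _)
  obtain ⟨K, hK, hKU⟩ := h
  rw [← hKU, Set.image_iUnion]
  exact MeasurableSet.iUnion fun m => ((hK m).image hf).measurableSet

theorem map_quad_compl_orbit (u : Fin r → ℝ) :
    ((measM 𝒱 ε u).map (quad 𝒱 ε)) (orbit 𝒱 ε)ᶜ = 0 := by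
  have : ProperSpace (WSp 𝒱 ε) := FiniteDimensional.proper_real _
  have hmeas : MeasurableSet (quad 𝒱 ε '' WPlus 𝒱 ε) :=
    measurableSet_image_of_isOpen continuous_quad isOpen_WPlus
  refine measure_mono_null (t := (quad 𝒱 ε '' WPlus 𝒱 ε)ᶜ) ?_ ?_
  · rw [Set.compl_subset_compl]
    rintro _ ⟨x, hx, rfl⟩
    exact quad_mem_orbit hx
  · rw [Measure.map_apply measurable_quad hmeas.compl]
    refine withDensity_absolutelyContinuous _ _ ?_
    refine measure_mono_null (t := (WPlus 𝒱 ε)ᶜ) (fun x hx hx' => hx ⟨x, hx', rfl⟩) ?_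
    rw [Measure.restrict_apply isOpen_WPlus.measurableSet.compl]
    simp

end GindikinRiesz

namespace GindikinRiesz

variable {r : ℕ} {n : Fin r → ℕ} {𝒱 : BlockSystem r n} {ε : Fin r → Fin 2}

/-! ### The determinant of the action of `H` on the space of columns -/

/-- The space of admissible blocks in position `(l,k)`. -/
def admSub (𝒱 : BlockSystem r n) (l k : Fin r) :
    Submodule ℝ (Matrix (Fin (n l)) (Fin (n k)) ℝ) where
  carrier := {A | Adm 𝒱 l k A}
  add_mem' := Adm.add
  zero_mem' := Adm.zero' l k
  smul_mem' c A hA := by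
    have h := (Adm.diag (𝒱 := 𝒱) l c).mul hA
    rwa [Adm.smul_one_mul] at h

theorem finrank_admSub_of_lt {l k : Fin r} (h : k < l) :
    Module.finrank ℝ (admSub 𝒱 l k) = 𝒱.dimV l k := by
  have : admSub 𝒱 l k = 𝒱.V l k :=
    Submodule.ext fun A => ⟨fun hA => Adm.mem_of_lt hA h, fun hA => Adm.lower h A hA⟩
  rw [this, BlockSystem.dimV]

theorem finrank_admSub_self (k : Fin r) : Module.finrank ℝ (admSub 𝒱 k k) = 1 := by
  have : Nonempty (Fin (n k)) := ⟨⟨0, 𝒱.npos k⟩⟩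
  have : admSub 𝒱 k k = Submodule.span ℝ {1} := by
    refine Submodule.ext fun A => ?_
    rw [Submodule.mem_span_singleton]
    refine ⟨fun hA => ?_, ?_⟩
    · obtain ⟨c, hc⟩ := Adm.eq_smul_one hA
      exact ⟨c, hc.symm⟩
    · rintro ⟨c, rfl⟩
      exact Adm.diag k c
  rw [this, finrank_span_singleton one_ne_zero]

theorem finrank_admSub_of_gt {l k : Fin r} (h : l < k) :
    Module.finrank ℝ (admSub 𝒱 l k) = 0 := by
  have : admSub 𝒱 l k = ⊥ := by
    refine (Submodule.eq_bot_iff _).2 fun A hA => Adm.eq_zero_of_lt hA h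
  rw [this, finrank_bot]

theorem sum_finrank_admSub (l : Fin r) :
    ∑ i : {i : Fin r // ε i = 1}, Module.finrank ℝ (admSub 𝒱 l i.1) =
      (ε l : ℕ) + pPar 𝒱 ε l := by
  have h1 : ∑ i : {i : Fin r // ε i = 1}, Module.finrank ℝ (admSub 𝒱 l i.1) =
      ∑ i, (ε i : ℕ) * Module.finrank ℝ (admSub 𝒱 l i) := by
    rw [← sum_subtype_eps ε]
    · refine Finset.sum_congr rfl fun i _ => ?_
      rw [i.2]
      simp
    · intro k hk
      rw [Fin.two_eq_zero_of_ne_one hk]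
      simp
  rw [h1, ← Finset.sum_subset (Finset.subset_univ (Finset.Iic l)), ← Finset.Iio_insert,
    Finset.sum_insert (by simp), finrank_admSub_self, mul_one, pPar]
  · congr 1
    exact Finset.sum_congr rfl fun i hi => by rw [finrank_admSub_of_lt (Finset.mem_Iio.1 hi)]
  · intro k _ hk
    rw [Finset.mem_Iic, not_le] at hk
    rw [finrank_admSub_of_gt hk, mul_zero]

/-- The decomposition of `W^ε` into blocks. -/
noncomputable def blockEquiv (𝒱 : BlockSystem r n) (ε : Fin r → Fin 2) :
    WSp 𝒱 ε ≃ₗ[ℝ] ∀ p : {i : Fin r // ε i = 1} × Fin r, admSub 𝒱 p.2 p.1.1 where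
  toFun x p := ⟨x.X p.2 p.1, WSub.adm (x p.1).2 p.2⟩
  map_add' _ _ := rfl
  map_smul' _ _ := rfl
  invFun y i := ⟨Matrix.of fun a b => (y (i, a.1)).1 a.2 b,
    mem_WSub_of_adm fun l => (y (i, l)).2⟩
  left_inv _ := rfl
  right_inv _ := rfl

theorem blockEquiv_actW (T : HSet 𝒱) (x : WSp 𝒱 ε) (p : {i : Fin r // ε i = 1} × Fin r) :
    (blockEquiv 𝒱 ε (actW ε T x) p).1 =
      ∑ a, blk T.1 p.2 a * (blockEquiv 𝒱 ε x (p.1, a)).1 :=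
  colBlk_mul _ _ _

theorem blockEquiv_actW_single_self (T : HSet 𝒱) (q : {i : Fin r // ε i = 1} × Fin r)
    (v : admSub 𝒱 q.2 q.1.1) :
    blockEquiv 𝒱 ε (actW ε T ((blockEquiv 𝒱 ε).symm (Pi.single q v))) q =
      scal (blk T.1 q.2 q.2) • v := by
  apply Subtype.ext
  rw [blockEquiv_actW, LinearEquiv.apply_symm_apply, Finset.sum_eq_single q.2]
  · change blk T.1 q.2 q.2 * ((Pi.single q v :
      ∀ p : {i : Fin r // ε i = 1} × Fin r, admSub 𝒱 p.2 p.1.1) q).1 = _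
    rw [Pi.single_eq_same, HSet.blk_self T.2 q.2]
    simp [scal_smul_one (𝒱.npos q.2)]
  · intro a _ ha
    rw [Pi.single_eq_of_ne fun h => ha (congrArg Prod.snd h)]
    simp
  · simp

theorem blockEquiv_actW_single_of_ne (T : HSet 𝒱) {p q : {i : Fin r // ε i = 1} × Fin r}
    (v : admSub 𝒱 q.2 q.1.1) (hpq : p ≠ q) (h : p.2 ≤ q.2) :
    blockEquiv 𝒱 ε (actW ε T ((blockEquiv 𝒱 ε).symm (Pi.single q v))) p = 0 := by
  apply Subtype.ext
  rw [blockEquiv_actW, LinearEquiv.apply_symm_apply]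
  refine Finset.sum_eq_zero fun a _ => ?_
  by_cases ha : (p.1, a) = q
  · subst ha
    have : p.2 < a := lt_of_le_of_ne h fun h => hpq (Prod.ext rfl h)
    rw [T.2.1 a p.2 this, Matrix.zero_mul]
  · rw [Pi.single_eq_of_ne ha]
    simp

theorem det_actW (T : HSet 𝒱) :
    LinearMap.det (actW ε T) =
      ∏ k, scal (blk T.1 k k) ^ ((ε k : ℕ) + pPar 𝒱 ε k) := by
  classical
  set t : Fin r → ℝ := fun k => scal (blk T.1 k k) with ht
  let b := fun p : {i : Fin r // ε i = 1} × Fin r => Module.finBasis ℝ (admSub 𝒱 p.2 p.1.1)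
  let B := (Pi.basis b).map (blockEquiv 𝒱 ε).symm
  have hentry : ∀ p q a c, LinearMap.toMatrix B B (actW ε T) ⟨p, a⟩ ⟨q, c⟩ =
      (b p).repr (blockEquiv 𝒱 ε (actW ε T ((blockEquiv 𝒱 ε).symm
        (Pi.single q (b q c)))) p) a := by
    intro p q a c
    rw [LinearMap.toMatrix_apply]
    simp [B, Pi.basis_apply, Pi.basis_repr]
  let lvl : (Σ p : {i : Fin r // ε i = 1} × Fin r,
      Fin (Module.finrank ℝ (admSub 𝒱 p.2 p.1.1))) → (Fin r)ᵒᵈ := fun x => OrderDual.toDual x.1.2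
  have htri : (LinearMap.toMatrix B B (actW ε T)).BlockTriangular lvl := by
    rintro ⟨p, a⟩ ⟨q, c⟩ h
    have h' : p.2 < q.2 := OrderDual.toDual_lt_toDual.1 h
    rw [hentry, blockEquiv_actW_single_of_ne T _ (fun hpq => h'.ne (by rw [hpq])) h'.le]
    simp
  have hsq : ∀ l, (LinearMap.toMatrix B B (actW ε T)).toSquareBlock lvl l =
      t (OrderDual.ofDual l) • 1 := by
    intro l
    ext ⟨⟨p, a⟩, hp⟩ ⟨⟨q, c⟩, hq⟩
    have hp' : p.2 = OrderDual.ofDual l := hp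
    have hq' : q.2 = OrderDual.ofDual l := hq
    rw [Matrix.toSquareBlock_def, Matrix.of_apply, hentry]
    by_cases hpq : p = q
    · subst hpq
      rw [blockEquiv_actW_single_self, ← hp']
      simp only [map_smul, Finsupp.smul_apply, Module.Basis.repr_self, Matrix.smul_apply, ht]
      congr 1
      by_cases hac : c = a
      · subst hac
        simp
      · rw [Finsupp.single_eq_of_ne' hac, Matrix.one_apply_ne]
        intro h
        simp only [Subtype.mk.injEq, Sigma.mk.injEq, heq_eq_eq, true_and] at h
        exact hac h.symm
    · rw [blockEquiv_actW_single_of_ne T _ hpq (hp'.trans hq'.symm).le, Matrix.smul_apply,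
        Matrix.one_apply_ne]
      · simp
      · intro h
        simp only [Subtype.mk.injEq, Sigma.mk.injEq] at h
        exact hpq h.1
  rw [← LinearMap.det_toMatrix B, htri.det_fintype]
  have h1 : ∀ l : (Fin r)ᵒᵈ, ((LinearMap.toMatrix B B (actW ε T)).toSquareBlock lvl l).det =
      ∏ x with lvl x = l, t (OrderDual.ofDual (lvl x)) := by
    intro l
    rw [hsq, Matrix.det_smul, Matrix.det_one, mul_one, Fintype.card_subtype,
      Finset.prod_congr rfl fun x hx => by rw [(Finset.mem_filter.1 hx).2], Finset.prod_const]
  rw [Finset.prod_congr rfl fun l _ => h1 l, Finset.prod_fiberwise, Fintype.prod_sigma,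
    Fintype.prod_prod_type_right]
  refine Finset.prod_congr rfl fun l _ => ?_
  rw [← sum_finrank_admSub (𝒱 := 𝒱) (ε := ε) l, ← Finset.prod_pow_eq_pow_sum]
  refine Finset.prod_congr rfl fun i _ => ?_
  simp [lvl, ht]

theorem det_actW_pos (T : HSet 𝒱) : 0 < LinearMap.det (actW ε T) := by
  rw [det_actW]
  exact Finset.prod_pos fun k _ => pow_pos (HSet.diag_pos 𝒱 T.2 k) _

end GindikinRiesz

/-! ### Gaussian integrals -/

theorem integral_prod_mul_exp_neg_norm_sq {E : Type*} [NormedAddCommGroup E]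
    [InnerProductSpace ℝ E] [FiniteDimensional ℝ E] [MeasurableSpace E] [BorelSpace E]
    {ι : Type*} [Fintype ι] {e : ι → E} (he : Orthonormal ℝ e) (f : ι → ℝ → ℝ) :
    ∫ x : E, (∏ i, f i (inner ℝ (e i) x)) * Real.exp (-‖x‖ ^ 2) =
      (∏ i, ∫ t : ℝ, f i t * Real.exp (-t ^ 2)) *
        √Real.pi ^ (Module.finrank ℝ E - Fintype.card ι) := by
  set m := Module.finrank ℝ E - Fintype.card ι with hm
  have hcard : Module.finrank ℝ E = Fintype.card (ι ⊕ Fin m) := by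
    have := he.linearIndependent.fintype_card_le_finrank
    rw [Fintype.card_sum, Fintype.card_fin]
    omega
  let v : ι ⊕ Fin m → E := Sum.elim e 0
  have hv : Orthonormal ℝ ((Set.range (Sum.inl : ι → ι ⊕ Fin m)).domRestrict v) := by
    refine ⟨?_, ?_⟩
    · rintro ⟨_, i, rfl⟩
      exact he.1 i
    · rintro ⟨_, i, rfl⟩ ⟨_, j, rfl⟩ hij
      exact he.2 fun h => hij (by rw [h])
  obtain ⟨b, hb⟩ := hv.exists_orthonormalBasis_extension_of_card_eq hcard
  have hbe : ∀ i, b (Sum.inl i) = e i := fun i => hb _ ⟨i, rfl⟩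
  let F : ι ⊕ Fin m → ℝ → ℝ := Sum.elim (fun i t => f i t * Real.exp (-t ^ 2))
    fun _ t => Real.exp (-t ^ 2)
  have hF : ∀ x : E, (∏ i, f i (inner ℝ (e i) x)) * Real.exp (-‖x‖ ^ 2) =
      ∏ j, F j ((MeasurableEquiv.toLp 2 (ι ⊕ Fin m → ℝ)).symm (b.measurableEquiv x) j) := by
    intro x
    have h1 : ∀ j, (MeasurableEquiv.toLp 2 (ι ⊕ Fin m → ℝ)).symm (b.measurableEquiv x) j =
        inner ℝ (b j) x := fun j => b.repr_apply_apply x j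
    have h2 : ‖x‖ ^ 2 = ∑ j, inner ℝ (b j) x ^ 2 := by
      rw [← b.sum_sq_norm_inner_right x]
      simp
    simp only [h1]
    rw [h2, ← Finset.sum_neg_distrib, Real.exp_sum, Fintype.prod_sum_type, Fintype.prod_sum_type,
      ← mul_assoc, ← Finset.prod_mul_distrib]
    simp [F, hbe]
  have hexp : ∫ t : ℝ, Real.exp (-t ^ 2) = √Real.pi := by
    have := integral_gaussian 1
    simpa using this
  rw [integral_congr_ae (.of_forall hF),
    b.measurePreserving_measurableEquiv.integral_comp'
      (g := fun y => ∏ j, F j ((MeasurableEquiv.toLp 2 (ι ⊕ Fin m → ℝ)).symm y j)),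
    (EuclideanSpace.volume_preserving_symm_measurableEquiv_toLp (ι ⊕ Fin m)).integral_comp'
      (g := fun y => ∏ j, F j (y j)),
    integral_fintype_prod_volume_eq_prod, Fintype.prod_sum_type]
  simp [F, hexp]

theorem integral_indicator_rpow_mul_exp_neg_sq {u : ℝ} (hu : 0 < u) :
    ∫ t : ℝ, (Set.Ioi (0 : ℝ)).indicator (fun t => t ^ (2 * u - 1)) t * Real.exp (-t ^ 2) =
      Real.Gamma u / 2 := by
  have h : ∀ t : ℝ, (Set.Ioi (0 : ℝ)).indicator (fun t => t ^ (2 * u - 1)) t *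
      Real.exp (-t ^ 2) = (Set.Ioi (0 : ℝ)).indicator
        (fun t => t ^ (2 * u - 1) * Real.exp (-t ^ (2 : ℝ))) t := fun t => by
    simp only [Set.indicator_apply, Real.rpow_two]
    split_ifs <;> simp
  rw [integral_congr_ae (.of_forall h), integral_indicator measurableSet_Ioi,
    integral_rpow_mul_exp_neg_rpow two_pos (by linarith)]
  rw [show (2 * u - 1 + 1) / 2 = u by ring]
  ring

namespace GindikinRiesz

variable {r : ℕ} {n : Fin r → ℕ} {𝒱 : BlockSystem r n} {ε : Fin r → Fin 2}

/-- The element `x` of `W^ε` with `x_{ii} = 1` and all other blocks zero. -/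
noncomputable def unitW (𝒱 : BlockSystem r n) (i : {i : Fin r // ε i = 1}) : WSp 𝒱 ε :=
  (blockEquiv 𝒱 ε).symm (Pi.single (i, i.1) ⟨1, by
    have := Adm.diag (𝒱 := 𝒱) i.1 1
    rwa [one_smul] at this⟩)

theorem unitW_X (i : {i : Fin r // ε i = 1}) (p : {i : Fin r // ε i = 1} × Fin r)
    (h : p ≠ (i, i.1)) : (unitW 𝒱 i).X p.2 p.1 = 0 := by
  have : (blockEquiv 𝒱 ε (unitW 𝒱 i) p).1 = 0 := by
    rw [unitW, LinearEquiv.apply_symm_apply, Pi.single_eq_of_ne h]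
    rfl
  exact this

theorem unitW_X_self (i : {i : Fin r // ε i = 1}) : (unitW 𝒱 i).X i.1 i = 1 := by
  have : (blockEquiv 𝒱 ε (unitW 𝒱 i) (i, i.1)).1 = 1 := by
    rw [unitW, LinearEquiv.apply_symm_apply, Pi.single_eq_same]
  exact this

theorem unitW_d_self (i : {i : Fin r // ε i = 1}) : (unitW 𝒱 i).d i = 1 := by
  rw [WSp.d, unitW_X_self, ← one_smul ℝ (1 : Matrix (Fin (n i.1)) (Fin (n i.1)) ℝ),
    scal_smul_one (𝒱.npos i.1)]

theorem unitW_d_of_ne {i j : {i : Fin r // ε i = 1}} (h : j ≠ i) : (unitW 𝒱 i).d j = 0 := by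
  rw [WSp.d, unitW_X i (j, j.1) fun hj => h (congrArg Prod.fst hj), scal_zero]

theorem inner_unitW (i : {i : Fin r // ε i = 1}) (x : WSp 𝒱 ε) :
    inner ℝ (unitW 𝒱 i) x = x.d i := by
  change WSp.ipW _ _ = _
  rw [WSp.ipW, Finset.sum_eq_single i]
  · rw [unitW_d_self, one_mul, Finset.sum_eq_zero, add_zero]
    intro l hl
    rw [unitW_X i (i, l) fun h => (Finset.mem_Ioi.1 hl).ne' (congrArg Prod.snd h), ip_zero_left]
  · intro j _ hj
    rw [unitW_d_of_ne hj, zero_mul, zero_add]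
    refine Finset.sum_eq_zero fun l _ => ?_
    rw [unitW_X i (j, l) fun h => hj (congrArg Prod.fst h), ip_zero_left]
  · simp

theorem orthonormal_unitW : Orthonormal ℝ (unitW 𝒱 : {i : Fin r // ε i = 1} → WSp 𝒱 ε) := by
  classical
  rw [orthonormal_iff_ite]
  intro i j
  rw [inner_unitW]
  split_ifs with h
  · rw [h, unitW_d_self]
  · exact unitW_d_of_ne h

/-- The unnormalised density of `M_u^ε`, extended by `0`. -/
noncomputable def weightW (u : Fin r → ℝ) (x : WSp 𝒱 ε) : ℝ :=
  ∏ i : {i : Fin r // ε i = 1}, (Set.Ioi (0 : ℝ)).indicator (fun t => t ^ (2 * u i.1 - 1)) (x.d i)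

theorem weightW_nonneg (u : Fin r → ℝ) (x : WSp 𝒱 ε) : 0 ≤ weightW u x :=
  Finset.prod_nonneg fun _ _ => Set.indicator_nonneg (fun _ ht => Real.rpow_nonneg (le_of_lt ht) _) _

theorem measurable_weightW (u : Fin r → ℝ) : Measurable (weightW u : WSp 𝒱 ε → ℝ) := by
  refine Finset.measurable_fun_prod _ fun i _ => ?_
  have h : Measurable ((Set.Ioi (0 : ℝ)).indicator fun t : ℝ => t ^ (2 * u i.1 - 1)) :=
    (measurable_id.pow_const _).indicator measurableSet_Ioi
  exact h.comp (WSp.continuous_d i).measurable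

theorem weightW_of_mem {u : Fin r → ℝ} {x : WSp 𝒱 ε} (hx : x ∈ WPlus 𝒱 ε) :
    weightW u x = ∏ i, x.d i ^ (2 * u i.1 - 1) :=
  Finset.prod_congr rfl fun i _ => Set.indicator_of_mem (hx i) _

theorem weightW_of_notMem {u : Fin r → ℝ} {x : WSp 𝒱 ε} (hx : x ∉ WPlus 𝒱 ε) :
    weightW u x = 0 := by
  simp only [WPlus, Set.mem_ofPred_eq, not_forall] at hx
  obtain ⟨i, hi⟩ := hx
  exact Finset.prod_eq_zero (Finset.mem_univ i) (Set.indicator_of_notMem hi _)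

theorem GammaEps_pos {u : Fin r → ℝ} (hu : u ∈ RPlus ε) : 0 < GammaEps 𝒱 ε u := by
  refine mul_pos (Real.rpow_pos_of_pos Real.pi_pos _) (Finset.prod_pos fun i _ => ?_)
  exact div_pos (Real.Gamma_pos_of_pos ((hu i.1).2 i.2))
    (mul_pos two_pos (Real.sqrt_pos.2 Real.pi_pos))

theorem integral_weightW_mul_exp {u : Fin r → ℝ} (hu : u ∈ RPlus ε) :
    ∫ x : WSp 𝒱 ε, weightW u x * Real.exp (-‖x‖ ^ 2) = GammaEps 𝒱 ε u := by
  have h := integral_prod_mul_exp_neg_norm_sq (orthonormal_unitW (𝒱 := 𝒱) (ε := ε))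
    fun i => (Set.Ioi (0 : ℝ)).indicator fun t => t ^ (2 * u i.1 - 1)
  simp only [inner_unitW] at h
  have hcard := (orthonormal_unitW (𝒱 := 𝒱) (ε := ε)).linearIndependent.fintype_card_le_finrank
  refine h.trans ?_
  rw [Finset.prod_congr rfl fun i _ => integral_indicator_rpow_mul_exp_neg_sq ((hu i.1).2 i.2),
    GammaEps]
  have hs : (0 : ℝ) < √Real.pi := Real.sqrt_pos.2 Real.pi_pos
  have h1 : Real.pi ^ ((Module.finrank ℝ (WSp 𝒱 ε) : ℝ) / 2) =
      √Real.pi ^ Module.finrank ℝ (WSp 𝒱 ε) := by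
    rw [Real.sqrt_eq_rpow, ← Real.rpow_natCast, ← Real.rpow_mul Real.pi_pos.le]
    congr 1
    ring
  have h2 : ∏ i : {i : Fin r // ε i = 1}, Real.Gamma (u i.1) / (2 * √Real.pi) =
      (∏ i : {i : Fin r // ε i = 1}, Real.Gamma (u i.1) / 2) /
        √Real.pi ^ Fintype.card {i : Fin r // ε i = 1} := by
    rw [← Finset.card_univ, ← Finset.prod_const, ← Finset.prod_div_distrib]
    exact Finset.prod_congr rfl fun i _ => (div_div _ _ _).symm
  rw [h1, h2, ← Nat.sub_add_cancel hcard, pow_add, Nat.add_sub_cancel]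
  field_simp

theorem lintegral_measM (u : Fin r → ℝ) {g : WSp 𝒱 ε → ENNReal} (hg : Measurable g) :
    ∫⁻ x, g x ∂measM 𝒱 ε u =
      ∫⁻ x, ENNReal.ofReal (weightW u x / GammaEps 𝒱 ε u) * g x := by
  have hdens : Measurable fun x : WSp 𝒱 ε =>
      ENNReal.ofReal ((∏ i, x.d i ^ (2 * u i.1 - 1)) / GammaEps 𝒱 ε u) :=
    ((Finset.measurable_fun_prod _ fun i _ =>
      (WSp.continuous_d i).measurable.pow_const _).div_const _).ennreal_ofReal
  rw [measM, lintegral_withDensity_eq_lintegral_mul _ hdens hg,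
    ← lintegral_indicator isOpen_WPlus.measurableSet]
  refine lintegral_congr fun x => ?_
  by_cases hx : x ∈ WPlus 𝒱 ε
  · rw [Set.indicator_of_mem hx, weightW_of_mem hx]
    rfl
  · rw [Set.indicator_of_notMem hx, weightW_of_notMem hx]
    simp

theorem lintegral_exp_neg_norm_sq_measM {u : Fin r → ℝ} (hu : u ∈ RPlus ε) :
    ∫⁻ x, ENNReal.ofReal (Real.exp (-‖x‖ ^ 2)) ∂measM 𝒱 ε u = 1 := by
  have hG := GammaEps_pos (𝒱 := 𝒱) hu
  rw [lintegral_measM u (by fun_prop)]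
  have h1 : ∀ x : WSp 𝒱 ε, ENNReal.ofReal (weightW u x / GammaEps 𝒱 ε u) *
      ENNReal.ofReal (Real.exp (-‖x‖ ^ 2)) =
      ENNReal.ofReal ((weightW u x * Real.exp (-‖x‖ ^ 2)) / GammaEps 𝒱 ε u) := fun x => by
    rw [← ENNReal.ofReal_mul (div_nonneg (weightW_nonneg u x) hG.le), div_mul_eq_mul_div]
  have h2 := integral_weightW_mul_exp (𝒱 := 𝒱) hu
  have hint : Integrable fun x : WSp 𝒱 ε => weightW u x * Real.exp (-‖x‖ ^ 2) :=
    .of_integral_ne_zero (h2 ▸ hG.ne')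
  rw [lintegral_congr h1, ← ofReal_integral_eq_lintegral_ofReal (hint.div_const _),
    integral_div, h2, div_self hG.ne', ENNReal.ofReal_one]
  exact .of_forall fun x => div_nonneg (mul_nonneg (weightW_nonneg u x) (Real.exp_nonneg _)) hG.le

/-- The factor by which `T` transforms the measure `M_u^ε`. -/
noncomputable def chiReal (𝒱 : BlockSystem r n) (ε : Fin r → Fin 2) (u : Fin r → ℝ)
    (T : HSet 𝒱) : ℝ :=
  ∏ k, scal (blk T.1 k k) ^ (2 * u k + pPar 𝒱 ε k)

theorem chiReal_pos (u : Fin r → ℝ) (T : HSet 𝒱) : 0 < chiReal 𝒱 ε u T :=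
  Finset.prod_pos fun k _ => Real.rpow_pos_of_pos (HSet.diag_pos 𝒱 T.2 k) _

theorem det_actW_mul_weightW {u : Fin r → ℝ} (hu : u ∈ RPlus ε) (T : HSet 𝒱) (x : WSp 𝒱 ε) :
    LinearMap.det (actW ε T) * weightW u (actW ε T x) = chiReal 𝒱 ε u T * weightW u x := by
  have h1 : weightW u (actW ε T x) =
      (∏ k, scal (blk T.1 k k) ^ (2 * u k - (ε k : ℕ))) * weightW u x := by
    rw [← prod_subtype_eps ε, weightW, weightW, ← Finset.prod_mul_distrib]
    · refine Finset.prod_congr rfl fun i _ => ?_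
      have ht := HSet.diag_pos 𝒱 T.2 i.1
      rw [actW_d, i.2]
      simp only [Set.indicator_apply, Set.mem_Ioi, mul_pos_iff_of_pos_left ht]
      split_ifs with h
      · rw [Real.mul_rpow ht.le h.le]
        simp
      · simp
    · intro k hk
      rw [Fin.two_eq_zero_of_ne_one hk, (hu k).1 (Fin.two_eq_zero_of_ne_one hk)]
      simp
  rw [h1, ← mul_assoc, det_actW, ← Finset.prod_mul_distrib, chiReal]
  congr 1
  refine Finset.prod_congr rfl fun k _ => ?_
  rw [← Real.rpow_natCast, ← Real.rpow_add (HSet.diag_pos 𝒱 T.2 k)]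
  congr 1
  push_cast
  ring

theorem lintegral_comp_actW_measM {u : Fin r → ℝ} (hu : u ∈ RPlus ε) (T : HSet 𝒱)
    {g : WSp 𝒱 ε → ENNReal} (hg : Measurable g) :
    ∫⁻ x, g (actW ε T x) ∂measM 𝒱 ε u =
      ENNReal.ofReal (chiReal 𝒱 ε u T)⁻¹ * ∫⁻ x, g x ∂measM 𝒱 ε u := by
  have hG := GammaEps_pos (𝒱 := 𝒱) hu
  have hdet := det_actW_pos (ε := ε) T
  have hchi := chiReal_pos (ε := ε) u T
  have hact : Measurable (actW ε T) := (LinearMap.continuous_of_finiteDimensional _).measurable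
  have hw : Measurable fun x : WSp 𝒱 ε => ENNReal.ofReal (weightW u x / GammaEps 𝒱 ε u) :=
    ((measurable_weightW u).div_const _).ennreal_ofReal
  rw [lintegral_measM u (g := fun x => g (actW ε T x)) (hg.comp hact), lintegral_measM u hg]
  have h1 : ∀ x : WSp 𝒱 ε, ENNReal.ofReal (weightW u x / GammaEps 𝒱 ε u) * g (actW ε T x) =
      ENNReal.ofReal (LinearMap.det (actW ε T) / chiReal 𝒱 ε u T) *
        (ENNReal.ofReal (weightW u (actW ε T x) / GammaEps 𝒱 ε u) * g (actW ε T x)) := fun x => by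
    rw [← mul_assoc, ← ENNReal.ofReal_mul (by positivity)]
    congr 2
    have := det_actW_mul_weightW hu T x
    field_simp
    linarith
  have h2 := Measure.map_linearMap_addHaar_eq_smul_addHaar
    (volume : Measure (WSp 𝒱 ε)) hdet.ne'
  have h3 : ∫⁻ x, (ENNReal.ofReal (weightW u (actW ε T x) / GammaEps 𝒱 ε u) *
      g (actW ε T x)) = ENNReal.ofReal |(LinearMap.det (actW ε T))⁻¹| *
        ∫⁻ x, ENNReal.ofReal (weightW u x / GammaEps 𝒱 ε u) * g x := by
    rw [← lintegral_map (f := fun x => ENNReal.ofReal (weightW u x / GammaEps 𝒱 ε u) * g x)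
      (hw.mul hg) hact, h2, lintegral_smul_measure, smul_eq_mul]
  rw [lintegral_congr h1, lintegral_const_mul' _ _ ENNReal.ofReal_ne_top, h3, ← mul_assoc,
    ← ENNReal.ofReal_mul (by positivity), abs_of_pos (by positivity)]
  congr 2
  field_simp

theorem lintegral_exp_neg_inner_quad {u : Fin r → ℝ} (hu : u ∈ RPlus ε) (T : HSet 𝒱) :
    ∫⁻ x, ENNReal.ofReal (Real.exp (-inner ℝ (quad 𝒱 ε x) (rhoStar T (unitZ 𝒱)))) ∂measM 𝒱 ε u =
      ENNReal.ofReal (chiReal 𝒱 ε u T)⁻¹ := by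
  simp only [inner_quad_rhoStar_unitZ]
  rw [lintegral_comp_actW_measM hu T (g := fun x => ENNReal.ofReal (Real.exp (-‖x‖ ^ 2)))
    (by fun_prop), lintegral_exp_neg_norm_sq_measM hu, mul_one]

end GindikinRiesz

theorem ofReal_Gamma_mul_rpow_neg {k a : ℝ} (hk : 0 < k) (ha : 0 < a) :
    ENNReal.ofReal (Real.Gamma k * a ^ (-k)) =
      ∫⁻ s in Set.Ioi (0 : ℝ), ENNReal.ofReal (s ^ (k - 1) * Real.exp (-(a * s))) := by
  have h := Real.integral_rpow_mul_exp_neg_mul_Ioi hk ha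
  have h' : (1 / a) ^ k * Real.Gamma k = Real.Gamma k * a ^ (-k) := by
    rw [one_div, Real.inv_rpow ha.le, Real.rpow_neg ha.le, mul_comm]
  rw [h'] at h
  have hpos : 0 < Real.Gamma k * a ^ (-k) :=
    mul_pos (Real.Gamma_pos_of_pos hk) (Real.rpow_pos_of_pos ha _)
  rw [← h, ofReal_integral_eq_lintegral_ofReal]
  · exact .of_integral_ne_zero (h ▸ hpos.ne')
  · filter_upwards [ae_restrict_mem measurableSet_Ioi] with s hs
    exact mul_nonneg (Real.rpow_nonneg (le_of_lt hs) _) (Real.exp_nonneg _)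

namespace GindikinRiesz

variable {r : ℕ} {n : Fin r → ℕ} {𝒱 : BlockSystem r n} {ε : Fin r → Fin 2}

/-! ### Growth of the image measure -/

theorem lintegral_exp_neg_mul_norm_sq {u : Fin r → ℝ} (hu : u ∈ RPlus ε) {s : ℝ} (hs : 0 < s) :
    ∫⁻ x, ENNReal.ofReal (Real.exp (-(s * ‖x‖ ^ 2))) ∂measM 𝒱 ε u =
      ENNReal.ofReal (s ^ (-((∑ k, (2 * u k + pPar 𝒱 ε k)) / 2))) := by
  have hc : ∀ _ : Fin r, 0 < √s := fun _ => Real.sqrt_pos.2 hs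
  have h := lintegral_exp_neg_inner_quad (𝒱 := 𝒱) hu ⟨_, HSet.diagonal hc⟩
  rw [rhoStar_diagonal_unitZ hc] at h
  have h1 : ∀ x : WSp 𝒱 ε,
      inner ℝ (quad 𝒱 ε x) (diagZ 𝒱 fun _ => √s ^ 2) = s * ‖x‖ ^ 2 := fun x => by
    rw [inner_diagZ, ← inner_quad_unitZ, inner_unitZ, ← Finset.sum_mul, Real.sq_sqrt hs.le,
      mul_comm]
  simp only [h1] at h
  rw [h]
  congr 1
  have h2 : chiReal 𝒱 ε u ⟨_, HSet.diagonal hc⟩ =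
      ∏ k, √s ^ (2 * u k + pPar 𝒱 ε k) :=
    Finset.prod_congr rfl fun k _ => by
      have h3 : scal (blk (Matrix.diagonal fun _ : Idx n => √s) k k) = √s := by
        rw [blk_diagonal_self (fun _ => √s) k, scal_smul_one (𝒱.npos k)]
      rw [h3]
  rw [h2, ← Real.rpow_sum_of_pos (Real.sqrt_pos.2 hs), Real.sqrt_eq_rpow, ← Real.rpow_mul hs.le, ← Real.rpow_neg hs.le]
  congr 1
  ring

theorem integrable_one_add_norm_sq_rpow {u : Fin r → ℝ} (hu : u ∈ RPlus ε) {k : ℝ}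
    (hk : (∑ k, (2 * u k + pPar 𝒱 ε k)) / 2 < k) (hk0 : 0 < k) :
    Integrable (fun x : WSp 𝒱 ε => (1 + ‖x‖ ^ 2) ^ (-k)) (measM 𝒱 ε u) := by
  set A := (∑ k, (2 * u k + pPar 𝒱 ε k)) / 2 with hA
  have hmeas : Measurable fun x : WSp 𝒱 ε => (1 + ‖x‖ ^ 2) ^ (-k) :=
    Measurable.pow_const (by fun_prop) _
  have hG := Real.Gamma_pos_of_pos hk0
  suffices h : Integrable (fun x : WSp 𝒱 ε => Real.Gamma k * (1 + ‖x‖ ^ 2) ^ (-k))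
      (measM 𝒱 ε u) by
    refine (h.const_mul (Real.Gamma k)⁻¹).congr (.of_forall fun x => ?_)
    exact inv_mul_cancel_left₀ hG.ne' _
  refine ⟨(hmeas.const_mul _).aestronglyMeasurable, ?_⟩
  rw [hasFiniteIntegral_iff_ofReal (.of_forall fun x => by positivity)]
  have h1 : ∀ x : WSp 𝒱 ε, ENNReal.ofReal (Real.Gamma k * (1 + ‖x‖ ^ 2) ^ (-k)) =
      ∫⁻ s in Set.Ioi (0 : ℝ), ENNReal.ofReal (s ^ (k - 1) * Real.exp (-s)) *
        ENNReal.ofReal (Real.exp (-(s * ‖x‖ ^ 2))) := fun x => by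
    rw [ofReal_Gamma_mul_rpow_neg hk0 (by positivity)]
    refine setLIntegral_congr_fun measurableSet_Ioi fun s hs => ?_
    have hs' : 0 ≤ s ^ (k - 1) := Real.rpow_nonneg (le_of_lt hs) _
    rw [← ENNReal.ofReal_mul (by positivity), mul_assoc, ← Real.exp_add]
    ring_nf
  have : SFinite (measM 𝒱 ε u) := by
    unfold measM
    infer_instance
  rw [lintegral_congr h1, lintegral_lintegral_swap (by fun_prop)]
  have h2 : ∀ s ∈ Set.Ioi (0 : ℝ), ∫⁻ x : WSp 𝒱 ε,
      ENNReal.ofReal (s ^ (k - 1) * Real.exp (-s)) *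
        ENNReal.ofReal (Real.exp (-(s * ‖x‖ ^ 2))) ∂measM 𝒱 ε u =
      ENNReal.ofReal (Real.exp (-s) * s ^ (k - A - 1)) := fun s hs => by
    have hs0 : (0 : ℝ) < s := hs
    rw [lintegral_const_mul' _ _ ENNReal.ofReal_ne_top, lintegral_exp_neg_mul_norm_sq hu hs0,
      ← ENNReal.ofReal_mul (by positivity), mul_right_comm, ← Real.rpow_add hs0, mul_comm]
    congr 3
    ring
  rw [setLIntegral_congr_fun measurableSet_Ioi h2]
  exact (lintegral_mono fun s => Real.ofReal_le_enorm _).trans_lt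
    (Real.GammaIntegral_convergent (sub_pos.2 hk)).hasFiniteIntegral

theorem hasTemperateGrowth_map_quad {u : Fin r → ℝ} (hu : u ∈ RPlus ε) :
    ((measM 𝒱 ε u).map (quad 𝒱 ε)).HasTemperateGrowth := by
  obtain ⟨N, hN⟩ := exists_nat_gt (max ((∑ k, (2 * u k + pPar 𝒱 ε k)) / 2) 0)
  have hN1 := (le_max_left _ _).trans_lt hN
  have hN0 := (le_max_right _ _).trans_lt hN
  refine ⟨N, ?_⟩
  have hc : Continuous fun y : ZSp 𝒱 => (1 + ‖y‖) ^ (-(N : ℝ)) :=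
    Continuous.rpow_const (by fun_prop) fun y => Or.inl (by positivity)
  rw [integrable_map_measure hc.aestronglyMeasurable measurable_quad.aemeasurable]
  set C := 1 + ‖unitZ 𝒱‖ with hC
  have hC0 : 0 < C := by positivity
  refine ((integrable_one_add_norm_sq_rpow (𝒱 := 𝒱) hu hN1 hN0).const_mul (C ^ (N : ℝ))).mono'
    (hc.comp continuous_quad).aestronglyMeasurable (.of_forall fun x => ?_)
  rw [Function.comp_apply, Real.norm_of_nonneg (by positivity)]
  have h1 : ‖x‖ ^ 2 ≤ ‖quad 𝒱 ε x‖ * ‖unitZ 𝒱‖ := by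
    rw [← inner_quad_unitZ]
    exact real_inner_le_norm _ _
  have h2 : 1 + ‖x‖ ^ 2 ≤ C * (1 + ‖quad 𝒱 ε x‖) := by
    rw [hC]
    nlinarith [norm_nonneg (quad 𝒱 ε x), norm_nonneg (unitZ 𝒱)]
  rw [Real.rpow_neg (by positivity), Real.rpow_neg (by positivity), ← div_eq_mul_inv,
    le_div_iff₀ (by positivity), inv_mul_le_iff₀ (by positivity),
    ← Real.mul_rpow (by positivity) hC0.le, mul_comm _ C]
  exact Real.rpow_le_rpow (by positivity) h2 hN0.le

/-! ### The Laplace transform -/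

theorem integral_cexp_inner_quad {u : Fin r → ℝ} (hu : u ∈ RPlus ε) {T : HSet 𝒱} {θ : ZSp 𝒱}
    (hT : rhoStar T (unitZ 𝒱) = -θ) :
    ∫ x, Complex.exp ((inner ℝ (quad 𝒱 ε x) θ : ℝ) : ℂ) ∂measM 𝒱 ε u =
      (((chiReal 𝒱 ε u T)⁻¹ : ℝ) : ℂ) := by
  have h := lintegral_exp_neg_inner_quad (𝒱 := 𝒱) hu T
  simp only [hT, inner_neg_right, neg_neg] at h
  have h1 : ∫ x, Real.exp (inner ℝ (quad 𝒱 ε x) θ) ∂measM 𝒱 ε u = (chiReal 𝒱 ε u T)⁻¹ := by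
    rw [integral_eq_lintegral_of_nonneg_ae (.of_forall fun x => Real.exp_nonneg _), h,
      ENNReal.toReal_ofReal (inv_nonneg.2 (chiReal_pos u T).le)]
    have hc : Continuous fun x : WSp 𝒱 ε => Real.exp (inner ℝ (quad 𝒱 ε x) θ) :=
      Real.continuous_exp.comp (continuous_quad.inner continuous_const)
    exact hc.aestronglyMeasurable
  rw [← h1, ← integral_complex_ofReal]
  exact integral_congr_ae (.of_forall fun x => (Complex.ofReal_exp _).symm)

theorem chi_revPar_neg_revPar (u : Fin r → ℝ) (T : HSet 𝒱) :
    chi (revPar (-revPar fun k => ((u k + (pPar 𝒱 ε k : ℝ) / 2 : ℝ) : ℂ))) T =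
      (((chiReal 𝒱 ε u T)⁻¹ : ℝ) : ℂ) := by
  rw [chi, chiReal, ← Finset.prod_inv_distrib, Complex.ofReal_prod]
  refine Finset.prod_congr rfl fun k _ => ?_
  have ht := HSet.diag_pos 𝒱 T.2 k
  rw [← Real.rpow_neg ht.le, Complex.ofReal_cpow ht.le]
  congr 1
  simp only [revPar, Pi.neg_apply, Fin.rev_rev]
  push_cast
  ring

theorem DeltaStar_neg {η : ZSp 𝒱} (hη : η ∈ dualCone 𝒱) (u : Fin r → ℝ) :
    ∃ T : HSet 𝒱, rhoStar T (unitZ 𝒱) = η ∧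
      DeltaStar 𝒱 (-revPar fun k => ((u k + (pPar 𝒱 ε k : ℝ) / 2 : ℝ) : ℂ)) η =
        (((chiReal 𝒱 ε u T)⁻¹ : ℝ) : ℂ) := by
  have h := exists_rhoStar_unitZ_eq hη
  refine ⟨h.choose, h.choose_spec, ?_⟩
  rw [DeltaStar, dif_pos h, chi_revPar_neg_revPar]

theorem exists_inner_le_of_neg_mem_dualCone {θ : ZSp 𝒱} (hθ : -θ ∈ dualCone 𝒱) :
    ∃ c : ℝ, 0 < c ∧ ∀ y ∈ closure (cone 𝒱), inner ℝ y θ ≤ -c * ‖y‖ := by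
  obtain ⟨c, hc, h⟩ := exists_mul_norm_le_inner hθ
  refine ⟨c, hc, fun y hy => ?_⟩
  have := h y hy
  rw [inner_neg_right] at this
  linarith

theorem exists_schwartzMap_eq_exp_near_cone {θ : ZSp 𝒱} (hθ : -θ ∈ dualCone 𝒱) :
    ∃ f : 𝓢(ZSp 𝒱, ℂ),
      ∀ᶠ y in 𝓝ˢ (closure (cone 𝒱)), f y = Complex.exp ((inner ℝ y θ : ℝ) : ℂ) := by
  obtain ⟨c, hc, h⟩ := exists_inner_le_of_neg_mem_dualCone hθ
  obtain ⟨f, hf⟩ := exists_schwartzMap_eq_exp_inner hc h 1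
  refine ⟨f, ?_⟩
  rw [Filter.Eventually, mem_nhdsSet_iff_forall]
  intro x hx
  filter_upwards [Metric.ball_mem_nhds x one_pos] with y hy
  exact hf y ⟨x, hx, (mem_ball_iff_norm.1 hy).le⟩

/-- The image of `M_u^ε` under the quadratic map, as a tempered distribution. -/
noncomputable def rieszDistribution (𝒱 : BlockSystem r n) {ε : Fin r → Fin 2} {u : Fin r → ℝ}
    (hu : u ∈ RPlus ε) : 𝓢'(ZSp 𝒱, ℂ) :=
  have := hasTemperateGrowth_map_quad (𝒱 := 𝒱) hu
  ((measM 𝒱 ε u).map (quad 𝒱 ε)).toTemperedDistribution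

theorem rieszDistribution_apply {u : Fin r → ℝ} (hu : u ∈ RPlus ε) (f : 𝓢(ZSp 𝒱, ℂ)) :
    rieszDistribution 𝒱 hu f = ∫ y, f y ∂(measM 𝒱 ε u).map (quad 𝒱 ε) := by
  have := hasTemperateGrowth_map_quad (𝒱 := 𝒱) hu
  exact Measure.toTemperedDistribution_apply _ _

theorem rieszDistribution_apply_eq_integral_quad {u : Fin r → ℝ} (hu : u ∈ RPlus ε)
    (f : 𝓢(ZSp 𝒱, ℂ)) :
    rieszDistribution 𝒱 hu f = ∫ x, f (quad 𝒱 ε x) ∂measM 𝒱 ε u := by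
  rw [rieszDistribution_apply, integral_map measurable_quad.aemeasurable
    f.continuous.aestronglyMeasurable]

theorem isGindikinRiesz_rieszDistribution {u : Fin r → ℝ} (hu : u ∈ RPlus ε) :
    IsGindikinRiesz 𝒱 (fun k => ((u k + (pPar 𝒱 ε k : ℝ) / 2 : ℝ) : ℂ))
      (rieszDistribution 𝒱 hu) := by
  refine ⟨fun y hy => ?_, fun θ hθ => ⟨exists_schwartzMap_eq_exp_near_cone hθ, fun f hf => ?_⟩⟩
  · refine (Distribution.mem_dsupport_iff _).1 hy _ (fun f hf => ?_) isClosed_closure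
    rw [rieszDistribution_apply_eq_integral_quad]
    refine integral_eq_zero_of_ae (.of_forall fun x => ?_)
    by_contra h
    exact hf (subset_tsupport _ h) (quad_mem_closure_cone x)
  · obtain ⟨T, hT, hD⟩ := DeltaStar_neg (ε := ε) hθ u
    rw [hD, ← integral_cexp_inner_quad hu hT, rieszDistribution_apply_eq_integral_quad]
    exact integral_congr_ae (.of_forall fun x =>
      hf.self_of_nhdsSet _ (quad_mem_closure_cone x))

/-! ### Uniqueness -/

theorem IsGindikinRiesz.unique {σ : Fin r → ℂ} {R R' : 𝓢'(ZSp 𝒱, ℂ)}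
    (hR : IsGindikinRiesz 𝒱 σ R) (hR' : IsGindikinRiesz 𝒱 σ R') : R = R' := by
  let D : 𝓢(ZSp 𝒱, ℂ) →L[ℂ] ℂ :=
    { toFun := fun f => R f - R' f
      map_add' := fun f g => by simp only [map_add]; ring
      map_smul' := fun c f => by simp only [map_smul, smul_eq_mul, RingHom.id_apply]; ring
      cont := (map_continuous R).sub (map_continuous R') }
  have hu : -(-unitZ 𝒱) ∈ dualCone 𝒱 := by
    rw [neg_neg]
    exact unitZ_mem_dualCone
  obtain ⟨c, hc, h⟩ := exists_inner_le_of_neg_mem_dualCone hu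
  have hD : D = 0 := by
    refine SchwartzMap.eq_zero_of_laplace_eq_zero D hc h fun θ hθ f hf => ?_
    have hθ' : -θ ∈ dualCone 𝒱 := by
      intro y hy hy0
      have h1 := h y hy
      have h2 : inner ℝ y (θ - -unitZ 𝒱) ≤ ‖y‖ * ‖θ - -unitZ 𝒱‖ := real_inner_le_norm _ _
      rw [inner_sub_right] at h2
      have h3 : ‖y‖ * ‖θ - -unitZ 𝒱‖ < ‖y‖ * c := mul_lt_mul_of_pos_left hθ (norm_pos_iff.2 hy0)
      rw [inner_neg_right]
      linarith
    change R f - R' f = 0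
    rw [(hR.2 θ hθ').2 f hf, (hR'.2 θ hθ').2 f hf, sub_self]
  refine DFunLike.ext _ _ fun f => sub_eq_zero.1 ?_
  exact congrArg (fun D : 𝓢(ZSp 𝒱, ℂ) →L[ℂ] ℂ => D f) hD

end GindikinRiesz

theorem mainTheorem9 {r : ℕ} {n : Fin r → ℕ} (𝒱 : BlockSystem r n) (ε : Fin r → Fin 2)
    (hε : ε ≠ 0) (u : Fin r → ℝ) (hu : u ∈ RPlus ε) :
    ∃ R : 𝓢'(ZSp 𝒱, ℂ),
      IsGindikinRiesz 𝒱 (fun k => ((u k + (pPar 𝒱 ε k : ℝ) / 2 : ℝ) : ℂ)) R ∧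
      (∀ R' : 𝓢'(ZSp 𝒱, ℂ),
        IsGindikinRiesz 𝒱 (fun k => ((u k + (pPar 𝒱 ε k : ℝ) / 2 : ℝ) : ℂ)) R' → R' = R) ∧
      (∀ f : 𝓢(ZSp 𝒱, ℂ),
        Integrable f ((measM 𝒱 ε u).map (quad 𝒱 ε)) ∧
          R f = ∫ y, f y ∂((measM 𝒱 ε u).map (quad 𝒱 ε))) ∧
      ((measM 𝒱 ε u).map (quad 𝒱 ε)) (orbit 𝒱 ε)ᶜ = 0 := by
  refine ⟨rieszDistribution 𝒱 hu, isGindikinRiesz_rieszDistribution hu,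
    fun R' hR' => hR'.unique (isGindikinRiesz_rieszDistribution hu),
    fun f => ⟨?_, rieszDistribution_apply hu f⟩, map_quad_compl_orbit u⟩
  have := hasTemperateGrowth_map_quad (𝒱 := 𝒱) hu
  exact f.integrable
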